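/- Consider four pendula with indices taken mod $4$, and let $V(x)=-\cos x-1$. Let $\eta:[0,\infty)\to\mathbb R$ be a bump profile, i.e. $\eta(t)>0$ for $0\le t<1$, $\eta(t)=0$ for $t\ge 1$, and $x\mapsto\eta(|x|)$ is $C^\infty$ on $\mathbb R^3$. Fix a real number $r\ge 3$ and, for $\varepsilon>0$, put $$\beta(x,\varepsilon)=\varepsilon^r\sum_{n\in\mathbb Z^3}\eta\!\left(\frac{|x-2\pi n|}{\varepsilon}\right),\qquad x\in\mathbb R^3 .$$ For a sign $\kappa\in\{1,-1\}$ consider on $\mathbb R^4$ the Jacobi metric of energy $1$, $$d\rho(\mathbf x)=\sqrt{\,1-\sum_{i=1}^4\bigl(V(x_i)+\kappa\,\varepsilon\,\beta(x_{i-1},x_i,x_{i+1},\varepsilon)\bigr)}\;ds ,$$ where $ds$ is the Euclidean line element ($\kappa=1$ belongs to the Hamiltonian $\sum_i \frac12 y_i^2+V(x_i)+\varepsilon\beta(x_{i-1},x_i,x_{i+1},\varepsilon)$). For an index $j$ mod $4$ and $a\in\mathbb Z^4$, let $c=c(j,a)\in\mathbb R^4$ be the point with $c_i=2\pi a_i$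 for $i\neq j+3$ and $c_{j+3}=2\pi a_{j+3}+\pi$, and let $\Sigma(j,a)$ be the section with centre $c$, $$\Sigma(j,a)=\{x\in\mathbb R^4:\ x_{j+2}=c_{j+2},\ (x_j-c_j)^2+(x_{j+1}-c_{j+1})^2\le\varepsilon,\ |x_{j+3}-c_{j+3}|\le\sqrt\varepsilon\}.$$ There exists $\varepsilon_0>0$ (depending only on $\eta$ and $r$) such that for all $0<\varepsilon<\varepsilon_0$ and either sign $\kappa$ the following holds. Let $\Sigma_0=\Sigma(j_0,a_0)$ and $\Sigma_1=\Sigma(j_1,a_1)$ be two sections with $\mathrm{Center}(\Sigma_1)-\mathrm{Center}(\Sigma_0)=2\pi\vec n$, where $|\vec n|>1/\varepsilon$ and, listing the coordinates in the order $j_0,j_0+1,j_0+2,j_0+3$, either $j_1=j_0$ and $\vec n=(m,n,1,0)$ with $m,n\in\mathbb Z$, or $j_1=j_0+1$ and $\vec n=(\tfrac12,s,1,\tfrac12)$ with $s\in\mathbb Z$. Then for all $p_0\in\Sigma_0$ and $p_1\in\Sigma_1$ there is a geodesic $\gamma(p_0,p_1):[0,1]\to\mathbb R^4$ of the Jacobi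 metric with $\gamma(p_0,p_1)(0)=p_0$ and $\gamma(p_0,p_1)(1)=p_1$, and it can be chosen so as to depend smoothly on $p_0$ and $p_1$: the map $(p_0,p_1,t)\mapsto\gamma(p_0,p_1)(t)$ on $\Sigma_0\times\Sigma_1\times[0,1]$ extends to a $C^\infty$ map on an open neighbourhood of this set. -/

import Mathlib

open scoped ContDiff

noncomputable section

namespace PendulumLattice

/-- The configuration space `ℝ⁴` of four pendula with its Euclidean structure. Pendula are indexed
by `Fin 4`, whose addition and subtraction are modulo `4`, so the chain is periodic. -/
abbrev Config : Type := EuclideanSpace ℝ (Fin 4)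

/-- The potential of a single pendulum. -/
def pendulumPotential (x : ℝ) : ℝ := -Real.cos x - 1

/-- `η` is the profile of a smooth bump function: positive on `[0, 1)`, zero on `[1, ∞)`, and such
that the radial function `x ↦ η |x|` on `ℝ³` is of class `C^∞` (only the values of `η` on `[0, ∞)`
matter). -/
structure IsBumpProfile (η : ℝ → ℝ) : Prop where
  smooth : ContDiff ℝ ∞ (fun x : EuclideanSpace ℝ (Fin 3) => η ‖x‖)
  pos : ∀ t : ℝ, 0 ≤ t → t < 1 → 0 < η t
  zero : ∀ t : ℝ, 1 ≤ t → η t = 0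

/-- The localized coupling `β(x, ε) = ε ^ r ∑_{n ∈ ℤ³} η (|x - 2 π n| / ε)` on `ℝ³`. -/
def coupling (η : ℝ → ℝ) (r ε : ℝ) (x : EuclideanSpace ℝ (Fin 3)) : ℝ :=
  ε ^ r * ∑' n : Fin 3 → ℤ,
    η (‖x - WithLp.toLp 2 (fun i => 2 * Real.pi * (n i : ℝ))‖ / ε)

/-- The conformal factor
`1 - ∑ i, (V (x_i) + κ ε β (x_{i-1}, x_i, x_{i+1}, ε))`, with a sign `κ`. -/
def jacobiFactor (η : ℝ → ℝ) (r κ ε : ℝ) (x : Config) : ℝ :=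
  1 - ∑ i : Fin 4,
    (pendulumPotential (x i) + κ * ε * coupling η r ε !₂[x (i - 1), x i, x (i + 1)])

/-- The metric tensor of the Jacobi metric `dρ = √(jacobiFactor) ds` at energy `1`, where `ds` is
the Euclidean line element. -/
def jacobiMetric (η : ℝ → ℝ) (r κ ε : ℝ) (x : Config) : Matrix (Fin 4) (Fin 4) ℝ :=
  jacobiFactor η r κ ε x • (1 : Matrix (Fin 4) (Fin 4) ℝ)

/-- The partial derivative in the direction of the `i`-th coordinate. -/
def partialDeriv (i : Fin 4) (f : Config → ℝ) (x : Config) : ℝ :=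
  fderiv ℝ f x (EuclideanSpace.single i (1 : ℝ))

/-- The Christoffel symbol `Γ^k_{ij}` of a Riemannian metric `g` on `ℝ⁴`. -/
def christoffel (g : Config → Matrix (Fin 4) (Fin 4) ℝ) (k i j : Fin 4) (x : Config) : ℝ :=
  (1 / 2) * ∑ l : Fin 4, (g x)⁻¹ k l *
    (partialDeriv i (fun y => g y j l) x + partialDeriv j (fun y => g y i l) x
      - partialDeriv l (fun y => g y i j) x)

/-- `c` is an (affinely parametrized) geodesic of the metric `g` on the interval `I`:
`c'' ^ k = - ∑ i j, Γ^k_{ij} (c) c' ^ i c' ^ j`, with one-sided derivatives at end points. -/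
def IsGeodesicOn (g : Config → Matrix (Fin 4) (Fin 4) ℝ) (c : ℝ → Config) (I : Set ℝ) : Prop :=
  ∃ v : ℝ → Config, ∀ t ∈ I,
    HasDerivWithinAt c (v t) I t ∧
    HasDerivWithinAt v
      (WithLp.toLp 2 (fun k => -∑ i : Fin 4, ∑ j : Fin 4,
        christoffel g k i j (c t) * v t i * v t j)) I t

/-- A map is smooth on an arbitrary subset if it is (the restriction of a map that is) of class
`C^∞` on an open neighbourhood of that subset. -/
def SmoothOnSubset {E F : Type*} [NormedAddCommGroup E] [NormedSpace ℝ E]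
    [NormedAddCommGroup F] [NormedSpace ℝ F] (f : E → F) (A : Set E) : Prop :=
  ∃ U : Set E, IsOpen U ∧ A ⊆ U ∧ ContDiffOn ℝ ∞ f U

/-- The centre of the section in which the pendula `j` and `j + 1` exchange energy, `j + 2` is the
facilitator and `j + 3` stands upside down, translated by `2 π a` with `a ∈ ℤ⁴`. -/
def center (j : Fin 4) (a : Fin 4 → ℤ) : Config :=
  WithLp.toLp 2 (fun i => 2 * Real.pi * (a i : ℝ) + if i = j + 3 then Real.pi else 0)

/-- The section with the above centre: for `j` the first pendulum and `a = 0` it is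
`x₃ = 0`, `x₁² + x₂² ≤ ε`, `|x₄ - π| ≤ √ε`. -/
def crossSection (ε : ℝ) (j : Fin 4) (a : Fin 4 → ℤ) : Set Config :=
  {x | x (j + 2) = center j a (j + 2) ∧
    (x j - center j a j) ^ 2 + (x (j + 1) - center j a (j + 1)) ^ 2 ≤ ε ∧
    |x (j + 3) - center j a (j + 3)| ≤ √ε}

/-- The vector `(m, n, 1, 0)`, with the index shifted by `j`. -/
def transferVector (j : Fin 4) (m n : ℤ) : Config :=
  WithLp.toLp 2 (fun i =>
    if i = j then (m : ℝ) else if i = j + 1 then (n : ℝ) else if i = j + 2 then 1 else 0)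

/-- The vector `(1/2, s, 1, 1/2)`, with the index shifted by `j`. -/
def advanceVector (j : Fin 4) (s : ℤ) : Config :=
  WithLp.toLp 2 (fun i =>
    if i = j then (1 / 2 : ℝ) else if i = j + 1 then (s : ℝ)
    else if i = j + 2 then 1 else 1 / 2)

/-- The section `(j₁, a₁)` may follow the section `(j₀, a₀)` in an itinerary, `2 π ν` being the
vector from the centre of `(j₀, a₀)` to that of `(j₁, a₁)`: either both belong to the
same string and `ν = (m, n, 1, 0)`, or the second one starts the next string and
`ν = (1/2, s, 1, 1/2)`, up to a shift of the index. -/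
def IsItineraryStep (j₀ : Fin 4) (a₀ : Fin 4 → ℤ) (j₁ : Fin 4) (a₁ : Fin 4 → ℤ)
    (ν : Config) : Prop :=
  center j₁ a₁ = center j₀ a₀ + (2 * Real.pi) • ν ∧
    ((j₁ = j₀ ∧ ∃ m n : ℤ, ν = transferVector j₀ m n) ∨
      (j₁ = j₀ + 1 ∧ ∃ s : ℤ, ν = advanceVector j₀ s))

end PendulumLattice

end

/-!
Where the coupling vanishes the four pendula are independent, and there a motion of total energy
one, reparametrized, is a geodesic of the Jacobi metric (`isGeodesicOn_of_motion`). The geodesics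
are found by solving the boundary value problem for the uncoupled pendula, and by treating the
coupling as a small perturbation of the end points.

*Uncoupled pendula.* For a single pendulum that has to get from the neighbourhood of one position
to that of another there is a smooth family of motions, parametrized by the displacements of the
end points and by the duration `T` (`IsSwingFamily`). There are two kinds. Rotations have positive
energy; their duration is an integral of the inverse speed, which decreases from infinity to zero
as the energy grows from zero, and it is inverted for the energy (`exists_rotation_family`). The
other motions linger near the upright equilibrium and have energy `O(T⁻²)`. They are explicit in
the coordinate `s = sin (u / 2)`, where `u` is the displacement from the upright position: this
solves `s'' = s` in a new time (`exists_linger_family`). All four pendula are given the same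
duration. When the total energy equals one it is strictly decreasing in `T`. For large `T` it is
below one, and because the displacement between the sections is large one of the swings is long, so
that it is at least one for some `T` (`exists_one_le_totalEnergy`). The implicit function theorem
therefore gives a duration, smooth in the end points, for which the total energy is one
(`exists_free_motion`). The derivatives of the end velocities with respect to the end points are
bounded independently of the length of the swings.

*Coupling.* The coupling acts only where three neighbouring pendula are near the bottom. Two of the
pendula, the one that makes a full turn or half of one and the one that starts upright, stay away
from the bottom except during the first and the last unit of time (`StaysAway`), so that the
coupling vanishes in between. Every coupled motion with the same middle part differs from the
uncoupled motion only by the effect of the coupling during these two units of time. The coupling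
is small together with its first two derivatives, as the scale `ε` of its support costs two factors
`ε⁻¹` and its amplitude is `ε ^ (r + 1)` with `r ≥ 3` (`exists_isSmallCoupling`). By Grönwall's
inequality the effect is then small and has a small Lipschitz constant (`scattering_bounds`). The
map from the end points of the uncoupled motion to those of the coupled motion is therefore close to
the identity, and it has a smooth inverse (`exists_inverse_near_id`, `exists_geodesics`).
-/

open scoped ContDiff

noncomputable section

namespace PendulumLattice

open Set Filter Topology

/-! ### Composition operators on spaces of continuous functions -/

/-- The pointwise application `(A, u) ↦ (s ↦ A s (u s))` on continuous functions over a compact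
space, as a continuous bilinear map. -/
def pointwiseApply (K E F : Type) [TopologicalSpace K] [CompactSpace K]
    [NormedAddCommGroup E] [NormedSpace ℝ E] [NormedAddCommGroup F] [NormedSpace ℝ F] :
    C(K, E →L[ℝ] F) →L[ℝ] C(K, E) →L[ℝ] C(K, F) :=
  LinearMap.mkContinuous₂
    (LinearMap.mk₂ ℝ
      (fun (A : C(K, E →L[ℝ] F)) (u : C(K, E)) =>
        (⟨fun s => A s (u s), A.continuous.clm_apply u.continuous⟩ : C(K, F)))
      (fun A B u => by ext s; simp) (fun c A u => by ext s; simp)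
      (fun A u v => by ext s; simp) (fun c A u => by ext s; simp)) 1 (by
    intro A u
    rw [ContinuousMap.norm_le _ (by positivity)]
    intro s
    calc ‖A s (u s)‖ ≤ ‖A s‖ * ‖u s‖ := (A s).le_opNorm _
      _ ≤ 1 * ‖A‖ * ‖u‖ := by
        rw [one_mul]
        gcongr
        · exact A.norm_coe_le_norm s
        · exact u.norm_coe_le_norm s)

@[simp] lemma pointwiseApply_apply {K E F : Type} [TopologicalSpace K] [CompactSpace K]
    [NormedAddCommGroup E] [NormedSpace ℝ E] [NormedAddCommGroup F] [NormedSpace ℝ F]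
    (A : C(K, E →L[ℝ] F)) (u : C(K, E)) (s : K) : pointwiseApply K E F A u s = A s (u s) := rfl

/-- The composition operator `u ↦ f ∘ u` on continuous functions. -/
def postcomp (K : Type) [TopologicalSpace K] {E F : Type} [TopologicalSpace E]
    [TopologicalSpace F] (f : E → F) (hf : Continuous f) (u : C(K, E)) : C(K, F) :=
  (⟨f, hf⟩ : C(E, F)).comp u

lemma hasFDerivAt_postcomp {K E F : Type} [TopologicalSpace K] [CompactSpace K]
    [NormedAddCommGroup E] [NormedSpace ℝ E] [NormedAddCommGroup F] [NormedSpace ℝ F]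
    {f : E → F} (hf : ContDiff ℝ 1 f) (u : C(K, E)) :
    HasFDerivAt (postcomp K f hf.continuous)
      (pointwiseApply K E F (postcomp K (fderiv ℝ f) (hf.continuous_fderiv one_ne_zero) u)) u := by
  have hD : Continuous (fderiv ℝ f) := hf.continuous_fderiv one_ne_zero
  rw [hasFDerivAt_iff_isLittleO_nhds_zero, Asymptotics.isLittleO_iff]
  intro c hc
  have hcont : Continuous (postcomp K (fderiv ℝ f) hD) := ContinuousMap.continuous_postcomp _
  obtain ⟨δ, hδ, hδ'⟩ := (Metric.continuousAt_iff (f := postcomp K (fderiv ℝ f) hD)).1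
    hcont.continuousAt c hc
  rw [Metric.eventually_nhds_iff]
  refine ⟨δ, hδ, fun h hh => ?_⟩
  rw [dist_zero_right] at hh
  rw [ContinuousMap.norm_le _ (by positivity)]
  intro s
  have key : ∀ x ∈ segment ℝ (u s) (u s + h s), ‖fderiv ℝ f x - fderiv ℝ f (u s)‖ ≤ c := by
    intro x hx
    rw [segment_eq_image'] at hx
    obtain ⟨θ, hθ, rfl⟩ := hx
    have h1 : dist (u + θ • h) u < δ := by
      rw [dist_eq_norm, add_sub_cancel_left, norm_smul, Real.norm_eq_abs, abs_of_nonneg hθ.1]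
      nlinarith [norm_nonneg h, hθ.2]
    have h2 := (ContinuousMap.dist_apply_le_dist s).trans (hδ' h1).le
    rw [dist_eq_norm] at h2
    simpa [postcomp] using h2
  have h3 := (convex_segment (𝕜 := ℝ) (u s) (u s + h s)).norm_image_sub_le_of_norm_hasFDerivWithin_le'
    (f := f) (f' := fderiv ℝ f) (φ := fderiv ℝ f (u s)) (C := c)
    (fun x _ => ((hf.differentiable one_ne_zero) x).hasFDerivAt.hasFDerivWithinAt)
    key (left_mem_segment ℝ _ _) (right_mem_segment ℝ _ _)
  rw [add_sub_cancel_left] at h3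
  refine le_trans ?_ (h3.trans ?_)
  · simp [postcomp]
  · gcongr
    exact h.norm_coe_le_norm s

lemma contDiff_postcomp_nat {K : Type} [TopologicalSpace K] [CompactSpace K] (n : ℕ) :
    ∀ {E F : Type} [NormedAddCommGroup E] [NormedSpace ℝ E] [NormedAddCommGroup F]
      [NormedSpace ℝ F] {f : E → F} (hf : ContDiff ℝ n f),
      ContDiff ℝ n (postcomp K f hf.continuous) := by
  induction n with
  | zero =>
    intro E F _ _ _ _ f hf
    exact contDiff_zero.2 (ContinuousMap.continuous_postcomp _)
  | succ n ih =>
    intro E F _ _ _ _ f hf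
    have h1 : ContDiff ℝ 1 f := hf.of_le (by exact_mod_cast Nat.le_add_left 1 n)
    have hD : ContDiff ℝ n (fderiv ℝ f) :=
      hf.fderiv_right (m := n) (by exact_mod_cast le_refl (n + 1))
    push_cast
    rw [contDiff_succ_iff_hasFDerivAt]
    refine ⟨fun u => pointwiseApply K E F (postcomp K (fderiv ℝ f) hD.continuous u), ?_,
      fun u => hasFDerivAt_postcomp h1 u⟩
    exact (pointwiseApply K E F).contDiff.comp (ih hD)

/-- The composition operator of a smooth map is smooth on the space of continuous functions. -/
lemma contDiff_postcomp {K E F : Type} [TopologicalSpace K] [CompactSpace K]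
    [NormedAddCommGroup E] [NormedSpace ℝ E] [NormedAddCommGroup F] [NormedSpace ℝ F]
    {f : E → F} (hf : ContDiff ℝ ∞ f) : ContDiff ℝ ∞ (postcomp K f hf.continuous) :=
  contDiff_infty.2 fun n => contDiff_postcomp_nat n (contDiff_infty.1 hf n)

/-! ### Integrals depending on a parameter -/

/-- The primitive `u ↦ (s ↦ ∫ r in 0..s, u r)` of continuous functions on the unit interval. -/
def primitive (E : Type) [NormedAddCommGroup E] [NormedSpace ℝ E] [CompleteSpace E] :
    C(unitInterval, E) →L[ℝ] C(unitInterval, E) :=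
  LinearMap.mkContinuous
    { toFun := fun u => ⟨fun s => ∫ r in (0 : ℝ)..s, IccExtend zero_le_one u r,
        (intervalIntegral.continuous_primitive
          (fun a b => (u.continuous.Icc_extend' (h := zero_le_one)).intervalIntegrable a b) 0).comp
            continuous_subtype_val⟩
      map_add' := fun u v => by
        ext s
        simp only [ContinuousMap.coe_mk, ContinuousMap.add_apply]
        rw [← intervalIntegral.integral_add
          ((u.continuous.Icc_extend' (h := zero_le_one)).intervalIntegrable _ _)
          ((v.continuous.Icc_extend' (h := zero_le_one)).intervalIntegrable _ _)]
        rfl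
      map_smul' := fun c u => by
        ext s
        simp only [ContinuousMap.coe_mk, ContinuousMap.smul_apply, RingHom.id_apply]
        rw [← intervalIntegral.integral_smul]
        rfl } 1 (by
    intro u
    rw [ContinuousMap.norm_le _ (by positivity)]
    intro s
    have := intervalIntegral.norm_integral_le_of_norm_le_const (a := 0) (b := (s : ℝ)) (C := ‖u‖)
      (f := IccExtend zero_le_one u) (fun r _ => u.norm_coe_le_norm _)
    refine this.trans ?_
    rw [sub_zero, abs_of_nonneg s.2.1, one_mul]
    exact mul_le_of_le_one_right (norm_nonneg _) s.2.2)

lemma primitive_apply {E : Type} [NormedAddCommGroup E] [NormedSpace ℝ E] [CompleteSpace E]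
    (u : C(unitInterval, E)) (s : unitInterval) :
    primitive E u s = ∫ r in (0 : ℝ)..s, IccExtend zero_le_one u r := rfl

lemma norm_primitive_apply_le {E : Type} [NormedAddCommGroup E] [NormedSpace ℝ E] [CompleteSpace E]
    (u : C(unitInterval, E)) : ‖primitive E u‖ ≤ ‖u‖ := by
  simpa using (LinearMap.mkContinuous_norm_le _ zero_le_one _ : ‖primitive E‖ ≤ 1) |>
    fun h => (primitive E).le_of_opNorm_le h u

/-- The curve `s ↦ (p, s)` over the unit interval, as a function of `p`. -/
def constProdId (E : Type) [NormedAddCommGroup E] [NormedSpace ℝ E] (p : E) :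
    C(unitInterval, E × ℝ) := ⟨fun s => (p, (s : ℝ)), by fun_prop⟩

lemma contDiff_const_curve (E : Type) [NormedAddCommGroup E] [NormedSpace ℝ E] :
    ContDiff ℝ ∞ (fun p : E => ContinuousMap.const unitInterval p) := by
  have : IsBoundedLinearMap ℝ (fun p : E => ContinuousMap.const unitInterval p) :=
    { map_add := fun p q => by ext s; simp
      map_smul := fun c p => by ext s; simp
      bound := ⟨1, one_pos, fun p => by
        rw [ContinuousMap.norm_le _ (by positivity)]; intro s; simp⟩ }
  exact this.contDiff

lemma hasFDerivAt_constProdId (E : Type) [NormedAddCommGroup E] [NormedSpace ℝ E] :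
    ∃ L : E →L[ℝ] C(unitInterval, E × ℝ), (∀ v s, L v s = (v, 0)) ∧
      ∀ p, HasFDerivAt (constProdId E) L p := by
  have hL : IsBoundedLinearMap ℝ
      (fun p : E => ContinuousMap.const unitInterval ((p, 0) : E × ℝ)) :=
    { map_add := fun p q => by ext s <;> simp
      map_smul := fun c p => by ext s <;> simp
      bound := ⟨1, one_pos, fun p => by
        rw [ContinuousMap.norm_le _ (by positivity)]; intro s; simp⟩ }
  let L : E →L[ℝ] C(unitInterval, E × ℝ) := hL.toContinuousLinearMap
  refine ⟨L, fun v s => rfl, fun p => ?_⟩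
  have h : constProdId E = fun p => L p + constProdId E 0 := by
    funext p
    ext s
    · change p = p + 0
      rw [add_zero]
    · change (s : ℝ) = 0 + s
      rw [zero_add]
  rw [h]
  exact L.hasFDerivAt.add_const _

lemma contDiff_constProdId (E : Type) [NormedAddCommGroup E] [NormedSpace ℝ E] :
    ContDiff ℝ ∞ (constProdId E) := by
  obtain ⟨L, -, hL⟩ := hasFDerivAt_constProdId E
  rw [contDiff_infty_iff_fderiv]
  refine ⟨fun p => (hL p).differentiableAt, ?_⟩
  have : fderiv ℝ (constProdId E) = fun _ => L := funext fun p => (hL p).fderiv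
  rw [this]
  exact contDiff_const

lemma integral_eq_primitive {E F : Type} [NormedAddCommGroup E] [NormedSpace ℝ E]
    [NormedAddCommGroup F] [NormedSpace ℝ F] [CompleteSpace F] {g : E × ℝ → F} (hg : Continuous g)
    (p : E) : ∫ s in (0 : ℝ)..1, g (p, s) = primitive F (postcomp _ g hg (constProdId E p)) 1 := by
  rw [primitive_apply]
  refine intervalIntegral.integral_congr fun s hs => ?_
  rw [uIcc_of_le zero_le_one] at hs
  simp only [IccExtend, Function.comp, projIcc_of_mem zero_le_one hs]
  rfl

/-- Integrals of smooth functions over a compact interval depend smoothly on parameters. -/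
lemma contDiff_parametric_integral {E F : Type} [NormedAddCommGroup E] [NormedSpace ℝ E]
    [NormedAddCommGroup F] [NormedSpace ℝ F] [CompleteSpace F] {g : E × ℝ → F}
    (hg : ContDiff ℝ ∞ g) : ContDiff ℝ ∞ fun p => ∫ s in (0 : ℝ)..1, g (p, s) := by
  have h : (fun p => ∫ s in (0 : ℝ)..1, g (p, s)) = fun p =>
      ContinuousMap.evalCLM ℝ (1 : unitInterval)
        (primitive F (postcomp unitInterval g hg.continuous (constProdId E p))) :=
    funext fun p => integral_eq_primitive hg.continuous p
  rw [h]
  exact (ContinuousMap.evalCLM ℝ (1 : unitInterval) : C(unitInterval, F) →L[ℝ] F).contDiff.comp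
    ((primitive F).contDiff.comp
    ((contDiff_postcomp hg).comp (contDiff_constProdId E)))

/-- Differentiation of a parametric integral under the integral sign. -/
lemma fderiv_parametric_integral {E F : Type} [NormedAddCommGroup E] [NormedSpace ℝ E]
    [NormedAddCommGroup F] [NormedSpace ℝ F] [CompleteSpace F] {g : E × ℝ → F}
    (hg : ContDiff ℝ ∞ g) (p v : E) :
    fderiv ℝ (fun p => ∫ s in (0 : ℝ)..1, g (p, s)) p v =
      ∫ s in (0 : ℝ)..1, fderiv ℝ g (p, s) (v, 0) := by
  obtain ⟨L, hLv, hL⟩ := hasFDerivAt_constProdId E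
  have h1 : ContDiff ℝ 1 g := hg.of_le (by exact_mod_cast le_top)
  have h : (fun p => ∫ s in (0 : ℝ)..1, g (p, s)) = fun p =>
      ContinuousMap.evalCLM ℝ (1 : unitInterval)
        (primitive F (postcomp unitInterval g hg.continuous (constProdId E p))) :=
    funext fun p => integral_eq_primitive hg.continuous p
  have h2 := (ContinuousLinearMap.hasFDerivAt (ContinuousMap.evalCLM ℝ (1 : unitInterval) :
    C(unitInterval, F) →L[ℝ] F)).comp p
    ((primitive F).hasFDerivAt.comp p ((hasFDerivAt_postcomp h1 (constProdId E p)).comp p (hL p)))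
  have h3 : Continuous fun q : E × ℝ => fderiv ℝ g q (v, 0) :=
    (h1.continuous_fderiv one_ne_zero).clm_apply continuous_const
  rw [(congrArg (fun f => fderiv ℝ f p) h).trans h2.fderiv, integral_eq_primitive h3]
  simp only [ContinuousLinearMap.comp_apply, ContinuousMap.evalCLM_apply]
  congr 2
  ext s
  simp [postcomp, hLv]

/-! ### Smooth flows of globally Lipschitz vector fields -/

/-- `Φ` is the (complete) flow of the autonomous vector field `X`. -/
structure IsFlow {E : Type} [NormedAddCommGroup E] [NormedSpace ℝ E] (X : E → E)
    (Φ : ℝ → E → E) : Prop where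
  zero : ∀ z, Φ 0 z = z
  deriv : ∀ z t, HasDerivAt (fun s => Φ s z) (X (Φ t z)) t

section Flow

variable {E : Type} [NormedAddCommGroup E] [NormedSpace ℝ E] {X : E → E} {Φ : ℝ → E → E}
  {K : NNReal}

lemma IsFlow.eq_of_hasDerivAt (hΦ : IsFlow X Φ) (hX : LipschitzWith K X) {c : ℝ → E}
    (hc : ∀ t, HasDerivAt c (X (c t)) t) (t : ℝ) : c t = Φ t (c 0) := by
  have := ODE_solution_unique_univ (v := fun _ => X) (s := fun _ => univ) (t₀ := 0) (f := c)
    (g := fun t => Φ t (c 0)) (K := K) (fun _ => hX.lipschitzOnWith)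
    (fun t => ⟨hc t, mem_univ _⟩) (fun t => ⟨hΦ.deriv _ t, mem_univ _⟩) (hΦ.zero _).symm
  exact congrFun this t

lemma IsFlow.add (hΦ : IsFlow X Φ) (hX : LipschitzWith K X) (s t : ℝ) (z : E) :
    Φ (t + s) z = Φ t (Φ s z) := by
  have := hΦ.eq_of_hasDerivAt hX (c := fun t => Φ (t + s) z)
    (fun t => by simpa using (hΦ.deriv z (t + s)).comp_add_const t s) t
  simpa using this

lemma IsFlow.neg_apply (hΦ : IsFlow X Φ) (hX : LipschitzWith K X) (t : ℝ) (z : E) :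
    Φ (-t) (Φ t z) = z := by
  rw [← hΦ.add hX, neg_add_cancel, hΦ.zero]

/-- A solution on a compact time interval follows the flow. -/
lemma IsFlow.eq_of_hasDerivWithinAt (hΦ : IsFlow X Φ) (hX : LipschitzWith K X) {c : ℝ → E}
    {t₀ t₁ : ℝ} (hc : ∀ t ∈ Icc t₀ t₁, HasDerivWithinAt c (X (c t)) (Icc t₀ t₁) t) {t : ℝ}
    (ht : t ∈ Icc t₀ t₁) : c t = Φ (t - t₀) (c t₀) := by
  have := ODE_solution_unique (v := fun _ => X) (K := K) (fun _ => hX) (f := c)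
    (g := fun t => Φ (t - t₀) (c t₀)) (a := t₀) (b := t₁)
    (fun t ht => (hc t ht).continuousWithinAt)
    (fun t ht => (hc t (Ico_subset_Icc_self ht)).mono_of_mem_nhdsWithin
      (Icc_mem_nhdsGE_of_mem ht))
    (fun t _ => (((hΦ.deriv _ _).comp_sub_const t t₀).continuousAt).continuousWithinAt)
    (fun t _ => ((hΦ.deriv _ _).comp_sub_const t t₀).hasDerivWithinAt) (by simp [hΦ.zero])
  exact this ht

variable [CompleteSpace E]

open Manifold in
/-- A globally Lipschitz `C^1` vector field is complete. -/
lemma exists_isFlow (hX : LipschitzWith K X) (hX1 : ContDiff ℝ 1 X) : ∃ Φ, IsFlow X Φ := by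
  have key : ∀ x : E, ∃ γ : ℝ → E, γ 0 = x ∧ IsMIntegralCurve (I := 𝓘(ℝ, E)) γ X := by
    refine exists_isMIntegralCurve_of_isMIntegralCurveOn (I := 𝓘(ℝ, E)) (v := X)
      (contMDiff_vectorSpace_iff_contDiff.2 hX1) (ε := 1 / (2 * (K + 1))) (by positivity) ?_
    intro x
    set ε : ℝ := 1 / (2 * (K + 1)) with hε
    have hε0 : 0 < ε := by positivity
    have hpl : IsPicardLindelof (fun _ => X) (tmin := -ε) (tmax := ε) ⟨0, by constructor <;> linarith⟩
        x (‖X x‖₊ + 1) 0 ((K + 1) * (‖X x‖₊ + 1)) K :=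
      { lipschitzOnWith := fun _ _ => hX.lipschitzOnWith
        continuousOn := fun _ _ => continuousOn_const
        norm_le := fun _ _ y hy => by
          have h1 := hX.dist_le_mul y x
          rw [Metric.mem_closedBall] at hy
          rw [dist_eq_norm] at h1
          have h2 : ‖X y‖ ≤ ‖X x‖ + K * dist y x := by
            calc ‖X y‖ = ‖X x + (X y - X x)‖ := by rw [add_sub_cancel]
              _ ≤ _ := (norm_add_le _ _).trans (by gcongr)
          push_cast at hy ⊢
          have h3 : (K : ℝ) * dist y x ≤ K * (‖X x‖ + 1) := by gcongr
          linarith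
        mul_max_le := by
          have : max (ε - 0) (0 - -ε) = ε := by simp
          simp only [this]
          push_cast
          rw [hε]
          have : ((K : ℝ) + 1) * (‖X x‖ + 1) * (1 / (2 * (K + 1))) = (‖X x‖ + 1) / 2 := by
            field_simp
          rw [this]
          linarith [norm_nonneg (X x)] }
    obtain ⟨α, h0, hα⟩ := hpl.exists_eq_forall_mem_Icc_hasDerivWithinAt₀
    refine ⟨α, h0, fun t ht => ?_⟩
    have : HasDerivAt α (X (α t)) t :=
      (hα t (Ioo_subset_Icc_self ht)).hasDerivAt (Icc_mem_nhds ht.1 ht.2)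
    exact this.hasFDerivAt.hasFDerivWithinAt.hasMFDerivWithinAt
  choose γ h0 hγ using key
  refine ⟨fun t z => γ z t, h0, fun z t => ?_⟩
  have := hγ z t
  exact hasDerivAt_iff_hasFDerivAt.2 this.hasFDerivAt

/-- The orbit segment `s ↦ Φ (t s) z`, `0 ≤ s ≤ 1`. -/
def IsFlow.orbit (hΦ : IsFlow X Φ) (t : ℝ) (z : E) : C(unitInterval, E) :=
  ⟨fun s => Φ (t * s) z, by
    have h : Continuous fun r => Φ r z :=
      continuous_iff_continuousAt.2 fun r => (hΦ.deriv z r).continuousAt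
    exact h.comp (by fun_prop)⟩

/-- The defect of a curve over the unit interval as a solution, at speed `t`, of the integral
equation with initial value `z`. -/
def integralDefect (X : E → E) (hX : Continuous X) (q : (ℝ × E) × C(unitInterval, E)) :
    C(unitInterval, E) :=
  q.2 - ContinuousMap.const unitInterval q.1.2 - q.1.1 • primitive E (postcomp _ X hX q.2)

lemma IsFlow.integralDefect_orbit (hΦ : IsFlow X Φ) (hX : Continuous X) (t : ℝ) (z : E) :
    integralDefect X hX ((t, z), hΦ.orbit t z) = 0 := by
  ext s
  have h1 : ∀ r : ℝ, HasDerivAt (fun r => Φ (t * r) z) (t • X (Φ (t * r) z)) r := fun r =>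
    HasDerivAt.scomp r (hΦ.deriv z (t * r)) (by simpa using (hasDerivAt_id r).const_mul t)
  have hc : Continuous fun r => Φ (t * r) z :=
    continuous_iff_continuousAt.2 fun r => (h1 r).continuousAt
  have h2 := intervalIntegral.integral_eq_sub_of_hasDerivAt (a := 0) (b := s) (fun r _ => h1 r)
    (((hX.comp hc).const_smul t).intervalIntegrable _ _)
  have h3 : primitive E (postcomp _ X hX (hΦ.orbit t z)) s = ∫ r in (0 : ℝ)..s, X (Φ (t * r) z) := by
    rw [primitive_apply]
    refine intervalIntegral.integral_congr fun r hr => ?_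
    rw [uIcc_of_le s.2.1] at hr
    simp only [IccExtend, Function.comp, projIcc_of_mem zero_le_one ⟨hr.1, hr.2.trans s.2.2⟩]
    rfl
  simp only [integralDefect, ContinuousMap.sub_apply, ContinuousMap.smul_apply, h3,
    ContinuousMap.const_apply, ContinuousMap.zero_apply]
  rw [← intervalIntegral.integral_smul, h2]
  simp [IsFlow.orbit, hΦ.zero]

lemma eq_of_integralDefect_eq_zero (hX : LipschitzWith K X) {t : ℝ} (ht : |t| * K < 1) {z : E}
    {u v : C(unitInterval, E)} (hu : integralDefect X hX.continuous ((t, z), u) = 0)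
    (hv : integralDefect X hX.continuous ((t, z), v) = 0) : u = v := by
  have h : u - v = t • primitive E (postcomp _ X hX.continuous u - postcomp _ X hX.continuous v) := by
    have := sub_eq_zero.2 (hu.trans hv.symm)
    simp only [integralDefect] at this
    rw [map_sub, smul_sub, ← sub_eq_zero, ← this]
    abel
  have h1 : ‖postcomp _ X hX.continuous u - postcomp _ X hX.continuous v‖ ≤ K * ‖u - v‖ := by
    rw [ContinuousMap.norm_le _ (by positivity)]
    intro s
    have := hX.dist_le_mul (u s) (v s)
    rw [dist_eq_norm, dist_eq_norm] at this
    refine this.trans ?_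
    gcongr
    exact (u - v).norm_coe_le_norm s
  have h2 : ‖u - v‖ ≤ |t| * K * ‖u - v‖ := by
    conv_lhs => rw [h]
    rw [norm_smul, Real.norm_eq_abs, mul_assoc]
    gcongr
    exact (norm_primitive_apply_le _).trans h1
  have h3 : ‖u - v‖ = 0 := by nlinarith [norm_nonneg (u - v)]
  exact sub_eq_zero.1 (norm_eq_zero.1 h3)

lemma contDiff_integralDefect (hX : ContDiff ℝ ∞ X) :
    ContDiff ℝ ∞ (integralDefect X hX.continuous) := by
  unfold integralDefect
  refine (contDiff_snd.sub ((contDiff_const_curve E).comp (contDiff_snd.comp contDiff_fst))).sub ?_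
  exact (contDiff_fst.comp contDiff_fst).smul ((primitive E).contDiff.comp
    ((contDiff_postcomp hX).comp contDiff_snd))

lemma isInvertible_id_sub {V : Type} [NormedAddCommGroup V] [NormedSpace ℝ V] [CompleteSpace V]
    (B : V →L[ℝ] V) {c : ℝ} (hc0 : 0 ≤ c) (hc : c < 1) (hB : ∀ v, ‖B v‖ ≤ c * ‖v‖) :
    (ContinuousLinearMap.id ℝ V - B).IsInvertible := by
  obtain ⟨e, he⟩ := isUnit_one_sub_of_norm_lt_one ((B.opNorm_le_bound hc0 hB).trans_lt hc)
  exact ⟨ContinuousLinearEquiv.unitsEquiv ℝ _ e, he⟩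

lemma isInvertible_partial_integralDefect (hXL : LipschitzWith K X) (hX : ContDiff ℝ ∞ X) {t : ℝ}
    (ht : |t| * K < 1) (z : E) (u : C(unitInterval, E)) :
    (fderiv ℝ (integralDefect X hX.continuous) ((t, z), u) ∘L
      .inr ℝ (ℝ × E) C(unitInterval, E)).IsInvertible := by
  have hX1 : ContDiff ℝ 1 X := hX.of_le (by exact_mod_cast le_top)
  set A := pointwiseApply unitInterval E E
    (postcomp _ (fderiv ℝ X) (hX1.continuous_fderiv one_ne_zero) u) with hA
  have hd : HasFDerivAt (fun u => integralDefect X hX.continuous ((t, z), u))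
      (ContinuousLinearMap.id ℝ _ - t • (primitive E ∘L A)) u := by
    have h1 := (primitive E).hasFDerivAt.comp u (hasFDerivAt_postcomp hX1 u)
    exact ((hasFDerivAt_id u).sub_const (ContinuousMap.const unitInterval z)).sub (h1.const_smul t)
  have heq : fderiv ℝ (integralDefect X hX.continuous) ((t, z), u) ∘L
      .inr ℝ (ℝ × E) C(unitInterval, E) =
        ContinuousLinearMap.id ℝ _ - t • (primitive E ∘L A) := by
    have h2 := ((contDiff_integralDefect hX).differentiable (by simp) ((t, z), u)).hasFDerivAt
    exact (h2.comp u (hasFDerivAt_prodMk_right (t, z) u)).unique hd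
  rw [heq]
  refine isInvertible_id_sub (t • (primitive E ∘L A)) (by positivity) ht fun h => ?_
  change ‖t • primitive E (A h)‖ ≤ _
  rw [norm_smul, Real.norm_eq_abs, mul_assoc]
  gcongr
  refine (norm_primitive_apply_le _).trans ?_
  rw [ContinuousMap.norm_le _ (by positivity)]
  intro s
  change ‖fderiv ℝ X (u s) (h s)‖ ≤ _
  refine (ContinuousLinearMap.le_opNorm _ _).trans ?_
  gcongr
  · exact norm_fderiv_le_of_lipschitz ℝ hXL
  · exact h.norm_coe_le_norm s

/-- For small times the orbit is the solution of an integral equation on the space of continuous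
curves, so that it depends smoothly on time and initial point by the implicit function theorem. -/
lemma IsFlow.contDiffAt_of_small (hΦ : IsFlow X Φ) (hXL : LipschitzWith K X)
    (hX : ContDiff ℝ ∞ X) {t : ℝ} (ht : |t| * K < 1) (z : E) :
    ContDiffAt ℝ ∞ (fun q : ℝ × E => Φ q.1 q.2) (t, z) := by
  set G := integralDefect X hX.continuous
  set w : (ℝ × E) × C(unitInterval, E) := ((t, z), hΦ.orbit t z) with hw
  have hG : ContDiffAt ℝ ∞ G w := (contDiff_integralDefect hX).contDiffAt
  have hinv : (fderiv ℝ G w ∘L .inr ℝ (ℝ × E) C(unitInterval, E)).IsInvertible :=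
    isInvertible_partial_integralDefect hXL hX ht z _
  have h0 : G w = 0 := hΦ.integralDefect_orbit hX.continuous t z
  set ψ := hG.implicitFunction (by simp) hinv with hψ
  have h1 : ContDiffAt ℝ ∞ ψ (t, z) := hG.contDiffAt_implicitFunction (by simp) hinv
  have h2 : ∀ᶠ q in 𝓝 (t, z), G (q, ψ q) = G w :=
    hG.eventually_apply_implicitFunction (by simp) hinv
  have h3 : ∀ᶠ q : ℝ × E in 𝓝 (t, z), |q.1| * K < 1 :=
    (by fun_prop : Continuous fun q : ℝ × E => |q.1| * K).continuousAt.eventually_lt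
      continuousAt_const ht
  have h4 : ContDiffAt ℝ ∞ (fun q => (ContinuousMap.evalCLM ℝ (1 : unitInterval) :
      C(unitInterval, E) →L[ℝ] E) (ψ q)) (t, z) :=
    (ContinuousLinearMap.contDiff _).contDiffAt.comp _ h1
  refine h4.congr_of_eventuallyEq ?_
  filter_upwards [h2, h3] with q hq2 hq3
  have h5 : ψ q = hΦ.orbit q.1 q.2 :=
    eq_of_integralDefect_eq_zero hXL hq3 (hq2.trans h0)
      (hΦ.integralDefect_orbit hX.continuous q.1 q.2)
  simp [h5, IsFlow.orbit]

/-- The flow of a globally Lipschitz `C^∞` vector field is jointly `C^∞` in time and initial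
value. -/
theorem IsFlow.contDiff (hΦ : IsFlow X Φ) (hXL : LipschitzWith K X) (hX : ContDiff ℝ ∞ X) :
    ContDiff ℝ ∞ (fun q : ℝ × E => Φ q.1 q.2) := by
  -- Doubling the time range by the group law.
  have key : ∀ n : ℕ, ∀ t : ℝ, |t| * K < 2 ^ n → ∀ z,
      ContDiffAt ℝ ∞ (fun q : ℝ × E => Φ q.1 q.2) (t, z) := by
    intro n
    induction n with
    | zero => intro t ht z; exact hΦ.contDiffAt_of_small hXL hX (by simpa using ht) z
    | succ n ih =>
      intro t ht z
      have ht' : |t / 2| * K < 2 ^ n := by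
        rw [abs_div, abs_two]; rw [pow_succ] at ht; linarith
      have h1 : ContDiffAt ℝ ∞ (fun q : ℝ × E => (q.1 / 2, q.2)) (t, z) :=
        (contDiffAt_fst.div_const 2).prodMk contDiffAt_snd
      have h2 : ContDiffAt ℝ ∞ (fun q : ℝ × E => Φ (q.1 / 2) q.2) (t, z) :=
        ContDiffAt.comp (t, z) (f := fun q : ℝ × E => (q.1 / 2, q.2)) (ih (t / 2) ht' z) h1
      have h3 : ContDiffAt ℝ ∞ (fun q : ℝ × E => (q.1 / 2, Φ (q.1 / 2) q.2)) (t, z) :=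
        (contDiffAt_fst.div_const 2).prodMk h2
      have h4 := ContDiffAt.comp (t, z) (f := fun q : ℝ × E => (q.1 / 2, Φ (q.1 / 2) q.2))
        (ih (t / 2) ht' (Φ (t / 2) z)) h3
      refine h4.congr_of_eventuallyEq (Eventually.of_forall fun q => ?_)
      simp only [Function.comp]
      rw [← hΦ.add hXL, add_halves]
  rw [contDiff_iff_contDiffAt]
  rintro ⟨t, z⟩
  obtain ⟨n, hn⟩ := pow_unbounded_of_one_lt (|t| * K) one_lt_two
  exact key n t hn z

end Flow

/-! ### Real-variable tools -/

/-- A function defined implicitly by an equation with a unique solution is smooth. -/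
lemma contDiffAt_of_implicit {E : Type} [NormedAddCommGroup E] [NormedSpace ℝ E] [CompleteSpace E]
    {G : E × ℝ → ℝ} {O : Set (E × ℝ)} (hO : IsOpen O) (hG : ContDiffOn ℝ ∞ G O) {U : Set E}
    (hU : IsOpen U) {T : E → ℝ} {c : E → ℝ} (hc : ContDiffOn ℝ ∞ c U)
    (hT : ∀ p ∈ U, (p, T p) ∈ O ∧ G (p, T p) = c p)
    (huniq : ∀ p ∈ U, ∀ t, (p, t) ∈ O → G (p, t) = c p → t = T p)
    (hne : ∀ p ∈ U, fderiv ℝ G (p, T p) (0, 1) ≠ 0) : ContDiffOn ℝ ∞ T U := by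
  intro p hp
  refine ContDiffAt.contDiffWithinAt ?_
  obtain ⟨hpO, hpc⟩ := hT p hp
  have hG1 : ContDiffAt ℝ ∞ G (p, T p) := hG.contDiffAt (hO.mem_nhds hpO)
  set H : E × ℝ → ℝ := fun q => G q - c q.1 with hH
  have hc1 : ContDiffAt ℝ ∞ (fun q : E × ℝ => c q.1) (p, T p) :=
    ContDiffAt.comp (p, T p) (f := Prod.fst) (hc.contDiffAt (hU.mem_nhds hp)) contDiffAt_fst
  have hH1 : ContDiffAt ℝ ∞ H (p, T p) := hG1.sub hc1
  have hinv : (fderiv ℝ H (p, T p) ∘L .inr ℝ E ℝ).IsInvertible := by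
    have h1 : fderiv ℝ H (p, T p) (0, 1) = fderiv ℝ G (p, T p) (0, 1) := by
      have h2 : fderiv ℝ H (p, T p) = _ :=
        fderiv_sub (hG1.differentiableAt (by simp)) (hc1.differentiableAt (by simp))
      have h3 : HasFDerivAt (fun q : E × ℝ => c q.1) ((fderiv ℝ c p) ∘L .fst ℝ E ℝ) (p, T p) :=
        HasFDerivAt.comp (p, T p) (f := Prod.fst)
          (((hc.contDiffAt (hU.mem_nhds hp)).differentiableAt (by simp)).hasFDerivAt) hasFDerivAt_fst
      rw [h2, h3.fderiv]
      simp
    have h0 := hne p hp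
    rw [← h1] at h0
    refine ⟨ContinuousLinearEquiv.unitsEquivAut ℝ (Units.mk0 _ h0), ?_⟩
    ext
    simp
  set ψ := hH1.implicitFunction (by simp) hinv with hψ
  have h1 : ContDiffAt ℝ ∞ ψ p := hH1.contDiffAt_implicitFunction (by simp) hinv
  have h2 : ∀ᶠ q in 𝓝 p, H (q, ψ q) = H (p, T p) :=
    hH1.eventually_apply_implicitFunction (by simp) hinv
  have h3 : ψ p = T p := hH1.implicitFunction_apply_self (by simp) hinv
  have h4 : ∀ᶠ q in 𝓝 p, (q, ψ q) ∈ O := by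
    refine (continuousAt_id.prodMk h1.continuousAt).eventually (hO.mem_nhds ?_)
    simpa [h3] using hpO
  refine h1.congr_of_eventuallyEq ?_
  filter_upwards [h2, h4, hU.mem_nhds hp] with q hq2 hq4 hqU
  refine (huniq q hqU _ hq4 ?_).symm
  simp only [hH, hpc, sub_self] at hq2
  linarith

/-- Motion along the line with prescribed positive speed `1 / φ`: the inverse of the primitive
of `φ`. -/
lemma exists_motion {φ : ℝ → ℝ} {x₀ x₁ : ℝ} (hx : x₀ ≤ x₁) (hφ : ContinuousOn φ (Icc x₀ x₁))
    (hpos : ∀ x ∈ Icc x₀ x₁, 0 < φ x) :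
    ∃ x : ℝ → ℝ, x 0 = x₀ ∧ x (∫ y in x₀..x₁, φ y) = x₁ ∧
      ∀ t ∈ Icc 0 (∫ y in x₀..x₁, φ y), x t ∈ Icc x₀ x₁ ∧ ∫ y in x₀..x t, φ y = t ∧
        HasDerivWithinAt x (1 / φ (x t)) (Icc 0 (∫ y in x₀..x₁, φ y)) t := by
  set ψ : ℝ → ℝ := IccExtend hx ((Icc x₀ x₁).domRestrict φ) with hψ
  have hψc : Continuous ψ := (continuousOn_iff_continuous_domRestrict.1 hφ).Icc_extend'
  have hψpos : ∀ y, 0 < ψ y := fun y => hpos _ (projIcc x₀ x₁ hx y).2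
  have hψeq : ∀ y ∈ Icc x₀ x₁, ψ y = φ y := fun y hy => by
    rw [hψ, IccExtend_of_mem hx _ hy]; rfl
  obtain ⟨m, hm, hm'⟩ : ∃ m, 0 < m ∧ ∀ y, m ≤ ψ y := by
    obtain ⟨y₀, hy₀, hmin⟩ := isCompact_Icc.exists_isMinOn (nonempty_Icc.2 hx) hφ
    exact ⟨φ y₀, hpos _ hy₀, fun y => hmin (projIcc x₀ x₁ hx y).2⟩
  set t : ℝ → ℝ := fun x => ∫ y in x₀..x, ψ y with ht
  have hint : ∀ a b, IntervalIntegrable ψ MeasureTheory.volume a b :=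
    fun a b => hψc.intervalIntegrable a b
  have htd : ∀ x, HasDerivAt t (ψ x) x := fun x =>
    intervalIntegral.integral_hasDerivAt_right (hint _ _)
      hψc.aestronglyMeasurable.stronglyMeasurableAtFilter hψc.continuousAt
  have htm : StrictMono t := strictMono_of_deriv_pos fun x => by rw [(htd x).deriv]; exact hψpos x
  have htc : Continuous t := continuous_iff_continuousAt.2 fun x => (htd x).continuousAt
  have hgrow : ∀ a b, a ≤ b → m * (b - a) ≤ t b - t a := by
    intro a b hab
    have h1 : t b - t a = ∫ y in a..b, ψ y := by
      rw [ht]; exact intervalIntegral.integral_interval_sub_left (hint _ _) (hint _ _)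
    have h2 := intervalIntegral.integral_mono_on hab
      (intervalIntegrable_const (c := m)) (hint a b) (fun y _ => hm' y)
    rw [intervalIntegral.integral_const, smul_eq_mul] at h2
    rw [h1]; linarith
  have ht0 : t x₀ = 0 := by simp [ht]
  have hsurj : Function.Surjective t := by
    refine htc.surjective ?_ ?_
    · refine tendsto_atTop_mono' atTop ?_ (tendsto_id.atTop_add
        (tendsto_const_nhds (x := -x₀)) |>.const_mul_atTop hm)
      filter_upwards [eventually_ge_atTop x₀] with x hx
      have := hgrow x₀ x hx
      simp only [id]; linarith
    · refine tendsto_atBot_mono' atBot ?_ (tendsto_id.atBot_add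
        (tendsto_const_nhds (x := -x₀)) |>.const_mul_atBot hm)
      filter_upwards [eventually_le_atBot x₀] with x hx
      have := hgrow x x₀ hx
      simp only [id]; linarith
  set e := htm.orderIsoOfSurjective t hsurj with he
  have het : ∀ x, e x = t x := fun x => rfl
  have hτ : t x₁ = ∫ y in x₀..x₁, φ y :=
    intervalIntegral.integral_congr fun y hy => hψeq y (by rwa [uIcc_of_le hx] at hy)
  rw [← hτ]
  refine ⟨e.symm, by rw [OrderIso.symm_apply_eq, het, ht0], by rw [OrderIso.symm_apply_eq, het],
    fun s hs => ?_⟩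
  have hmem : e.symm s ∈ Icc x₀ x₁ := by
    constructor
    · rw [OrderIso.le_symm_apply, het, ht0]; exact hs.1
    · rw [OrderIso.symm_apply_le, het]; exact hs.2
  refine ⟨hmem, ?_, ?_⟩
  · have hes : t (e.symm s) = s := e.apply_symm_apply s
    conv_rhs => rw [← hes]
    refine intervalIntegral.integral_congr fun y hy => (hψeq y ?_).symm
    rw [uIcc_of_le hmem.1] at hy
    exact ⟨hy.1, hy.2.trans hmem.2⟩
  have h1 := HasDerivAt.of_local_left_inverse (f := t) (g := e.symm) (a := s)
    e.symm.continuous.continuousAt (htd (e.symm s)) (hψpos _).ne'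
    (Eventually.of_forall fun r => e.apply_symm_apply r)
  rw [hψeq _ hmem, inv_eq_one_div] at h1
  exact h1.hasDerivWithinAt

/-! ### Integrals with variable end points, and implicit time equations -/

lemma integral_eq_rescaled {E : Type} {f : E × ℝ → ℝ} (p : E) (x₀ x₁ : ℝ) :
    ∫ x in x₀..x₁, f (p, x) = (x₁ - x₀) * ∫ s in (0 : ℝ)..1, f (p, x₀ + (x₁ - x₀) * s) := by
  rw [intervalIntegral.mul_integral_comp_add_mul (f := fun x => f (p, x))]
  simp

section

variable {E : Type} [NormedAddCommGroup E] [NormedSpace ℝ E] {f : E × ℝ → ℝ}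

/-- An integral of a smooth function is smooth in the parameters and in both end points. -/
lemma contDiff_integral_endpoints (hf : ContDiff ℝ ∞ f) :
    ContDiff ℝ ∞ fun q : E × ℝ × ℝ => ∫ x in q.2.1..q.2.2, f (q.1, x) := by
  simp_rw [integral_eq_rescaled]
  have h1 : ContDiff ℝ ∞ fun r : (E × ℝ × ℝ) × ℝ =>
      f (r.1.1, r.1.2.1 + (r.1.2.2 - r.1.2.1) * r.2) := hf.comp (by fun_prop)
  exact (by fun_prop : ContDiff ℝ ∞ fun q : E × ℝ × ℝ => q.2.2 - q.2.1).mul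
    (contDiff_parametric_integral h1)

lemma fderiv_integral_endpoints (hf : ContDiff ℝ ∞ f) (p v : E) (x₀ x₁ u₀ u₁ : ℝ) :
    fderiv ℝ (fun q : E × ℝ × ℝ => ∫ x in q.2.1..q.2.2, f (q.1, x)) (p, x₀, x₁) (v, u₀, u₁) =
      (∫ x in x₀..x₁, fderiv ℝ f (p, x) (v, 0)) + f (p, x₁) * u₁ - f (p, x₀) * u₀ := by
  set J := fun q : E × ℝ × ℝ => ∫ x in q.2.1..q.2.2, f (q.1, x) with hJ
  have hJd : HasFDerivAt J (fderiv ℝ J (p, x₀, x₁)) (p, x₀, x₁) :=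
    ((contDiff_integral_endpoints hf).differentiable (by simp) _).hasFDerivAt
  have hfc : Continuous fun x => f (p, x) := hf.continuous.comp (by fun_prop)
  have hint : ∀ a b, IntervalIntegrable (fun x => f (p, x)) MeasureTheory.volume a b :=
    fun a b => hfc.intervalIntegrable a b
  have e : ((v, u₀, u₁) : E × ℝ × ℝ) = (v, 0, 0) + (u₀ • (0, 1, 0) + u₁ • (0, 0, 1)) := by simp
  rw [e, map_add, map_add, map_smul, map_smul]
  have h0 : fderiv ℝ J (p, x₀, x₁) (0, 1, 0) = - f (p, x₀) := by
    have h1 : HasDerivAt (fun y => ((p, y, x₁) : E × ℝ × ℝ)) (0, 1, 0) x₀ :=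
      (hasDerivAt_const _ _).prodMk ((hasDerivAt_id _).prodMk (hasDerivAt_const _ _))
    have h2 := hJd.comp_hasDerivAt x₀ h1
    exact h2.unique (intervalIntegral.integral_hasDerivAt_left (hint _ _)
      hfc.aestronglyMeasurable.stronglyMeasurableAtFilter hfc.continuousAt)
  have h1 : fderiv ℝ J (p, x₀, x₁) (0, 0, 1) = f (p, x₁) := by
    have h1 : HasDerivAt (fun y => ((p, x₀, y) : E × ℝ × ℝ)) (0, 0, 1) x₁ :=
      (hasDerivAt_const _ _).prodMk ((hasDerivAt_const _ _).prodMk (hasDerivAt_id _))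
    have h2 := hJd.comp_hasDerivAt x₁ h1
    exact h2.unique (intervalIntegral.integral_hasDerivAt_right (hint _ _)
      hfc.aestronglyMeasurable.stronglyMeasurableAtFilter hfc.continuousAt)
  have h2 : fderiv ℝ J (p, x₀, x₁) (v, 0, 0) = ∫ x in x₀..x₁, fderiv ℝ f (p, x) (v, 0) := by
    set g : E × ℝ → ℝ := fun q => f (q.1, x₀ + (x₁ - x₀) * q.2) with hg
    have hgs : ContDiff ℝ ∞ g := hf.comp (by fun_prop)
    have h3 : HasFDerivAt (fun q : E => J (q, x₀, x₁))
        ((fderiv ℝ J (p, x₀, x₁)) ∘L .inl ℝ E (ℝ × ℝ)) p := 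
      HasFDerivAt.comp p (f := fun q => (q, x₀, x₁)) hJd (hasFDerivAt_prodMk_left p (x₀, x₁))
    have h4 : (fun q : E => J (q, x₀, x₁)) = fun q => (x₁ - x₀) * ∫ s in (0 : ℝ)..1, g (q, s) :=
      funext fun q => integral_eq_rescaled q x₀ x₁
    have h5 : HasFDerivAt (fun q : E => ∫ s in (0 : ℝ)..1, g (q, s)) _ p :=
      ((contDiff_parametric_integral hgs).differentiable (by simp) p).hasFDerivAt
    have h6 := DFunLike.congr_fun (h3.unique (h4 ▸ h5.const_mul (x₁ - x₀))) v
    have h7 : fderiv ℝ J (p, x₀, x₁) (v, 0, 0) = (x₁ - x₀) *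
        ∫ s in (0 : ℝ)..1, fderiv ℝ g (p, s) (v, 0) := by
      rw [← fderiv_parametric_integral hgs]; exact h6
    rw [h7, integral_eq_rescaled (f := fun q : E × ℝ => fderiv ℝ f q (v, 0))]
    congr 1
    refine intervalIntegral.integral_congr fun s _ => ?_
    have h8 : HasFDerivAt (fun q : E => g (q, s))
        (fderiv ℝ g (p, s) ∘L .inl ℝ E ℝ) p :=
      (hgs.differentiable (by simp) _).hasFDerivAt.comp p (hasFDerivAt_prodMk_left _ _)
    have h9 : HasFDerivAt (fun q : E => g (q, s))
        (fderiv ℝ f (p, x₀ + (x₁ - x₀) * s) ∘L .inl ℝ E ℝ) p :=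
      HasFDerivAt.comp p (f := fun q => (q, x₀ + (x₁ - x₀) * s))
        (hf.differentiable (by simp) _).hasFDerivAt (hasFDerivAt_prodMk_left _ _)
    simpa using DFunLike.congr_fun (h8.unique h9) v
  rw [h0, h1, h2]
  simp only [smul_eq_mul]
  ring

end

/-- The half-width of the windows in which the end points of a swing vary. -/
def windowRadius : ℝ := 1 / 10

/-- The parameters `(a, b, l)`: displacements `a`, `b` of the two end points in their windows, and
a third parameter in `Λ`. -/
def windowDomain (Λ : Set ℝ) : Set (ℝ × ℝ × ℝ) :=
  {q | |q.1| < windowRadius ∧ |q.2.1| < windowRadius ∧ q.2.2 ∈ Λ}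

lemma isOpen_windowDomain {Λ : Set ℝ} (hΛ : IsOpen Λ) : IsOpen (windowDomain Λ) := by
  have h1 : IsOpen {q : ℝ × ℝ × ℝ | |q.1| < windowRadius} := isOpen_lt (by fun_prop) (by fun_prop)
  have h2 : IsOpen {q : ℝ × ℝ × ℝ | |q.2.1| < windowRadius} := isOpen_lt (by fun_prop) (by fun_prop)
  have h3 : IsOpen {q : ℝ × ℝ × ℝ | q.2.2 ∈ Λ} :=
    hΛ.preimage (f := fun q : ℝ × ℝ × ℝ => q.2.2) (by fun_prop)
  exact h1.inter (h2.inter h3)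

/-- Passing from an internal parameter `l` to the transit time `T = G (a, b, l)`. -/
lemma exists_reparametrization {G : ℝ × ℝ × ℝ → ℝ} {Λ : Set ℝ} {T₀ : ℝ} (hΛ : IsOpen Λ)
    (hG : ContDiffOn ℝ ∞ G (windowDomain Λ))
    (hne : ∀ q ∈ windowDomain Λ, fderiv ℝ G q (0, 0, 1) ≠ 0)
    (hinj : ∀ a b, |a| < windowRadius → |b| < windowRadius → InjOn (fun l => G (a, b, l)) Λ)
    (hsurj : ∀ a b T, |a| < windowRadius → |b| < windowRadius → T₀ < T →
      ∃ l ∈ Λ, G (a, b, l) = T) :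
    ∃ L : ℝ × ℝ × ℝ → ℝ, ContDiffOn ℝ ∞ L (windowDomain (Ioi T₀)) ∧
      (∀ q ∈ windowDomain (Ioi T₀), (q.1, q.2.1, L q) ∈ windowDomain Λ ∧
        G (q.1, q.2.1, L q) = q.2.2) ∧
      ∀ W : ℝ × ℝ × ℝ → ℝ, ContDiffOn ℝ ∞ W (windowDomain Λ) →
        ContDiffOn ℝ ∞ (fun q => W (q.1, q.2.1, L q)) (windowDomain (Ioi T₀)) ∧
        ∀ q ∈ windowDomain (Ioi T₀), ∀ v : ℝ × ℝ × ℝ,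
          fderiv ℝ (fun q => W (q.1, q.2.1, L q)) q v =
            fderiv ℝ W (q.1, q.2.1, L q) (v.1, v.2.1, 0) +
            fderiv ℝ W (q.1, q.2.1, L q) (0, 0, 1) *
              ((v.2.2 - fderiv ℝ G (q.1, q.2.1, L q) (v.1, v.2.1, 0)) /
                fderiv ℝ G (q.1, q.2.1, L q) (0, 0, 1)) := by
  have hex : ∀ q : ℝ × ℝ × ℝ, ∃ l, q ∈ windowDomain (Ioi T₀) → l ∈ Λ ∧ G (q.1, q.2.1, l) = q.2.2 := by
    intro q
    by_cases hq : q ∈ windowDomain (Ioi T₀)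
    · obtain ⟨l, hl, hl'⟩ := hsurj q.1 q.2.1 q.2.2 hq.1 hq.2.1 hq.2.2
      exact ⟨l, fun _ => ⟨hl, hl'⟩⟩
    · exact ⟨0, fun h => absurd h hq⟩
  choose L hL using hex
  have hO := isOpen_windowDomain hΛ
  have hU := isOpen_windowDomain (isOpen_Ioi (a := T₀))
  have hmem : ∀ q ∈ windowDomain (Ioi T₀), (q.1, q.2.1, L q) ∈ windowDomain Λ := fun q hq =>
    ⟨hq.1, hq.2.1, (hL q hq).1⟩
  -- the parameter as a function on the product with the line
  set κ : (ℝ × ℝ × ℝ) × ℝ → ℝ × ℝ × ℝ := fun r => (r.1.1, r.1.2.1, r.2) with hκ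
  have hκs : ContDiff ℝ ∞ κ := by fun_prop
  have hκd : ∀ r, HasFDerivAt κ (fderiv ℝ κ r) r := fun r =>
    (hκs.differentiable (by simp) r).hasFDerivAt
  have hκ1 : ∀ r, fderiv ℝ κ r (0, 1) = (0, 0, 1) := fun r => by
    have h1 : HasDerivAt (fun t => κ (r.1, t)) (0, 0, 1) r.2 :=
      (hasDerivAt_const r.2 r.1.1).prodMk
        ((hasDerivAt_const r.2 r.1.2.1).prodMk (hasDerivAt_id r.2))
    have h2 : HasDerivAt (fun t => (r.1, t)) ((0, 1) : (ℝ × ℝ × ℝ) × ℝ) r.2 :=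
      (hasDerivAt_const _ _).prodMk (hasDerivAt_id _)
    have h3 : HasDerivAt (fun t => κ (r.1, t)) (fderiv ℝ κ r (0, 1)) r.2 :=
      HasFDerivAt.comp_hasDerivAt (l := κ) r.2 (hκd r) h2
    exact h3.unique h1
  have hLs : ContDiffOn ℝ ∞ L (windowDomain (Ioi T₀)) := by
    refine contDiffAt_of_implicit (G := G ∘ κ) (O := κ ⁻¹' windowDomain Λ)
      (hO.preimage hκs.continuous) (hG.comp hκs.contDiffOn fun _ h => h) hU (c := fun q => q.2.2)
      (by fun_prop) (fun q hq => ⟨hmem q hq, (hL q hq).2⟩) ?_ ?_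
    · intro q hq t ht htG
      exact hinj q.1 q.2.1 hq.1 hq.2.1 ht.2.2 (hL q hq).1 (htG.trans (hL q hq).2.symm)
    · intro q hq
      have h1 : HasFDerivAt G (fderiv ℝ G (κ (q, L q))) (κ (q, L q)) :=
        ((hG.contDiffAt (hO.mem_nhds (hmem q hq))).differentiableAt (by simp)).hasFDerivAt
      rw [(h1.comp _ (hκd _)).fderiv, ContinuousLinearMap.comp_apply, hκ1]
      exact hne _ (hmem q hq)
  set m : ℝ × ℝ × ℝ → ℝ × ℝ × ℝ := fun q => (q.1, q.2.1, L q) with hm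
  have hms : ContDiffOn ℝ ∞ m (windowDomain (Ioi T₀)) :=
    contDiffOn_fst.prodMk ((contDiff_fst.comp contDiff_snd).contDiffOn.prodMk hLs)
  have hmd : ∀ q ∈ windowDomain (Ioi T₀), ∀ v, HasFDerivAt m (fderiv ℝ m q) q ∧
      fderiv ℝ m q v = (v.1, v.2.1, fderiv ℝ L q v) := by
    intro q hq v
    have h1 : HasFDerivAt L (fderiv ℝ L q) q :=
      ((hLs.contDiffAt (hU.mem_nhds hq)).differentiableAt (by simp)).hasFDerivAt
    have h2 : HasFDerivAt m _ q := hasFDerivAt_fst.prodMk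
      ((hasFDerivAt_fst.comp q hasFDerivAt_snd).prodMk h1)
    rw [h2.fderiv]
    exact ⟨h2, rfl⟩
  have hcomp : ∀ W : ℝ × ℝ × ℝ → ℝ, ContDiffOn ℝ ∞ W (windowDomain Λ) →
      ∀ q ∈ windowDomain (Ioi T₀), ∀ v, fderiv ℝ (fun q => W (m q)) q v =
        fderiv ℝ W (m q) (v.1, v.2.1, 0) + fderiv ℝ W (m q) (0, 0, 1) * fderiv ℝ L q v := by
    intro W hW q hq v
    have h1 : HasFDerivAt W (fderiv ℝ W (m q)) (m q) :=
      ((hW.contDiffAt (hO.mem_nhds (hmem q hq))).differentiableAt (by simp)).hasFDerivAt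
    have h2 := h1.comp q (hmd q hq v).1
    have h3 : fderiv ℝ (fun q => W (m q)) q = _ := h2.fderiv
    have e : ((v.1, v.2.1, fderiv ℝ L q v) : ℝ × ℝ × ℝ) =
      (v.1, v.2.1, 0) + (fderiv ℝ L q v) • (0, 0, 1) := by simp
    rw [h3, ContinuousLinearMap.comp_apply, (hmd q hq v).2, e, map_add, map_smul, smul_eq_mul,
      mul_comm]
  refine ⟨L, hLs, fun q hq => ⟨hmem q hq, (hL q hq).2⟩, fun W hW =>
    ⟨hW.comp hms hmem, fun q hq v => ?_⟩⟩
  have h1 := hcomp G hG q hq v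
  have h2 : fderiv ℝ (fun q => G (m q)) q v = v.2.2 := by
    have h3 : (fun q => G (m q)) =ᶠ[𝓝 q] fun q => q.2.2 := by
      filter_upwards [hU.mem_nhds hq] with r hr using (hL r hr).2
    have h4 : HasFDerivAt (fun q : ℝ × ℝ × ℝ => q.2.2)
        (ContinuousLinearMap.snd ℝ ℝ ℝ ∘L ContinuousLinearMap.snd ℝ ℝ (ℝ × ℝ)) q :=
      (ContinuousLinearMap.snd ℝ ℝ ℝ ∘L ContinuousLinearMap.snd ℝ ℝ (ℝ × ℝ)).hasFDerivAt
    rw [h3.fderiv_eq, h4.fderiv]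
    rfl
  have h3 : fderiv ℝ L q v = (v.2.2 - fderiv ℝ G (m q) (v.1, v.2.1, 0)) /
      fderiv ℝ G (m q) (0, 0, 1) := by
    rw [eq_div_iff (hne _ (hmem q hq)), ← h2, h1]
    ring
  rw [hcomp W hW q hq v, h3]

/-! ### The single pendulum -/

/-- The phase-space vector field of the pendulum `x'' = -sin x`. -/
def pendField (z : ℝ × ℝ) : ℝ × ℝ := (z.2, -Real.sin z.1)

lemma contDiff_pendField : ContDiff ℝ ∞ pendField := by unfold pendField; fun_prop

lemma abs_sin_sub_sin_le (x y : ℝ) : |Real.sin x - Real.sin y| ≤ |x - y| := by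
  have := Convex.norm_image_sub_le_of_norm_deriv_le (f := Real.sin) (C := 1) (s := univ) (x := y)
    (y := x) (fun _ _ => Real.differentiableAt_sin) (fun z _ => by
      rw [Real.deriv_sin, Real.norm_eq_abs]; exact Real.abs_cos_le_one z) convex_univ
      (mem_univ _) (mem_univ _)
  simpa using this

lemma lipschitzWith_pendField : LipschitzWith 1 pendField := by
  refine LipschitzWith.of_dist_le_mul fun z w => ?_
  simp only [pendField, Prod.dist_eq, Real.dist_eq, NNReal.coe_one, one_mul]
  refine max_le (le_max_right _ _) (le_max_of_le_left ?_)
  rw [show -Real.sin z.1 - -Real.sin w.1 = -(Real.sin z.1 - Real.sin w.1) by ring, abs_neg]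
  exact abs_sin_sub_sin_le _ _

/-- The flow of the pendulum. -/
def pendFlow : ℝ → ℝ × ℝ → ℝ × ℝ :=
  (exists_isFlow lipschitzWith_pendField
    (contDiff_pendField.of_le (by exact_mod_cast le_top))).choose

lemma isFlow_pendFlow : IsFlow pendField pendFlow :=
  (exists_isFlow lipschitzWith_pendField
    (contDiff_pendField.of_le (by exact_mod_cast le_top))).choose_spec

lemma pendFlow_add (s t : ℝ) (z : ℝ × ℝ) : pendFlow (t + s) z = pendFlow t (pendFlow s z) :=
  isFlow_pendFlow.add lipschitzWith_pendField s t z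

lemma pendFlow_hasDerivAt_fst (z : ℝ × ℝ) (t : ℝ) :
    HasDerivAt (fun s => (pendFlow s z).1) (pendFlow t z).2 t := (isFlow_pendFlow.deriv z t).fst

lemma pendFlow_hasDerivAt_snd (z : ℝ × ℝ) (t : ℝ) :
    HasDerivAt (fun s => (pendFlow s z).2) (-Real.sin (pendFlow t z).1) t :=
  (isFlow_pendFlow.deriv z t).snd

/-- Time reversal. -/
lemma pendFlow_neg (t x y : ℝ) :
    pendFlow (-t) (x, -y) = ((pendFlow t (x, y)).1, -(pendFlow t (x, y)).2) := by
  have h := isFlow_pendFlow.eq_of_hasDerivAt lipschitzWith_pendField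
    (c := fun s => ((pendFlow (-s) (x, y)).1, -(pendFlow (-s) (x, y)).2)) (fun s => by
      have h1 := (pendFlow_hasDerivAt_fst (x, y) (-s)).scomp s (hasDerivAt_neg s)
      have h2 := ((pendFlow_hasDerivAt_snd (x, y) (-s)).scomp s (hasDerivAt_neg s)).neg
      simpa [pendField] using h1.prodMk h2) (-t)
  simpa [isFlow_pendFlow.zero] using h.symm

/-- Invariance under translation by a period. -/
lemma pendFlow_translate (t x y : ℝ) (m : ℤ) :
    pendFlow t (2 * Real.pi * m + x, y) =
      (2 * Real.pi * m + (pendFlow t (x, y)).1, (pendFlow t (x, y)).2) := by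
  have hs : ∀ x : ℝ, Real.sin (2 * Real.pi * m + x) = Real.sin x := fun x => by
    rw [add_comm, mul_comm]; exact Real.sin_add_int_mul_two_pi x m
  have h := isFlow_pendFlow.eq_of_hasDerivAt lipschitzWith_pendField
    (c := fun s => (2 * Real.pi * m + (pendFlow s (x, y)).1, (pendFlow s (x, y)).2)) (fun s => by
      have h1 := (pendFlow_hasDerivAt_fst (x, y) s).const_add (2 * Real.pi * m)
      have h2 := pendFlow_hasDerivAt_snd (x, y) s
      simpa [pendField, hs] using h1.prodMk h2) t
  simpa [isFlow_pendFlow.zero] using h.symm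

/-- Invariance under reflection. -/
lemma pendFlow_reflect (t x y : ℝ) :
    pendFlow t (-x, -y) = (-(pendFlow t (x, y)).1, -(pendFlow t (x, y)).2) := by
  have h := isFlow_pendFlow.eq_of_hasDerivAt lipschitzWith_pendField
    (c := fun s => (-(pendFlow s (x, y)).1, -(pendFlow s (x, y)).2)) (fun s => by
      have h1 := (pendFlow_hasDerivAt_fst (x, y) s).neg
      have h2 := (pendFlow_hasDerivAt_snd (x, y) s).neg
      simpa [pendField] using h1.prodMk h2) t
  simpa [isFlow_pendFlow.zero] using h.symm

/-- The energy of a single pendulum, which vanishes on the separatrix. -/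
def pendEnergy (x y : ℝ) : ℝ := y ^ 2 / 2 - Real.cos x - 1

lemma pendEnergy_pendFlow (t : ℝ) (z : ℝ × ℝ) :
    pendEnergy (pendFlow t z).1 (pendFlow t z).2 = pendEnergy z.1 z.2 := by
  have hd : ∀ s, HasDerivAt (fun s => pendEnergy (pendFlow s z).1 (pendFlow s z).2) 0 s := by
    intro s
    have h1 := (pendFlow_hasDerivAt_fst z s).cos
    have h2 := ((pendFlow_hasDerivAt_snd z s).pow 2).div_const 2
    have h3 := (h2.sub h1).sub_const 1
    exact h3.congr_deriv (by push_cast; ring)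
  have := is_const_of_deriv_eq_zero (fun s => (hd s).differentiableAt) (fun s => (hd s).deriv) t 0
  simpa [isFlow_pendFlow.zero] using this

/-- The speed at position `x` on the energy level `h`. -/
def speed (h x : ℝ) : ℝ := √(2 * (h + 1 + Real.cos x))

lemma pendEnergy_speed {h x : ℝ} (hx : 0 ≤ h + 1 + Real.cos x) : pendEnergy x (speed h x) = h := by
  rw [pendEnergy, speed, Real.sq_sqrt (by linarith)]; ring

lemma speed_pos {h x : ℝ} (hx : 0 < h + 1 + Real.cos x) : 0 < speed h x :=
  Real.sqrt_pos.2 (by linarith)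

lemma speed_sq {h x : ℝ} (hx : 0 ≤ h + 1 + Real.cos x) :
    speed h x ^ 2 = 2 * (h + 1 + Real.cos x) := Real.sq_sqrt (by linarith)

lemma continuous_speed (h : ℝ) : Continuous (speed h) := by unfold speed; fun_prop

lemma hasDerivAt_speed {h x : ℝ} (hx : 0 < h + 1 + Real.cos x) :
    HasDerivAt (speed h) (-Real.sin x / speed h x) x := by
  have h1 : HasDerivAt (fun x => 2 * (h + 1 + Real.cos x)) (2 * -Real.sin x) x :=
    ((Real.hasDerivAt_cos x).const_add (h + 1)).const_mul 2
  have h2 := h1.sqrt (by linarith)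
  rw [mul_div_mul_left _ _ two_ne_zero] at h2
  exact h2

lemma continuousOn_inv_speed {h x₀ x₁ : ℝ} (hpos : ∀ x ∈ Icc x₀ x₁, 0 < h + 1 + Real.cos x) :
    ContinuousOn (fun x => 1 / speed h x) (Icc x₀ x₁) :=
  continuousOn_const.div (continuous_speed h).continuousOn fun x hx => (speed_pos (hpos x hx)).ne'

/-- Monotone motion on an energy level: the pendulum travels from `x₀` to `x₁` in the time given by
the usual quadrature. -/
lemma pendFlow_transit {h x₀ x₁ : ℝ} (hx : x₀ ≤ x₁)
    (hpos : ∀ x ∈ Icc x₀ x₁, 0 < h + 1 + Real.cos x) :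
    pendFlow (∫ y in x₀..x₁, 1 / speed h y) (x₀, speed h x₀) = (x₁, speed h x₁) ∧
      ∀ t ∈ Icc 0 (∫ y in x₀..x₁, 1 / speed h y), ∃ x ∈ Icc x₀ x₁,
        pendFlow t (x₀, speed h x₀) = (x, speed h x) ∧ ∫ y in x₀..x, 1 / speed h y = t := by
  obtain ⟨x, h0, h1, hx⟩ := exists_motion hx (continuousOn_inv_speed hpos)
    (fun x hx => one_div_pos.2 (speed_pos (hpos x hx)))
  set τ := ∫ y in x₀..x₁, 1 / speed h y with hτ
  have hτ0 : 0 ≤ τ := intervalIntegral.integral_nonneg (by assumption)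
    fun x hx => (one_div_pos.2 (speed_pos (hpos x hx))).le
  have key : ∀ t ∈ Icc 0 τ, (x t, speed h (x t)) = pendFlow t (x₀, speed h x₀) := by
    intro t ht
    have := isFlow_pendFlow.eq_of_hasDerivWithinAt lipschitzWith_pendField
      (c := fun t => (x t, speed h (x t))) (t₀ := 0) (t₁ := τ) (fun t ht => ?_) ht
    · simpa [h0] using this
    · obtain ⟨hm, -, hd⟩ := hx t ht
      rw [one_div_one_div] at hd
      have hp := hpos _ hm
      have hs := (hasDerivAt_speed hp).comp_hasDerivWithinAt t hd
      rw [div_mul_cancel₀ _ (speed_pos hp).ne'] at hs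
      exact hd.prodMk hs
  refine ⟨by rw [← key τ ⟨hτ0, le_rfl⟩, h1], fun t ht => ⟨x t, (hx t ht).1, (key t ht).symm,
    (hx t ht).2.1⟩⟩

/-! ### Families of swings -/

/-- A smooth family of solutions of the pendulum equation that lead, in the time `T > T₀`, from
`α + a` to `β + b`, where `a` and `b` vary in their windows. The initial and final velocities are
`V₀ (a, b, T)` and `V₁ (a, b, T)`; the remaining fields bound their derivatives by constants that
are meant to be uniform over all families in use. -/
structure IsSwingFamily (C T₀ α β : ℝ) (V₀ V₁ : ℝ × ℝ × ℝ → ℝ) : Prop where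
  contDiffOn₀ : ContDiffOn ℝ ∞ V₀ (windowDomain (Ioi T₀))
  contDiffOn₁ : ContDiffOn ℝ ∞ V₁ (windowDomain (Ioi T₀))
  flow : ∀ q ∈ windowDomain (Ioi T₀), pendFlow q.2.2 (α + q.1, V₀ q) = (β + q.2.1, V₁ q)
  bound : ∀ q ∈ windowDomain (Ioi T₀), pendEnergy (α + q.1) (V₀ q) ≤ 2 →
    (|fderiv ℝ V₀ q (1, 0, 0)| ≤ C ∧ |fderiv ℝ V₀ q (0, 1, 0)| ≤ C) ∧
      |fderiv ℝ V₁ q (1, 0, 0)| ≤ C ∧ |fderiv ℝ V₁ q (0, 1, 0)| ≤ C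
  /-- `V₀ ∂V₀/∂T` is the derivative of the energy with respect to the duration `T`. -/
  decay : ∀ q ∈ windowDomain (Ioi T₀), V₀ q * fderiv ℝ V₀ q (0, 0, 1) ≤
    -2 * pendEnergy (α + q.1) (V₀ q) / q.2.2 + C / q.2.2 ^ 2
  boundT₀ : ∀ q ∈ windowDomain (Ioi T₀), |fderiv ℝ V₀ q (0, 0, 1)| ≤
    C * (-(V₀ q * fderiv ℝ V₀ q (0, 0, 1)) + C / q.2.2 ^ 2)
  boundT₁ : ∀ q ∈ windowDomain (Ioi T₀), |fderiv ℝ V₁ q (0, 0, 1)| ≤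
    C * (-(V₀ q * fderiv ℝ V₀ q (0, 0, 1)) + C / q.2.2 ^ 2)
  energy_ge : ∀ q ∈ windowDomain (Ioi T₀), -(C / q.2.2 ^ 2) ≤ pendEnergy (α + q.1) (V₀ q)
  energy_le : ∃ C', ∀ q ∈ windowDomain (Ioi T₀), pendEnergy (α + q.1) (V₀ q) ≤ C' / q.2.2 ^ 2

/-- In the family with initial velocities `V₀` the pendulum stays away from the bottom, except for
the first and the last unit of time. -/
def StaysAway (T₀ α : ℝ) (V₀ : ℝ × ℝ × ℝ → ℝ) : Prop :=
  ∀ q ∈ windowDomain (Ioi T₀), ∀ t ∈ Icc 1 (q.2.2 - 1),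
    Real.cos (pendFlow t (α + q.1, V₀ q)).1 < 999 / 1000

lemma windowDomain_mono {Λ Λ' : Set ℝ} (h : Λ ⊆ Λ') : windowDomain Λ ⊆ windowDomain Λ' :=
  fun _ hq => ⟨hq.1, hq.2.1, h hq.2.2⟩

lemma StaysAway.mono {T₀ T₀' α : ℝ} {V₀ : ℝ × ℝ × ℝ → ℝ} (h : StaysAway T₀ α V₀) (hT : T₀ ≤ T₀') :
    StaysAway T₀' α V₀ := fun q hq => h q (windowDomain_mono (Ioi_subset_Ioi hT) hq)

lemma IsSwingFamily.mono {C C' T₀ T₀' α β : ℝ} {V₀ V₁ : ℝ × ℝ × ℝ → ℝ}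
    (h : IsSwingFamily C T₀ α β V₀ V₁) (hC0 : 0 < C) (hC : C ≤ C') (hT : T₀ ≤ T₀') :
    IsSwingFamily C' T₀' α β V₀ V₁ := by
  have hD := windowDomain_mono (Ioi_subset_Ioi hT)
  have hdiv : ∀ T : ℝ, C / T ^ 2 ≤ C' / T ^ 2 := fun T => by gcongr
  have hT' : ∀ q ∈ windowDomain (Ioi T₀'), C * (-(V₀ q * fderiv ℝ V₀ q (0, 0, 1)) + C / q.2.2 ^ 2) ≤
      C' * (-(V₀ q * fderiv ℝ V₀ q (0, 0, 1)) + C' / q.2.2 ^ 2) := by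
    intro q hq
    have h1 := (abs_nonneg _).trans (h.boundT₀ q (hD hq))
    have h2 : 0 ≤ -(V₀ q * fderiv ℝ V₀ q (0, 0, 1)) + C / q.2.2 ^ 2 :=
      nonneg_of_mul_nonneg_right h1 hC0
    have := hdiv q.2.2
    have := hC0.le.trans hC
    gcongr
  exact
    { contDiffOn₀ := h.contDiffOn₀.mono hD
      contDiffOn₁ := h.contDiffOn₁.mono hD
      flow := fun q hq => h.flow q (hD hq)
      bound := fun q hq he => by
        obtain ⟨⟨h1, h2⟩, h3, h4⟩ := h.bound q (hD hq) he
        exact ⟨⟨h1.trans hC, h2.trans hC⟩, h3.trans hC, h4.trans hC⟩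
      decay := fun q hq => (h.decay q (hD hq)).trans (by have := hdiv q.2.2; linarith)
      boundT₀ := fun q hq => (h.boundT₀ q (hD hq)).trans (hT' q hq)
      boundT₁ := fun q hq => (h.boundT₁ q (hD hq)).trans (hT' q hq)
      energy_ge := fun q hq => le_trans (by have := hdiv q.2.2; linarith) (h.energy_ge q (hD hq))
      energy_le := by
        obtain ⟨C', hC'⟩ := h.energy_le
        exact ⟨C', fun q hq => hC' q (hD hq)⟩ }

/-! ### Symmetries of the pendulum -/

lemma sin_two_pi_int_add (m : ℤ) (x : ℝ) : Real.sin (2 * Real.pi * m + x) = Real.sin x := by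
  rw [add_comm, mul_comm]; exact Real.sin_add_int_mul_two_pi x m

lemma cos_two_pi_int_add (m : ℤ) (x : ℝ) : Real.cos (2 * Real.pi * m + x) = Real.cos x := by
  rw [add_comm, mul_comm]; exact Real.cos_add_int_mul_two_pi x m

lemma pendEnergy_translate (m : ℤ) (x y : ℝ) :
    pendEnergy (2 * Real.pi * m + x) y = pendEnergy x y := by
  rw [pendEnergy, cos_two_pi_int_add, pendEnergy]

lemma IsSwingFamily.translate {C T₀ α β : ℝ} {V₀ V₁ : ℝ × ℝ × ℝ → ℝ}
    (h : IsSwingFamily C T₀ α β V₀ V₁) (m : ℤ) :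
    IsSwingFamily C T₀ (2 * Real.pi * m + α) (2 * Real.pi * m + β) V₀ V₁ :=
  { contDiffOn₀ := h.contDiffOn₀
    contDiffOn₁ := h.contDiffOn₁
    flow := fun q hq => by rw [add_assoc, pendFlow_translate, h.flow q hq, add_assoc]
    bound := fun q hq => by rw [add_assoc, pendEnergy_translate]; exact h.bound q hq
    decay := fun q hq => by rw [add_assoc, pendEnergy_translate]; exact h.decay q hq
    boundT₀ := h.boundT₀
    boundT₁ := h.boundT₁
    energy_ge := fun q hq => by rw [add_assoc, pendEnergy_translate]; exact h.energy_ge q hq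
    energy_le := by simpa only [add_assoc, pendEnergy_translate] using h.energy_le }

lemma StaysAway.translate {T₀ α : ℝ} {V₀ : ℝ × ℝ × ℝ → ℝ} (h : StaysAway T₀ α V₀) (m : ℤ) :
    StaysAway T₀ (2 * Real.pi * m + α) V₀ := fun q hq t ht => by
  rw [add_assoc, pendFlow_translate, cos_two_pi_int_add]; exact h q hq t ht

/-- Changing the sign of both displacements. -/
def flipWindow : (ℝ × ℝ × ℝ) ≃L[ℝ] ℝ × ℝ × ℝ :=
  (ContinuousLinearEquiv.neg ℝ).prodCongr
    ((ContinuousLinearEquiv.neg ℝ).prodCongr (ContinuousLinearEquiv.refl ℝ ℝ))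

lemma flipWindow_apply (q : ℝ × ℝ × ℝ) : flipWindow q = (-q.1, -q.2.1, q.2.2) := rfl

lemma flipWindow_mem {Λ : Set ℝ} {q : ℝ × ℝ × ℝ} (hq : q ∈ windowDomain Λ) :
    flipWindow q ∈ windowDomain Λ := by
  refine ⟨?_, ?_, hq.2.2⟩
  · rw [flipWindow_apply, abs_neg]; exact hq.1
  · rw [flipWindow_apply, abs_neg]; exact hq.2.1

lemma fderiv_flip (V : ℝ × ℝ × ℝ → ℝ) (q v : ℝ × ℝ × ℝ) :
    fderiv ℝ (fun q => -V (flipWindow q)) q v = -fderiv ℝ V (flipWindow q) (flipWindow v) := by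
  have h1 : fderiv ℝ (V ∘ flipWindow) q = _ := flipWindow.comp_right_fderiv
  have h2 : fderiv ℝ (fun q => -V (flipWindow q)) q = -fderiv ℝ (V ∘ flipWindow) q := fderiv_fun_neg
  rw [h2, h1]
  rfl

/-- The mirror image of a family of swings. -/
lemma IsSwingFamily.reflect {C T₀ α β : ℝ} {V₀ V₁ : ℝ × ℝ × ℝ → ℝ}
    (h : IsSwingFamily C T₀ α β V₀ V₁) :
    IsSwingFamily C T₀ (-α) (-β) (fun q => -V₀ (flipWindow q)) (fun q => -V₁ (flipWindow q)) := by
  have hE : ∀ q : ℝ × ℝ × ℝ, pendEnergy (-α + q.1) (-V₀ (flipWindow q)) =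
      pendEnergy (α + (flipWindow q).1) (V₀ (flipWindow q)) := fun q => by
    rw [pendEnergy, pendEnergy, neg_sq, ← Real.cos_neg, flipWindow_apply, neg_add, neg_neg]
  have e1 : flipWindow (1, 0, 0) = -(1, 0, 0) := by simp [flipWindow_apply]
  have e2 : flipWindow (0, 1, 0) = -(0, 1, 0) := by simp [flipWindow_apply]
  have e3 : flipWindow (0, 0, 1) = (0, 0, 1) := by simp [flipWindow_apply]
  exact
  { contDiffOn₀ := (h.contDiffOn₀.comp flipWindow.contDiff.contDiffOn fun _ => flipWindow_mem).neg
    contDiffOn₁ := (h.contDiffOn₁.comp flipWindow.contDiff.contDiffOn fun _ => flipWindow_mem).neg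
    flow := fun q hq => by
      have := h.flow _ (flipWindow_mem hq)
      rw [show -α + q.1 = -(α + (flipWindow q).1) by rw [flipWindow_apply]; ring, pendFlow_reflect]
      rw [flipWindow_apply] at this ⊢
      rw [this, neg_add, neg_neg]
    bound := fun q hq he => by
      rw [hE] at he
      simp only [fderiv_flip, e1, e2, map_neg, neg_neg]
      exact h.bound _ (flipWindow_mem hq) he
    decay := fun q hq => by
      simp only [hE, fderiv_flip, e3, neg_mul_neg]
      exact h.decay _ (flipWindow_mem hq)
    boundT₀ := fun q hq => by
      simp only [fderiv_flip, e3, neg_mul_neg, abs_neg]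
      exact h.boundT₀ _ (flipWindow_mem hq)
    boundT₁ := fun q hq => by
      simp only [fderiv_flip, e3, neg_mul_neg, abs_neg]
      exact h.boundT₁ _ (flipWindow_mem hq)
    energy_ge := fun q hq => by rw [hE]; exact h.energy_ge _ (flipWindow_mem hq)
    energy_le := by
      obtain ⟨C', hC'⟩ := h.energy_le
      exact ⟨C', fun q hq => by rw [hE]; exact hC' _ (flipWindow_mem hq)⟩ }

lemma StaysAway.reflect {T₀ α : ℝ} {V₀ : ℝ × ℝ × ℝ → ℝ} (h : StaysAway T₀ α V₀) :
    StaysAway T₀ (-α) (fun q => -V₀ (flipWindow q)) := fun q hq t ht => by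
  rw [show -α + q.1 = -(α + (flipWindow q).1) by rw [flipWindow_apply]; ring, pendFlow_reflect,
    Real.cos_neg]
  exact h _ (flipWindow_mem hq) t ht

lemma cos_lt_of_mem_Icc {x : ℝ} (h : x ∈ Icc (1 / 10) (2 * Real.pi - 1 / 10)) :
    Real.cos x < 999 / 1000 := by
  have hpi := Real.pi_gt_three
  have h1 : Real.cos (1 / 10) < 999 / 1000 := by
    have h2 : Real.pi ^ 2 < 10 := by nlinarith [Real.pi_lt_d2]
    have h3 : 1 / 5 < 2 / Real.pi ^ 2 := by
      rw [div_lt_div_iff₀ (by norm_num) (by positivity)]; linarith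
    have h4 : |(1 / 10 : ℝ)| ≤ Real.pi := by rw [abs_of_pos (by norm_num)]; linarith
    have := Real.cos_le_one_sub_mul_cos_sq h4
    linarith
  rcases le_total x Real.pi with hx | hx
  · exact (Real.cos_le_cos_of_nonneg_of_le_pi (by norm_num) hx h.1).trans_lt h1
  · rw [← Real.cos_two_pi_sub]
    exact (Real.cos_le_cos_of_nonneg_of_le_pi (by norm_num) (by linarith)
      (by linarith [h.2])).trans_lt h1

lemma one_le_speed {h x : ℝ} (hh : -(1 / 16) ≤ h) (hx : |x| ≤ 1 / 2) : 1 ≤ speed h x := by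
  have h1 := Real.one_sub_sq_div_two_le_cos (x := x)
  have h2 : x ^ 2 ≤ 1 / 4 := by rw [← sq_abs]; nlinarith [abs_nonneg x]
  rw [speed, Real.one_le_sqrt]
  linarith

/-! ### Rotations -/

section Rotation

/-- The inverse speed on the energy level `exp l`. -/
def invSpeedExp (q : ℝ × ℝ) : ℝ := 1 / speed (Real.exp q.1) q.2

lemma exp_add_one_add_cos_pos (l x : ℝ) : 0 < Real.exp l + 1 + Real.cos x := by
  linarith [Real.exp_pos l, Real.neg_one_le_cos x]

lemma contDiff_speed_exp : ContDiff ℝ ∞ fun q : ℝ × ℝ => speed (Real.exp q.1) q.2 := by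
  unfold speed
  refine ContDiff.sqrt (by fun_prop) fun _ => ?_
  exact (mul_pos two_pos (exp_add_one_add_cos_pos _ _)).ne'

lemma contDiff_invSpeedExp : ContDiff ℝ ∞ invSpeedExp :=
  contDiff_const.div contDiff_speed_exp fun _ => (speed_pos (exp_add_one_add_cos_pos _ _)).ne'

lemma hasDerivAt_speed_energy {h x : ℝ} (hx : 0 < h + 1 + Real.cos x) :
    HasDerivAt (fun h => speed h x) (1 / speed h x) h := by
  have h1 : HasDerivAt (fun h => 2 * (h + 1 + Real.cos x)) (2 * 1) h :=
    (((hasDerivAt_id h).add_const 1).add_const _).const_mul 2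
  have h2 := h1.sqrt (by linarith)
  rw [mul_div_mul_left _ _ two_ne_zero] at h2
  exact h2

lemma fderiv_invSpeedExp (l x : ℝ) : fderiv ℝ invSpeedExp (l, x) (1, 0) =
    -(Real.exp l * (1 / speed (Real.exp l) x ^ 3)) := by
  have h1 : HasDerivAt (fun l => invSpeedExp (l, x)) (fderiv ℝ invSpeedExp (l, x) (1, 0)) l :=
    HasFDerivAt.comp_hasDerivAt (l := invSpeedExp) l
      ((contDiff_invSpeedExp.differentiable (by simp)) _).hasFDerivAt
      ((hasDerivAt_id l).prodMk (hasDerivAt_const l x))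
  have hp := speed_pos (exp_add_one_add_cos_pos l x)
  have h2 := ((hasDerivAt_speed_energy (exp_add_one_add_cos_pos l x)).comp l
    (Real.hasDerivAt_exp l)).fun_inv hp.ne'
  simp only [invSpeedExp, one_div] at h1
  rw [h1.unique h2]
  simp only [Function.comp]
  field_simp

variable (L : ℝ)

/-- The time that a rotation of energy `exp l` takes from `a` to `L + b`. -/
def rotationTime (q : ℝ × ℝ × ℝ) : ℝ :=
  ∫ x in q.1..(L + q.2.1), 1 / speed (Real.exp q.2.2) x

/-- Up to the factor `-exp l`, the derivative of the rotation time with respect to `l`. -/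
def rotationSlope (q : ℝ × ℝ × ℝ) : ℝ :=
  ∫ x in q.1..(L + q.2.1), 1 / speed (Real.exp q.2.2) x ^ 3

lemma contDiff_rotationTime : ContDiff ℝ ∞ (rotationTime L) :=
  (contDiff_integral_endpoints contDiff_invSpeedExp).comp
    (by fun_prop : ContDiff ℝ ∞ fun q : ℝ × ℝ × ℝ => (q.2.2, q.1, L + q.2.1))

lemma fderiv_rotationTime (q v : ℝ × ℝ × ℝ) : fderiv ℝ (rotationTime L) q v =
    -(Real.exp q.2.2 * rotationSlope L q) * v.2.2 + invSpeedExp (q.2.2, L + q.2.1) * v.2.1 -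
      invSpeedExp (q.2.2, q.1) * v.1 := by
  set m : ℝ × ℝ × ℝ → ℝ × ℝ × ℝ := fun q => (q.2.2, q.1, L + q.2.1) with hm
  set A : ℝ × ℝ × ℝ →L[ℝ] ℝ × ℝ × ℝ :=
    ((ContinuousLinearMap.snd ℝ ℝ ℝ) ∘L (ContinuousLinearMap.snd ℝ ℝ (ℝ × ℝ))).prod
      ((ContinuousLinearMap.fst ℝ ℝ (ℝ × ℝ)).prod
        ((ContinuousLinearMap.fst ℝ ℝ ℝ) ∘L (ContinuousLinearMap.snd ℝ ℝ (ℝ × ℝ)))) with hA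
  have h1 : HasFDerivAt m A q := by
    have h0 : m = fun q => A q + (0, 0, L) := by
      funext q
      simp [hm, hA, add_comm]
    rw [h0]
    exact A.hasFDerivAt.add_const _
  have h2 := ((contDiff_integral_endpoints contDiff_invSpeedExp).differentiable (by simp)
    (m q)).hasFDerivAt.comp q h1
  have h3 : fderiv ℝ (rotationTime L) q = _ := h2.fderiv
  rw [h3, ContinuousLinearMap.comp_apply]
  have h4 := fderiv_integral_endpoints contDiff_invSpeedExp q.2.2 v.2.2 q.1 (L + q.2.1) v.1 v.2.1
  refine Eq.trans h4 ?_
  have h5 : ∀ x, fderiv ℝ invSpeedExp (q.2.2, x) (v.2.2, 0) =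
      -(Real.exp q.2.2 * v.2.2) * (1 / speed (Real.exp q.2.2) x ^ 3) := fun x => by
    rw [show ((v.2.2, 0) : ℝ × ℝ) = v.2.2 • (1, 0) by simp, map_smul, fderiv_invSpeedExp, smul_eq_mul]
    ring
  simp_rw [h5]
  rw [intervalIntegral.integral_const_mul, rotationSlope]
  ring

end Rotation

lemma hasFDerivAt_speed {h x : ℝ} (hx : 0 < h + 1 + Real.cos x) :
    HasFDerivAt (fun q : ℝ × ℝ => speed q.1 q.2)
      ((1 / speed h x) • ContinuousLinearMap.fst ℝ ℝ ℝ +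
        (-Real.sin x / speed h x) • ContinuousLinearMap.snd ℝ ℝ ℝ) (h, x) := by
  have h1 : HasFDerivAt (fun q : ℝ × ℝ => 2 * (q.1 + 1 + Real.cos q.2))
      ((2 : ℝ) • (ContinuousLinearMap.fst ℝ ℝ ℝ + -Real.sin x • ContinuousLinearMap.snd ℝ ℝ ℝ))
      (h, x) :=
    ((hasFDerivAt_fst.add_const 1).add
      (hasFDerivAt_snd (p := (h, x))).cos).const_mul 2
  have h2 := h1.sqrt (by positivity)
  refine h2.congr_fderiv ?_
  have hs := (speed_pos hx).ne'
  change (1 / (2 * speed h x)) • _ = _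
  ext
  · simp
  · simp
    field_simp

section Rotation

variable {L : ℝ}

lemma speed_le {h x : ℝ} : speed h x ≤ √(2 * (h + 2)) :=
  Real.sqrt_le_sqrt (by linarith [Real.cos_le_one x])

lemma sqrt_le_speed {h x : ℝ} : √(2 * h) ≤ speed h x :=
  Real.sqrt_le_sqrt (by linarith [Real.neg_one_le_cos x])

lemma intervalIntegrable_invSpeed_pow (l a b : ℝ) (n : ℕ) :
    IntervalIntegrable (fun x => 1 / speed (Real.exp l) x ^ n) MeasureTheory.volume a b :=
  (continuous_const.div ((continuous_speed _).pow n) fun _ =>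
    (pow_pos (speed_pos (exp_add_one_add_cos_pos _ _)) n).ne').intervalIntegrable a b

lemma intervalIntegrable_invSpeed (l a b : ℝ) :
    IntervalIntegrable (fun x => 1 / speed (Real.exp l) x) MeasureTheory.volume a b := by
  simpa using intervalIntegrable_invSpeed_pow l a b 1

lemma rotation_le (hL : 6 ≤ L) {q : ℝ × ℝ × ℝ} {Λ : Set ℝ} (hq : q ∈ windowDomain Λ) :
    q.1 ≤ L + q.2.1 := by
  have h1 := abs_lt.1 hq.1
  have h2 := abs_lt.1 hq.2.1
  unfold windowRadius at h1 h2
  linarith [h1.2, h2.1]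

/-- On the energy level `h = exp l` every speed is at least `√(2 h)`. -/
lemma two_mul_exp_mul_rotationSlope_le (hL : 6 ≤ L) {q : ℝ × ℝ × ℝ} {Λ : Set ℝ}
    (hq : q ∈ windowDomain Λ) :
    2 * Real.exp q.2.2 * rotationSlope L q ≤ rotationTime L q := by
  rw [rotationSlope, rotationTime, ← intervalIntegral.integral_const_mul]
  refine intervalIntegral.integral_mono_on (rotation_le hL hq)
    ((intervalIntegrable_invSpeed_pow _ _ _ 3).const_mul _) (intervalIntegrable_invSpeed _ _ _)
    fun x _ => ?_
  have hp := exp_add_one_add_cos_pos q.2.2 x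
  have h1 := speed_sq hp.le
  have h2 := speed_pos hp
  have h3 := Real.neg_one_le_cos x
  rw [mul_one_div, div_le_div_iff₀ (by positivity) h2]
  have : 2 * Real.exp q.2.2 ≤ speed (Real.exp q.2.2) x ^ 2 := by rw [h1]; linarith
  nlinarith

lemma rotationSlope_ge (hL : 6.2 ≤ L) {q : ℝ × ℝ × ℝ} {Λ : Set ℝ} (hq : q ∈ windowDomain Λ)
    (he : Real.exp q.2.2 ≤ 2) : 2 / 9 ≤ rotationSlope L q := by
  have hle := rotation_le (L := L) (by linarith) hq
  have h1 := intervalIntegral.integral_mono_on hle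
    (intervalIntegrable_const (c := (1 / 27 : ℝ)))
    (intervalIntegrable_invSpeed_pow q.2.2 _ _ 3) fun x _ => by
      have hp := exp_add_one_add_cos_pos q.2.2 x
      have h2 := speed_pos hp
      have h3 : speed (Real.exp q.2.2) x ≤ 3 := by
        refine speed_le.trans ?_
        rw [Real.sqrt_le_left (by norm_num)]
        linarith
      have h4 : speed (Real.exp q.2.2) x ^ 3 ≤ 27 := by
        calc speed (Real.exp q.2.2) x ^ 3 ≤ 3 ^ 3 := by gcongr
          _ = 27 := by norm_num
      exact one_div_le_one_div_of_le (by positivity) h4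
  rw [intervalIntegral.integral_const, smul_eq_mul] at h1
  have h2 := abs_lt.1 hq.1
  have h3 := abs_lt.1 hq.2.1
  unfold windowRadius at h2 h3
  rw [rotationSlope]
  linarith [h2.1, h2.2, h3.1, h3.2]

lemma rotationSlope_pos (hL : 6 ≤ L) {q : ℝ × ℝ × ℝ} {Λ : Set ℝ} (hq : q ∈ windowDomain Λ) :
    0 < rotationSlope L q := by
  have hlt : q.1 < L + q.2.1 := by
    have h1 := abs_lt.1 hq.1
    have h2 := abs_lt.1 hq.2.1
    unfold windowRadius at h1 h2
    linarith [h1.2, h2.1]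
  exact intervalIntegral.intervalIntegral_pos_of_pos (intervalIntegrable_invSpeed_pow _ _ _ 3)
    (fun x => one_div_pos.2 (pow_pos (speed_pos (exp_add_one_add_cos_pos _ _)) 3)) hlt

/-- At energy `h` the speed is between `√(2h)` and `√(2(h + 2))`, which bounds the duration. -/
lemma rotationTime_bounds (hL : 6 ≤ L) {q : ℝ × ℝ × ℝ} {Λ : Set ℝ} (hq : q ∈ windowDomain Λ) :
    (L - 1) / √(2 * (Real.exp q.2.2 + 2)) ≤ rotationTime L q ∧
      rotationTime L q ≤ (L + 1) / √(2 * Real.exp q.2.2) := by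
  have hle := rotation_le hL hq
  have h2 := abs_lt.1 hq.1
  have h3 := abs_lt.1 hq.2.1
  unfold windowRadius at h2 h3
  have hs : 0 < √(2 * Real.exp q.2.2) := Real.sqrt_pos.2 (by positivity)
  constructor
  · have h1 := intervalIntegral.integral_mono_on hle
      (intervalIntegrable_const (c := 1 / √(2 * (Real.exp q.2.2 + 2))))
      (intervalIntegrable_invSpeed q.2.2 _ _) fun x _ =>
        one_div_le_one_div_of_le (speed_pos (exp_add_one_add_cos_pos q.2.2 x)) speed_le
    rw [intervalIntegral.integral_const, smul_eq_mul, mul_one_div] at h1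
    refine le_trans ?_ h1
    have : L - 1 ≤ L + q.2.1 - q.1 := by linarith [h2.2, h3.1]
    gcongr
  · have h1 := intervalIntegral.integral_mono_on hle (intervalIntegrable_invSpeed q.2.2 _ _)
      (intervalIntegrable_const (c := 1 / √(2 * Real.exp q.2.2))) fun x _ =>
        one_div_le_one_div_of_le hs sqrt_le_speed
    rw [intervalIntegral.integral_const, smul_eq_mul, mul_one_div] at h1
    refine h1.trans ?_
    have : L + q.2.1 - q.1 ≤ L + 1 := by linarith [h2.1, h3.2]
    gcongr

/-- Close to the separatrix a rotation takes arbitrarily long: the passage over the top costs the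
logarithm of the inverse distance. -/
lemma lt_rotationTime (hL : 6.2 ≤ L) {q : ℝ × ℝ × ℝ} {Λ : Set ℝ} (hq : q ∈ windowDomain Λ) {T : ℝ}
    (hT : q.2.2 = -2 * T - Real.log 2) : T < rotationTime L q := by
  have h2 := abs_lt.1 hq.1
  have h3 := abs_lt.1 hq.2.1
  unfold windowRadius at h2 h3
  have hpi := Real.pi_gt_three
  have hpi' := Real.pi_lt_d2
  have hη : √(2 * Real.exp q.2.2) = Real.exp (-T) := by
    rw [hT, Real.exp_sub, Real.exp_log two_pos, mul_div_cancel₀ _ two_ne_zero,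
      show -2 * T = -T + -T by ring, Real.exp_add, Real.sqrt_mul_self (Real.exp_pos _).le]
  -- with `h` the energy and `η = √(2h)`, the speed at `x ≥ π` is at most `η + (x - π)`
  set η := Real.exp (-T) with hηd
  have hη0 : 0 < η := Real.exp_pos _
  have hpos : ∀ x ∈ uIcc Real.pi (Real.pi + 1), 0 < η + (x - Real.pi) := fun x hx => by
    rw [uIcc_of_le (by linarith)] at hx
    linarith [hx.1]
  have hd : ∀ x ∈ uIcc Real.pi (Real.pi + 1),
      HasDerivAt (fun x => Real.log (η + (x - Real.pi))) (1 / (η + (x - Real.pi))) x := fun x hx =>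
    (((hasDerivAt_id x).sub_const Real.pi).const_add η).log (hpos x hx).ne'
  have hint : IntervalIntegrable (fun x => 1 / (η + (x - Real.pi))) MeasureTheory.volume Real.pi
      (Real.pi + 1) :=
    (continuousOn_const.div (by fun_prop) fun x hx => (hpos x hx).ne').intervalIntegrable
  have h4 := intervalIntegral.integral_eq_sub_of_hasDerivAt hd hint
  have h5 : T < ∫ x in Real.pi..Real.pi + 1, 1 / (η + (x - Real.pi)) := by
    rw [h4, add_sub_cancel_left, sub_self, add_zero, hηd, Real.log_exp]
    have := Real.log_pos (show 1 < Real.exp (-T) + 1 by linarith)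
    linarith
  refine h5.trans_le ?_
  have h6 : ∫ x in Real.pi..Real.pi + 1, 1 / (η + (x - Real.pi)) ≤
      ∫ x in Real.pi..Real.pi + 1, 1 / speed (Real.exp q.2.2) x := by
    refine intervalIntegral.integral_mono_on (by linarith) hint (intervalIntegrable_invSpeed _ _ _)
      fun x hx => ?_
    have hp := exp_add_one_add_cos_pos q.2.2 x
    refine one_div_le_one_div_of_le (speed_pos hp) ?_
    rw [speed, Real.sqrt_le_left (by linarith [hx.1])]
    have h7 := Real.one_sub_sq_div_two_le_cos (x := x - Real.pi)
    rw [Real.cos_sub_pi] at h7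
    have h8 : η ^ 2 = 2 * Real.exp q.2.2 := by rw [← hη, Real.sq_sqrt (by positivity)]
    nlinarith [mul_nonneg hη0.le (sub_nonneg.2 hx.1)]
  refine h6.trans ?_
  exact intervalIntegral.integral_mono_interval (by linarith [h2.2]) (by linarith)
    (by linarith [h3.1])
    (Eventually.of_forall fun x => (one_div_pos.2 (speed_pos (exp_add_one_add_cos_pos _ _))).le)
    (intervalIntegrable_invSpeed _ _ _)

/-- Swings that make a positive number of full rotations. Their energy is positive, so that the
transit time is the integral of the inverse speed. -/
theorem exists_rotation_family (k : ℕ) (hk : 1 ≤ k) :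
    ∃ V₀ V₁ : ℝ × ℝ × ℝ → ℝ, IsSwingFamily 6 1 0 (2 * Real.pi * k) V₀ V₁ ∧
      (∀ q ∈ windowDomain (Ioi 1),
        (2 * Real.pi * k - 1) ^ 2 / (2 * q.2.2 ^ 2) - 2 ≤ pendEnergy (0 + q.1) (V₀ q)) ∧
      (k = 1 → StaysAway 1 0 V₀) := by
  set L : ℝ := 2 * Real.pi * k with hLdef
  have hL : 6.2 ≤ L := by
    have : (1 : ℝ) ≤ k := by exact_mod_cast hk
    have := Real.pi_gt_d2
    rw [hLdef]; nlinarith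
  have hL6 : 6 ≤ L := by linarith
  have hcosL : ∀ x, Real.cos (L + x) = Real.cos x := fun x => by
    have := cos_two_pi_int_add k x
    simpa using this
  have hsinL : ∀ x, Real.sin (L + x) = Real.sin x := fun x => by
    have := sin_two_pi_int_add k x
    simpa using this
  have hspL : ∀ h x, speed h (L + x) = speed h x := fun h x => by rw [speed, hcosL, speed]
  have hslope : ∀ q ∈ windowDomain univ, fderiv ℝ (rotationTime L) q (0, 0, 1) =
      -(Real.exp q.2.2 * rotationSlope L q) := fun q _ => by
    rw [fderiv_rotationTime]; simp
  have hslope_neg : ∀ q ∈ windowDomain univ, fderiv ℝ (rotationTime L) q (0, 0, 1) < 0 :=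
    fun q hq => by
      rw [hslope q hq, neg_lt_zero]
      exact mul_pos (Real.exp_pos _) (rotationSlope_pos hL6 hq)
  have hline : ∀ a b l, HasDerivAt (fun l => rotationTime L (a, b, l))
      (fderiv ℝ (rotationTime L) (a, b, l) (0, 0, 1)) l := fun a b l =>
    HasFDerivAt.comp_hasDerivAt (l := rotationTime L) l
      ((contDiff_rotationTime L).differentiable (by simp) _).hasFDerivAt
      ((hasDerivAt_const l a).prodMk ((hasDerivAt_const l b).prodMk (hasDerivAt_id l)))
  obtain ⟨l, -, hl, hW⟩ := exists_reparametrization (G := rotationTime L) (Λ := univ) (T₀ := 1)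
    isOpen_univ (contDiff_rotationTime L).contDiffOn (fun q hq => (hslope_neg q hq).ne)
    (fun a b ha hb => (strictAnti_of_deriv_neg fun l => by
      rw [(hline a b l).deriv]; exact hslope_neg _ ⟨ha, hb, mem_univ _⟩).injective.injOn)
    (fun a b T ha hb hT => by
      have hc : Continuous fun l => rotationTime L (a, b, l) :=
        continuous_iff_continuousAt.2 fun l => (hline a b l).continuousAt
      have h1 : T < rotationTime L (a, b, -2 * T - Real.log 2) :=
        lt_rotationTime hL (q := (a, b, -2 * T - Real.log 2)) (Λ := univ)
          ⟨ha, hb, mem_univ _⟩ rfl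
      have h2 : rotationTime L (a, b, 2 * Real.log (L + 1)) < T := by
        refine lt_of_le_of_lt (rotationTime_bounds hL6 (q := (a, b, 2 * Real.log (L + 1)))
          (Λ := univ) ⟨ha, hb, mem_univ _⟩).2 (lt_trans ?_ hT)
        have h3 : Real.exp (2 * Real.log (L + 1)) = (L + 1) ^ 2 := by
          rw [show 2 * Real.log (L + 1) = Real.log (L + 1) + Real.log (L + 1) by ring,
            Real.exp_add, Real.exp_log (by linarith), sq]
        rw [div_lt_one (Real.sqrt_pos.2 (by positivity)), Real.lt_sqrt (by linarith), h3]
        nlinarith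
      obtain ⟨l, -, hl⟩ := intermediate_value_uIcc (a := 2 * Real.log (L + 1))
        (b := -2 * T - Real.log 2) hc.continuousOn (show T ∈ _ by
          rw [uIcc_of_le (h2.trans h1).le]; exact ⟨h2.le, h1.le⟩)
      exact ⟨l, mem_univ _, hl⟩)
  -- the speeds at the two ends, in terms of the logarithm of the energy
  have hs₀ : ContDiff ℝ ∞ fun q : ℝ × ℝ × ℝ => speed (Real.exp q.2.2) q.1 :=
    contDiff_speed_exp.comp (by fun_prop : ContDiff ℝ ∞ fun q : ℝ × ℝ × ℝ => (q.2.2, q.1))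
  have hs₁ : ContDiff ℝ ∞ fun q : ℝ × ℝ × ℝ => speed (Real.exp q.2.2) q.2.1 :=
    contDiff_speed_exp.comp (by fun_prop : ContDiff ℝ ∞ fun q : ℝ × ℝ × ℝ => (q.2.2, q.2.1))
  obtain ⟨hV₀, hd₀⟩ := hW _ hs₀.contDiffOn
  obtain ⟨hV₁, hd₁⟩ := hW _ hs₁.contDiffOn
  have hsp : ∀ l x, HasFDerivAt (fun q : ℝ × ℝ => speed (Real.exp q.1) q.2)
      ((Real.exp l / speed (Real.exp l) x) • ContinuousLinearMap.fst ℝ ℝ ℝ +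
        (-Real.sin x / speed (Real.exp l) x) • ContinuousLinearMap.snd ℝ ℝ ℝ) (l, x) := by
    intro l x
    have h1 : HasFDerivAt (fun q : ℝ × ℝ => (Real.exp q.1, q.2))
        ((Real.exp l • ContinuousLinearMap.fst ℝ ℝ ℝ).prod (ContinuousLinearMap.snd ℝ ℝ ℝ)) (l, x) :=
      (hasFDerivAt_fst (p := (l, x))).exp.prodMk hasFDerivAt_snd
    have h2 := HasFDerivAt.comp (g := fun q : ℝ × ℝ => speed q.1 q.2) (l, x)
      (hasFDerivAt_speed (h := Real.exp l) (exp_add_one_add_cos_pos l x)) h1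
    refine h2.congr_fderiv ?_
    ext <;> simp [div_eq_inv_mul]
  have hf₀ : ∀ q v : ℝ × ℝ × ℝ, fderiv ℝ (fun q : ℝ × ℝ × ℝ => speed (Real.exp q.2.2) q.1) q v =
      Real.exp q.2.2 / speed (Real.exp q.2.2) q.1 * v.2.2 +
        -Real.sin q.1 / speed (Real.exp q.2.2) q.1 * v.1 := by
    intro q v
    set A : ℝ × ℝ × ℝ →L[ℝ] ℝ × ℝ := ((ContinuousLinearMap.snd ℝ ℝ ℝ) ∘L
      (ContinuousLinearMap.snd ℝ ℝ (ℝ × ℝ))).prod (ContinuousLinearMap.fst ℝ ℝ (ℝ × ℝ))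
    have h1 := (hsp q.2.2 q.1).comp (f := A) q A.hasFDerivAt
    have h2 : fderiv ℝ (fun q : ℝ × ℝ × ℝ => speed (Real.exp q.2.2) q.1) q = _ := h1.fderiv
    rw [h2]
    simp [A]
  have hf₁ : ∀ q v : ℝ × ℝ × ℝ, fderiv ℝ (fun q : ℝ × ℝ × ℝ => speed (Real.exp q.2.2) q.2.1) q v =
      Real.exp q.2.2 / speed (Real.exp q.2.2) q.2.1 * v.2.2 +
        -Real.sin q.2.1 / speed (Real.exp q.2.2) q.2.1 * v.2.1 := by
    intro q v
    set A : ℝ × ℝ × ℝ →L[ℝ] ℝ × ℝ := ((ContinuousLinearMap.snd ℝ ℝ ℝ) ∘L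
      (ContinuousLinearMap.snd ℝ ℝ (ℝ × ℝ))).prod ((ContinuousLinearMap.fst ℝ ℝ ℝ) ∘L
      (ContinuousLinearMap.snd ℝ ℝ (ℝ × ℝ)))
    have h1 := (hsp q.2.2 q.2.1).comp (f := A) q A.hasFDerivAt
    have h2 : fderiv ℝ (fun q : ℝ × ℝ × ℝ => speed (Real.exp q.2.2) q.2.1) q = _ := h1.fderiv
    rw [h2]
    simp [A]
  set V₀ : ℝ × ℝ × ℝ → ℝ := fun q => speed (Real.exp (l q)) q.1 with hV₀def
  set V₁ : ℝ × ℝ × ℝ → ℝ := fun q => speed (Real.exp (l q)) q.2.1 with hV₁def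
  set I : ℝ × ℝ × ℝ → ℝ := fun q => rotationSlope L (q.1, q.2.1, l q) with hI
  have hIpos : ∀ q ∈ windowDomain (Ioi 1), 0 < I q := fun q hq => rotationSlope_pos hL6 (hl q hq).1
  have hsm : ∀ x : ℝ, |x| < windowRadius → ∀ h, 1 ≤ speed (Real.exp h) x := fun x hx h =>
    one_le_speed (by linarith [Real.exp_pos h]) (by unfold windowRadius at hx; linarith)
  have hG : ∀ q : ℝ × ℝ × ℝ, ∀ x y : ℝ, fderiv ℝ (rotationTime L) (q.1, q.2.1, l q) (x, y, 0) =
      1 / V₁ q * y - 1 / V₀ q * x := fun q x y => by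
    rw [fderiv_rotationTime]
    simp [invSpeedExp, hspL, hV₀def, hV₁def]
  have hp₀ : ∀ q ∈ windowDomain (Ioi 1), 1 ≤ V₀ q := fun q hq => hsm _ hq.1 _
  have hp₁ : ∀ q ∈ windowDomain (Ioi 1), 1 ≤ V₁ q := fun q hq => hsm _ hq.2.1 _
  have hD₀ : ∀ q ∈ windowDomain (Ioi 1), fderiv ℝ V₀ q (1, 0, 0) =
      -Real.sin q.1 / V₀ q - 1 / (V₀ q * V₀ q * I q) ∧
      fderiv ℝ V₀ q (0, 1, 0) = 1 / (V₀ q * V₁ q * I q) ∧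
      fderiv ℝ V₀ q (0, 0, 1) = -(1 / (V₀ q * I q)) := by
    intro q hq
    have h1 := hIpos q hq
    have h2 := hp₀ q hq
    have h3 := hp₁ q hq
    have he := Real.exp_pos (l q)
    refine ⟨(hd₀ q hq _).trans ?_, (hd₀ q hq _).trans ?_, (hd₀ q hq _).trans ?_⟩ <;>
    · rw [hf₀, hf₀, hslope _ (hl q hq).1, hG]
      change _ / V₀ q * _ + _ / V₀ q * _ + (_ / V₀ q * _ + _ / V₀ q * _) * (_ / -(_ * I q)) = _
      field_simp
      ring
  have hD₁ : ∀ q ∈ windowDomain (Ioi 1), fderiv ℝ V₁ q (1, 0, 0) = -(1 / (V₀ q * V₁ q * I q)) ∧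
      fderiv ℝ V₁ q (0, 1, 0) = -Real.sin q.2.1 / V₁ q + 1 / (V₁ q * V₁ q * I q) ∧
      fderiv ℝ V₁ q (0, 0, 1) = -(1 / (V₁ q * I q)) := by
    intro q hq
    have h1 := hIpos q hq
    have h2 := hp₀ q hq
    have h3 := hp₁ q hq
    have he := Real.exp_pos (l q)
    refine ⟨(hd₁ q hq _).trans ?_, (hd₁ q hq _).trans ?_, (hd₁ q hq _).trans ?_⟩ <;>
    · rw [hf₁, hf₁, hslope _ (hl q hq).1, hG]
      change _ / V₁ q * _ + _ / V₁ q * _ + (_ / V₁ q * _ + _ / V₁ q * _) * (_ / -(_ * I q)) = _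
      field_simp
      ring
  have hE : ∀ q, pendEnergy (0 + q.1) (V₀ q) = Real.exp (l q) := fun q => by
    rw [zero_add]; exact pendEnergy_speed (exp_add_one_add_cos_pos _ _).le
  have hdecay : ∀ q ∈ windowDomain (Ioi 1), V₀ q * fderiv ℝ V₀ q (0, 0, 1) = -(1 / I q) := by
    intro q hq
    have h1 := hIpos q hq
    have h2 := hp₀ q hq
    rw [(hD₀ q hq).2.2]
    field_simp
  have hT0 : ∀ q ∈ windowDomain (Ioi (1 : ℝ)), 0 < q.2.2 := fun q hq =>
    lt_trans one_pos hq.2.2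
  have htrans := fun (q : ℝ × ℝ × ℝ) (hq : q ∈ windowDomain (Ioi 1)) =>
    pendFlow_transit (h := Real.exp (l q)) (rotation_le hL6 hq)
      (fun x _ => exp_add_one_add_cos_pos _ x)
  have htime : ∀ q ∈ windowDomain (Ioi 1),
      ∫ y in q.1..L + q.2.1, 1 / speed (Real.exp (l q)) y = q.2.2 := fun q hq => (hl q hq).2
  refine ⟨V₀, V₁, ⟨hV₀, hV₁, ?_, ?_, ?_, ?_, ?_, ?_, ?_⟩, ?_, ?_⟩
  · intro q hq
    have := (htrans q hq).1
    rw [htime q hq, hspL] at this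
    rw [zero_add]
    exact this
  · intro q hq he
    rw [hE] at he
    have h1 : 2 / 9 ≤ I q := rotationSlope_ge hL (hl q hq).1 he
    have h2 := hp₀ q hq
    have h3 := hp₁ q hq
    have key : ∀ x y : ℝ, 1 ≤ x → 1 ≤ y → 0 < 1 / (x * y * I q) ∧ 1 / (x * y * I q) ≤ 9 / 2 := by
      intro x y hx hy
      have : 2 / 9 ≤ x * y * I q := by nlinarith [mul_le_mul hx hy zero_le_one (by linarith)]
      exact ⟨by positivity, by
        rw [div_le_div_iff₀ (by linarith) (by norm_num)]; linarith⟩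
    have hsin : ∀ x y : ℝ, 1 ≤ y → |-Real.sin x / y| ≤ 1 := fun x y hy => by
      rw [abs_div, abs_neg, abs_of_pos (by linarith : 0 < y), div_le_one (by linarith)]
      exact (Real.abs_sin_le_one x).trans hy
    obtain ⟨a1, a2, -⟩ := hD₀ q hq
    obtain ⟨b1, b2, -⟩ := hD₁ q hq
    have k00 := key _ _ h2 h2
    have k01 := key _ _ h2 h3
    have k11 := key _ _ h3 h3
    have s0 := abs_le.1 (hsin q.1 _ h2)
    have s1 := abs_le.1 (hsin q.2.1 _ h3)
    rw [a1, a2, b1, b2]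
    refine ⟨⟨?_, ?_⟩, ?_, ?_⟩ <;> rw [abs_le] <;> constructor <;> linarith
  · intro q hq
    rw [hE, hdecay q hq]
    have h1 := two_mul_exp_mul_rotationSlope_le hL6 (hl q hq).1
    rw [(hl q hq).2] at h1
    have h2 := hT0 q hq
    have h3 := hIpos q hq
    have h4 : 2 * Real.exp (l q) / q.2.2 ≤ 1 / I q := by
      rw [div_le_div_iff₀ h2 h3]; linarith
    have h5 : (0 : ℝ) ≤ 6 / q.2.2 ^ 2 := by positivity
    rw [neg_mul, neg_div]
    linarith
  · intro q hq
    have h1 := hIpos q hq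
    have h2 := hp₀ q hq
    rw [hdecay q hq, neg_neg, (hD₀ q hq).2.2, abs_neg, abs_of_pos (by positivity)]
    have h3 : 1 / (V₀ q * I q) ≤ 1 / I q :=
      one_div_le_one_div_of_le h1 (le_mul_of_one_le_left h1.le h2)
    have h4 : 0 < 1 / I q := by positivity
    have h5 : (0 : ℝ) ≤ 6 / q.2.2 ^ 2 := by positivity
    linarith
  · intro q hq
    have h1 := hIpos q hq
    have h2 := hp₁ q hq
    rw [hdecay q hq, neg_neg, (hD₁ q hq).2.2, abs_neg, abs_of_pos (by positivity)]
    have h3 : 1 / (V₁ q * I q) ≤ 1 / I q :=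
      one_div_le_one_div_of_le h1 (le_mul_of_one_le_left h1.le h2)
    have h4 : 0 < 1 / I q := by positivity
    have h5 : (0 : ℝ) ≤ 6 / q.2.2 ^ 2 := by positivity
    linarith
  · intro q hq
    rw [hE]
    have h5 : (0 : ℝ) ≤ 6 / q.2.2 ^ 2 := by positivity
    linarith [Real.exp_pos (l q)]
  · refine ⟨(L + 1) ^ 2 / 2, fun q hq => ?_⟩
    have h1 := (rotationTime_bounds hL6 (hl q hq).1).2
    rw [(hl q hq).2, le_div_iff₀ (Real.sqrt_pos.2 (by positivity))] at h1
    have h2 := hT0 q hq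
    have h3 := pow_le_pow_left₀ (by positivity) h1 2
    rw [mul_pow, Real.sq_sqrt (by positivity)] at h3
    rw [hE, le_div_iff₀ (by positivity)]
    linarith
  · intro q hq
    have h1 := (rotationTime_bounds hL6 (hl q hq).1).1
    rw [(hl q hq).2, div_le_iff₀ (Real.sqrt_pos.2 (by positivity))] at h1
    have h2 := hT0 q hq
    have h3 := pow_le_pow_left₀ (by linarith) h1 2
    rw [mul_pow, Real.sq_sqrt (by positivity)] at h3
    rw [hE, sub_le_iff_le_add, div_le_iff₀ (by positivity)]
    linarith
  · intro hk1 q hq t ht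
    have hL1 : L = 2 * Real.pi := by rw [hLdef, hk1]; simp
    have ht' : t ∈ Icc 0 (∫ y in q.1..L + q.2.1, 1 / speed (Real.exp (l q)) y) := by
      rw [htime q hq]; exact ⟨by linarith [ht.1], by linarith [ht.2]⟩
    obtain ⟨x, hx, hx1, hx2⟩ := (htrans q hq).2 t ht'
    rw [zero_add, show V₀ q = speed (Real.exp (l q)) q.1 from rfl, hx1]
    have ha := abs_lt.1 hq.1
    have hb := abs_lt.1 hq.2.1
    unfold windowRadius at ha hb
    have hii := intervalIntegrable_invSpeed (l q)
    refine cos_lt_of_mem_Icc ⟨?_, ?_⟩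
    · by_contra! hlt
      have h1 := intervalIntegral.integral_mono_on hx.1 (hii q.1 x)
        (intervalIntegrable_const (c := 1)) fun y hy => by
          rw [div_le_one (speed_pos (exp_add_one_add_cos_pos _ _))]
          exact one_le_speed (by linarith [Real.exp_pos (l q)])
            (abs_le.2 ⟨by linarith [hy.1, ha.1], by linarith [hy.2]⟩)
      rw [hx2, intervalIntegral.integral_const, smul_eq_mul] at h1
      linarith [ht.1, ha.1]
    · by_contra! hlt
      have h1 := intervalIntegral.integral_mono_on hx.2 (hii x (L + q.2.1))
        (intervalIntegrable_const (c := 1)) fun y hy => by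
          rw [div_le_one (speed_pos (exp_add_one_add_cos_pos _ _)), ← add_sub_cancel L y, hspL]
          exact one_le_speed (by linarith [Real.exp_pos (l q)])
            (abs_le.2 ⟨by linarith [hy.1], by linarith [hy.2, hb.2]⟩)
      have h2 := intervalIntegral.integral_add_adjacent_intervals (hii q.1 x) (hii x (L + q.2.1))
      rw [hx2, htime q hq] at h2
      rw [intervalIntegral.integral_const, smul_eq_mul] at h1
      linarith [ht.2, hb.2]

end Rotation

/-! ### A smooth extension of the inverse square root -/

/-- A smooth positive function that agrees with the identity on `[1/10, ∞)`. -/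
def positiveExtension (X : ℝ) : ℝ :=
  X * Real.smoothTransition (20 * X - 1) + (1 - Real.smoothTransition (20 * X - 1))

lemma positiveExtension_pos (X : ℝ) : 0 < positiveExtension X := by
  unfold positiveExtension
  rcases le_or_gt X (1 / 20) with h | h
  · rw [Real.smoothTransition.zero_of_nonpos (by linarith)]; norm_num
  · have h0 := Real.smoothTransition.nonneg (20 * X - 1)
    have h1 := Real.smoothTransition.le_one (20 * X - 1)
    nlinarith

lemma positiveExtension_eq {X : ℝ} (hX : 1 / 10 ≤ X) : positiveExtension X = X := by
  unfold positiveExtension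
  rw [Real.smoothTransition.one_of_one_le (by linarith)]; ring

lemma contDiff_positiveExtension : ContDiff ℝ ∞ positiveExtension := by
  have h : ContDiff ℝ ∞ fun X : ℝ => Real.smoothTransition (20 * X - 1) :=
    Real.smoothTransition.contDiff.comp (by fun_prop)
  unfold positiveExtension
  fun_prop

/-- A smooth function on `ℝ` that agrees with `1 / √X` on `[1/10, ∞)`. -/
def invSqrt (X : ℝ) : ℝ := (√(positiveExtension X))⁻¹

lemma contDiff_invSqrt : ContDiff ℝ ∞ invSqrt :=
  (contDiff_positiveExtension.sqrt fun X => (positiveExtension_pos X).ne').inv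
    fun X => (Real.sqrt_pos.2 (positiveExtension_pos X)).ne'

lemma invSqrt_eq {X : ℝ} (hX : 1 / 10 ≤ X) : invSqrt X = 1 / √X := by
  rw [invSqrt, positiveExtension_eq hX, one_div]

lemma hasDerivAt_invSqrt {X : ℝ} (hX : 1 / 10 < X) :
    HasDerivAt invSqrt (-(1 / (2 * (X * √X)))) X := by
  have h0 : 0 < X := by linarith
  have hs := Real.sqrt_pos.2 h0
  have h1 : HasDerivAt (fun X : ℝ => (√X)⁻¹) (-(1 / (2 * (X * √X)))) X := by
    refine ((Real.hasDerivAt_sqrt h0.ne').fun_inv hs.ne').congr_deriv ?_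
    have := Real.sq_sqrt h0.le
    rw [this]; field_simp
  refine h1.congr_of_eventuallyEq ?_
  filter_upwards [lt_mem_nhds hX] with Y hY
  rw [invSqrt, positiveExtension_eq hY.le]

/-! ### Motion near the upright position -/

/-- With `u` the displacement from the upright position, `s = sin (u / 2)` solves the linear
equation `s'' = s` with respect to a new time `σ`, where `dσ = cos (u / 2) dt`. This is its general
solution on `[0, S]`. -/
def holdProfile (A B S σ : ℝ) : ℝ := A * Real.exp (-σ) + B * Real.exp (σ - S)

lemma exp_neg_add_exp_sub_le {S σ : ℝ} (h : σ ∈ Icc 0 S) :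
    Real.exp (-σ) + Real.exp (σ - S) ≤ 1 + Real.exp (-S) := by
  have h1 : Real.exp (-σ) ≤ 1 := Real.exp_le_one_iff.2 (by linarith [h.1])
  have h2 : Real.exp (σ - S) ≤ 1 := Real.exp_le_one_iff.2 (by linarith [h.2])
  have h3 : Real.exp (-S) = Real.exp (-σ) * Real.exp (σ - S) := by
    rw [← Real.exp_add]; congr 1; ring
  nlinarith

lemma abs_holdProfile_le {A B S σ : ℝ} (hA : |A| ≤ 27 / 100) (hB : |B| ≤ 27 / 100)
    (hS : Real.exp (-S) ≤ 1 / 1000) (h : σ ∈ Icc 0 S) : |holdProfile A B S σ| ≤ 7 / 25 := by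
  have h1 := exp_neg_add_exp_sub_le h
  have h2 := Real.exp_pos (-σ)
  have h3 := Real.exp_pos (σ - S)
  calc |holdProfile A B S σ| ≤ |A * Real.exp (-σ)| + |B * Real.exp (σ - S)| := abs_add_le _ _
    _ = |A| * Real.exp (-σ) + |B| * Real.exp (σ - S) := by
      rw [abs_mul, abs_mul, abs_of_pos h2, abs_of_pos h3]
    _ ≤ 27 / 100 * Real.exp (-σ) + 27 / 100 * Real.exp (σ - S) := by gcongr
    _ ≤ 7 / 25 := by linarith

lemma hasDerivAt_holdProfile (A B S σ : ℝ) :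
    HasDerivAt (holdProfile A B S) (-(A * Real.exp (-σ)) + B * Real.exp (σ - S)) σ := by
  have h1 := ((hasDerivAt_id σ).neg.exp.const_mul A).add
    (((hasDerivAt_id σ).sub_const S).exp.const_mul B)
  refine (h1.congr_deriv ?_)
  simp

lemma nine_tenths_le_one_sub_sq {s : ℝ} (h : |s| ≤ 7 / 25) : 9 / 10 ≤ 1 - s ^ 2 := by
  have := abs_le.1 h
  nlinarith

/-- The time that the motion with the given profile takes. -/
def holdTime (A B S : ℝ) : ℝ := ∫ σ in (0 : ℝ)..S, invSqrt (1 - holdProfile A B S σ ^ 2)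

/-- Transforming the explicit solution back gives a motion of the pendulum that stays away from the
bottom position. -/
lemma pendFlow_hold {A B S : ℝ} (hS0 : 0 ≤ S) (hA : |A| ≤ 27 / 100) (hB : |B| ≤ 27 / 100)
    (hS : Real.exp (-S) ≤ 1 / 1000) :
    pendFlow (holdTime A B S) (Real.pi + 2 * Real.arcsin (A + B * Real.exp (-S)),
        2 * (-A + B * Real.exp (-S))) =
      (Real.pi + 2 * Real.arcsin (B + A * Real.exp (-S)), -(2 * (-B + A * Real.exp (-S)))) ∧
    ∀ t ∈ Icc 0 (holdTime A B S),
      Real.cos (pendFlow t (Real.pi + 2 * Real.arcsin (A + B * Real.exp (-S)),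
        2 * (-A + B * Real.exp (-S)))).1 < 999 / 1000 := by
  have hs : ∀ σ ∈ Icc 0 S, |holdProfile A B S σ| ≤ 7 / 25 := fun σ h => abs_holdProfile_le hA hB hS h
  have hcs : Continuous (holdProfile A B S) :=
    continuous_iff_continuousAt.2 fun σ => (hasDerivAt_holdProfile A B S σ).continuousAt
  obtain ⟨x, hx0, hx1, hx⟩ := exists_motion (φ := fun σ => invSqrt (1 - holdProfile A B S σ ^ 2)) hS0
    (contDiff_invSqrt.continuous.comp (by fun_prop)).continuousOn (fun σ hσ => by
      have := nine_tenths_le_one_sub_sq (hs σ hσ)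
      rw [invSqrt_eq (by linarith)]
      exact one_div_pos.2 (Real.sqrt_pos.2 (by linarith)))
  change x (holdTime A B S) = S at hx1
  change ∀ t ∈ Icc 0 (holdTime A B S), _ at hx
  set v : ℝ → ℝ := fun σ => -(A * Real.exp (-σ)) + B * Real.exp (σ - S) with hv
  have hvd : ∀ σ, HasDerivAt v (holdProfile A B S σ) σ := fun σ => by
    have h1 := ((hasDerivAt_id σ).neg.exp.const_mul A).neg.add
      (((hasDerivAt_id σ).sub_const S).exp.const_mul B)
    refine h1.congr_deriv ?_
    simp [holdProfile]
  set c : ℝ → ℝ × ℝ := fun t =>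
    (Real.pi + 2 * Real.arcsin (holdProfile A B S (x t)), 2 * v (x t)) with hc
  have hcd : ∀ t ∈ Icc 0 (holdTime A B S),
      HasDerivWithinAt c (pendField (c t)) (Icc 0 (holdTime A B S)) t := by
    intro t ht
    obtain ⟨h1, -, h2⟩ := hx t ht
    have h3 := hs _ h1
    have h3' := abs_le.1 h3
    have h4 := nine_tenths_le_one_sub_sq h3
    have h5 : 0 < √(1 - holdProfile A B S (x t) ^ 2) := Real.sqrt_pos.2 (by linarith)
    rw [invSqrt_eq (by linarith), one_div_one_div] at h2
    have h6 : HasDerivWithinAt (fun t => Real.pi + 2 * Real.arcsin (holdProfile A B S (x t)))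
        (2 * v (x t)) (Icc 0 (holdTime A B S)) t := by
      have e1 := (hasDerivAt_holdProfile A B S (x t)).comp_hasDerivWithinAt t h2
      have e2 := (Real.hasDerivAt_arcsin (x := holdProfile A B S (x t)) (by linarith)
        (by linarith)).comp_hasDerivWithinAt t e1
      refine ((e2.const_mul 2).const_add Real.pi).congr_deriv ?_
      rw [hv]; field_simp
    have h7 : HasDerivWithinAt (fun t => 2 * v (x t))
        (-Real.sin (Real.pi + 2 * Real.arcsin (holdProfile A B S (x t))))
        (Icc 0 (holdTime A B S)) t := by
      have e1 := (hvd (x t)).comp_hasDerivWithinAt t h2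
      refine (e1.const_mul 2).congr_deriv ?_
      rw [add_comm, Real.sin_add_pi, neg_neg, Real.sin_two_mul, Real.cos_arcsin,
        Real.sin_arcsin (by linarith) (by linarith)]
      ring
    exact h6.prodMk h7
  have hT : 0 ≤ holdTime A B S := by
    refine intervalIntegral.integral_nonneg hS0 fun σ hσ => ?_
    have := nine_tenths_le_one_sub_sq (hs σ hσ)
    rw [invSqrt_eq (by linarith)]
    positivity
  have hc0 : c 0 = (Real.pi + 2 * Real.arcsin (A + B * Real.exp (-S)),
      2 * (-A + B * Real.exp (-S))) := by
    simp [hc, hx0, hv, holdProfile]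
  have key : ∀ t ∈ Icc 0 (holdTime A B S), pendFlow t (c 0) = c t := fun t ht => by
    have := isFlow_pendFlow.eq_of_hasDerivWithinAt lipschitzWith_pendField hcd ht
    rw [this, sub_zero]
  rw [← hc0]
  refine ⟨?_, fun t ht => ?_⟩
  · rw [key _ (right_mem_Icc.2 hT)]
    simp only [hc, hx1, hv, holdProfile, sub_self, Real.exp_zero]
    congr 1 <;> ring_nf
  · rw [key t ht]
    have h3 := hs _ (hx t ht).1
    have h3' := abs_le.1 h3
    have h4 := nine_tenths_le_one_sub_sq h3
    simp only [hc]
    rw [add_comm, Real.cos_add_pi, Real.cos_two_mul, Real.cos_arcsin, Real.sq_sqrt (by linarith)]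
    linarith

lemma fderiv_apply_eq_of_hasDerivAt {E : Type} [NormedAddCommGroup E] [NormedSpace ℝ E]
    {f : E → ℝ} {p v : E} {d : ℝ} (hf : DifferentiableAt ℝ f p)
    (hd : HasDerivAt (fun t : ℝ => f (p + t • v)) d 0) : fderiv ℝ f p v = d :=
  (hf.hasFDerivAt.hasLineDerivAt v).unique hd

/-- The integrand of `holdTime`, as a function of the parameters `(A, B, S)` and of `σ`. -/
def holdIntegrand (q : (ℝ × ℝ × ℝ) × ℝ) : ℝ :=
  invSqrt (1 - holdProfile q.1.1 q.1.2.1 q.1.2.2 q.2 ^ 2)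

lemma contDiff_holdIntegrand : ContDiff ℝ ∞ holdIntegrand := by
  refine contDiff_invSqrt.comp ?_
  unfold holdProfile
  fun_prop

lemma contDiff_holdTime : ContDiff ℝ ∞ fun p : ℝ × ℝ × ℝ => holdTime p.1 p.2.1 p.2.2 :=
  (contDiff_integral_endpoints contDiff_holdIntegrand).comp
    (f := fun p : ℝ × ℝ × ℝ => (p, (0 : ℝ), p.2.2)) (by fun_prop)

lemma one_le_holdIntegrand {A B S σ : ℝ} (h : |holdProfile A B S σ| ≤ 7 / 25) :
    1 ≤ invSqrt (1 - holdProfile A B S σ ^ 2) ∧ invSqrt (1 - holdProfile A B S σ ^ 2) ≤ 11 / 10 := by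
  have h4 := nine_tenths_le_one_sub_sq h
  have h5 : √(1 - holdProfile A B S σ ^ 2) ≤ 1 := Real.sqrt_le_one.2 (by nlinarith)
  have h7 := abs_le.1 h
  have h6 : 10 / 11 ≤ √(1 - holdProfile A B S σ ^ 2) := Real.le_sqrt_of_sq_le (by nlinarith)
  rw [invSqrt_eq (by linarith)]
  constructor
  · rw [le_div_iff₀ (by linarith)]; linarith
  · rw [div_le_iff₀ (by linarith)]; linarith

lemma holdTime_bounds {A B S : ℝ} (hS0 : 0 ≤ S) (hA : |A| ≤ 27 / 100) (hB : |B| ≤ 27 / 100)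
    (hS : Real.exp (-S) ≤ 1 / 1000) : S ≤ holdTime A B S ∧ holdTime A B S ≤ 11 / 10 * S := by
  have hs : ∀ σ ∈ Icc 0 S, |holdProfile A B S σ| ≤ 7 / 25 := fun σ h => abs_holdProfile_le hA hB hS h
  have hi : IntervalIntegrable (fun σ => invSqrt (1 - holdProfile A B S σ ^ 2))
      MeasureTheory.volume 0 S :=
    (contDiff_holdIntegrand.continuous.comp
      (f := fun σ : ℝ => (((A, B, S) : ℝ × ℝ × ℝ), σ)) (by fun_prop)).intervalIntegrable _ _
  have h1 := intervalIntegral.integral_mono_on hS0 (intervalIntegrable_const (c := 1)) hi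
    fun σ hσ => (one_le_holdIntegrand (hs σ hσ)).1
  have h2 := intervalIntegral.integral_mono_on hS0 hi (intervalIntegrable_const (c := 11 / 10))
    fun σ hσ => (one_le_holdIntegrand (hs σ hσ)).2
  rw [intervalIntegral.integral_const, smul_eq_mul] at h1 h2
  unfold holdTime
  constructor <;> linarith

lemma abs_fderiv_holdIntegrand_le {A B S σ : ℝ} (hB : |B| ≤ 27 / 100)
    (h : |holdProfile A B S σ| ≤ 7 / 25) (v : ℝ × ℝ × ℝ) :
    |fderiv ℝ holdIntegrand ((A, B, S), σ) (v, 0)| ≤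
      1 / 2 * |v.1| * Real.exp (-σ) + 1 / 2 * (|v.2.1| + |v.2.2|) * Real.exp (σ - S) := by
  set s := holdProfile A B S σ with hs
  have h4 := nine_tenths_le_one_sub_sq h
  have h5 : 9 / 10 ≤ √(1 - s ^ 2) := Real.le_sqrt_of_sq_le (by linarith)
  set d := v.1 * Real.exp (-σ) + (v.2.1 - B * v.2.2) * Real.exp (σ - S) with hd
  have e1 : HasDerivAt (fun t : ℝ => holdProfile (A + t * v.1) (B + t * v.2.1) (S + t * v.2.2) σ)
      d 0 := by
    unfold holdProfile
    have a1 := (((hasDerivAt_id (0 : ℝ)).mul_const v.1).const_add A).mul_const (Real.exp (-σ))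
    have a2 := (((hasDerivAt_id (0 : ℝ)).mul_const v.2.1).const_add B)
    have a3 := ((((hasDerivAt_id (0 : ℝ)).mul_const v.2.2).const_add S).const_sub σ).exp
    refine (a1.add (a2.mul a3)).congr_deriv ?_
    simp [hd]; ring
  have e2 : HasDerivAt (fun t : ℝ => holdIntegrand (((A, B, S), σ) + t • (v, (0 : ℝ))))
      (1 / ((1 - s ^ 2) * √(1 - s ^ 2)) * s * d) 0 := by
    have e3 := (e1.pow 2).const_sub 1
    have e4 : HasDerivAt invSqrt (-(1 / (2 * ((1 - s ^ 2) * √(1 - s ^ 2)))))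
        (1 - holdProfile (A + 0 * v.1) (B + 0 * v.2.1) (S + 0 * v.2.2) σ ^ 2) := by
      simp only [zero_mul, add_zero, ← hs]
      exact hasDerivAt_invSqrt (by linarith)
    have e5 := HasDerivAt.comp (h₂ := invSqrt) (0 : ℝ) e4 e3
    refine HasDerivAt.congr_deriv (f := fun t : ℝ => holdIntegrand (((A, B, S), σ) + t • (v, (0 : ℝ))))
      ?_ ?_ (f' := -(1 / (2 * ((1 - s ^ 2) * √(1 - s ^ 2)))) * -(2 * s * d))
    · refine (e5.congr_deriv ?_).congr_of_eventuallyEq (Eventually.of_forall fun t => ?_)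
      · simp [← hs]
      · simp [holdIntegrand]
    · field_simp
  rw [fderiv_apply_eq_of_hasDerivAt
    (contDiff_holdIntegrand.differentiable (by simp)).differentiableAt e2]
  have h6 : 1 / ((1 - s ^ 2) * √(1 - s ^ 2)) ≤ 125 / 100 := by
    rw [div_le_iff₀ (by positivity)]; nlinarith
  have h7 : |d| ≤ |v.1| * Real.exp (-σ) + (|v.2.1| + |v.2.2|) * Real.exp (σ - S) := by
    have p1 := Real.exp_pos (-σ)
    have p2 := Real.exp_pos (σ - S)
    refine (abs_add_le _ _).trans ?_
    rw [abs_mul, abs_mul, abs_of_pos p1, abs_of_pos p2]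
    gcongr
    refine (abs_sub _ _).trans ?_
    rw [abs_mul]
    nlinarith [abs_nonneg v.2.2]
  have h8 : (0 : ℝ) < 1 / ((1 - s ^ 2) * √(1 - s ^ 2)) := by positivity
  rw [abs_mul, abs_mul, abs_of_pos h8]
  have h9 : 1 / ((1 - s ^ 2) * √(1 - s ^ 2)) * |s| ≤ 1 / 2 := by nlinarith [abs_nonneg s]
  calc _ ≤ 1 / 2 * |d| := by gcongr
    _ ≤ 1 / 2 * (|v.1| * Real.exp (-σ) + (|v.2.1| + |v.2.2|) * Real.exp (σ - S)) := by gcongr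
    _ = _ := by ring

/-- Up to a small part, the derivative of the duration is the boundary term of the integral at `S`:
the integrand depends on `A`, `B`, `S` only through terms that decay exponentially away from the two
ends of the interval. -/
lemma abs_fderiv_holdTime_sub_le {A B S : ℝ} (hS0 : 0 ≤ S) (hA : |A| ≤ 27 / 100)
    (hB : |B| ≤ 27 / 100) (hS : Real.exp (-S) ≤ 1 / 1000) (v : ℝ × ℝ × ℝ) :
    |fderiv ℝ (fun p : ℝ × ℝ × ℝ => holdTime p.1 p.2.1 p.2.2) (A, B, S) v -
      invSqrt (1 - holdProfile A B S S ^ 2) * v.2.2| ≤ 1 / 2 * (|v.1| + |v.2.1| + |v.2.2|) := by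
  have hs : ∀ σ ∈ Icc 0 S, |holdProfile A B S σ| ≤ 7 / 25 := fun σ h => abs_holdProfile_le hA hB hS h
  set J : (ℝ × ℝ × ℝ) × ℝ × ℝ → ℝ := fun q => ∫ σ in q.2.1..q.2.2, holdIntegrand (q.1, σ) with hJ
  set M : ℝ × ℝ × ℝ →L[ℝ] (ℝ × ℝ × ℝ) × ℝ × ℝ := (ContinuousLinearMap.id ℝ (ℝ × ℝ × ℝ)).prod
    ((0 : ℝ × ℝ × ℝ →L[ℝ] ℝ).prod
      ((ContinuousLinearMap.snd ℝ ℝ ℝ) ∘L (ContinuousLinearMap.snd ℝ ℝ (ℝ × ℝ))))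
  have h1 : HasFDerivAt (fun p : ℝ × ℝ × ℝ => holdTime p.1 p.2.1 p.2.2)
      ((fderiv ℝ J ((A, B, S), 0, S)) ∘L M) (A, B, S) :=
    (((contDiff_integral_endpoints contDiff_holdIntegrand).differentiable
      (by simp)).differentiableAt.hasFDerivAt).comp (f := M) (A, B, S) M.hasFDerivAt
  have h2 : fderiv ℝ (fun p : ℝ × ℝ × ℝ => holdTime p.1 p.2.1 p.2.2) (A, B, S) v =
      (∫ σ in (0 : ℝ)..S, fderiv ℝ holdIntegrand ((A, B, S), σ) (v, 0)) +
        holdIntegrand ((A, B, S), S) * v.2.2 - holdIntegrand ((A, B, S), 0) * 0 := by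
    rw [h1.fderiv]
    exact fderiv_integral_endpoints contDiff_holdIntegrand (A, B, S) v 0 S 0 v.2.2
  rw [h2]
  have h3 : |∫ σ in (0 : ℝ)..S, fderiv ℝ holdIntegrand ((A, B, S), σ) (v, 0)| ≤
      ∫ σ in (0 : ℝ)..S,
        (1 / 2 * |v.1| * Real.exp (-σ) + 1 / 2 * (|v.2.1| + |v.2.2|) * Real.exp (σ - S)) := by
    rw [← Real.norm_eq_abs]
    refine intervalIntegral.norm_integral_le_of_norm_le hS0 (Eventually.of_forall fun σ hσ => ?_)
      (Continuous.intervalIntegrable (by fun_prop) _ _)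
    exact abs_fderiv_holdIntegrand_le hB (hs σ (Ioc_subset_Icc_self hσ)) v
  have h4 : ∫ σ in (0 : ℝ)..S,
      (1 / 2 * |v.1| * Real.exp (-σ) + 1 / 2 * (|v.2.1| + |v.2.2|) * Real.exp (σ - S)) =
      (1 - Real.exp (-S)) * (1 / 2 * (|v.1| + |v.2.1| + |v.2.2|)) := by
    have e : ∀ σ ∈ uIcc 0 S, HasDerivAt (fun σ => -(1 / 2 * |v.1| * Real.exp (-σ)) +
        1 / 2 * (|v.2.1| + |v.2.2|) * Real.exp (σ - S))
        (1 / 2 * |v.1| * Real.exp (-σ) + 1 / 2 * (|v.2.1| + |v.2.2|) * Real.exp (σ - S)) σ := by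
      intro σ _
      have a1 := ((hasDerivAt_id σ).neg.exp.const_mul (1 / 2 * |v.1|)).neg.add
        (((hasDerivAt_id σ).sub_const S).exp.const_mul (1 / 2 * (|v.2.1| + |v.2.2|)))
      refine a1.congr_deriv ?_
      simp
    rw [intervalIntegral.integral_eq_sub_of_hasDerivAt e
      (Continuous.intervalIntegrable (by fun_prop) _ _)]
    simp
    ring
  have h5 := Real.exp_pos (-S)
  have h6 : 0 ≤ 1 / 2 * (|v.1| + |v.2.1| + |v.2.2|) := by positivity
  have h7 : (∫ σ in (0 : ℝ)..S, fderiv ℝ holdIntegrand ((A, B, S), σ) (v, 0)) +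
      holdIntegrand ((A, B, S), S) * v.2.2 - holdIntegrand ((A, B, S), 0) * 0 -
      invSqrt (1 - holdProfile A B S S ^ 2) * v.2.2 =
      ∫ σ in (0 : ℝ)..S, fderiv ℝ holdIntegrand ((A, B, S), σ) (v, 0) := by
    simp [holdIntegrand]
  rw [h7]
  refine h3.trans (h4.trans_le ?_)
  nlinarith

/-! ### Reaching the neighbourhood of the upright position -/

/-- A family of motions, parametrized by the initial displacement `a` from `α` and the energy `h`,
which reach in time `τ (a, h)` the position `π + 2 arcsin (g a)` with velocity `w`; the initial
velocity is `V (a, h, w)`. (The energy is a function of `a` and `w`, but it is convenient to treat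
it as an independent parameter.) -/
structure IsApproach (α : ℝ) (g : ℝ → ℝ) (τ : ℝ × ℝ → ℝ) (V : ℝ × ℝ × ℝ → ℝ) : Prop where
  contDiff_profile : ContDiff ℝ ∞ g
  contDiff_time : ContDiff ℝ ∞ τ
  contDiff_velocity : ContDiff ℝ ∞ V
  abs_profile_le : ∀ a, |a| < windowRadius → |g a| ≤ 1 / 4
  abs_deriv_profile_le : ∀ a, |deriv g a| ≤ 1 / 2
  time_bounds : ∀ a h, |a| < windowRadius → |h| < 1 / 16 → 0 ≤ τ (a, h) ∧ τ (a, h) ≤ 12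
  abs_fderiv_time_le : ∀ a h, |a| < windowRadius → |h| < 1 / 16 → ∀ u : ℝ × ℝ,
    |fderiv ℝ τ (a, h) u| ≤ |u.1| + 100 * |u.2|
  abs_fderiv_velocity_le : ∀ a h w, |a| < windowRadius → |h| < 1 / 16 → ∀ u : ℝ × ℝ × ℝ,
    |fderiv ℝ V (a, h, w) u| ≤ |u.1| + |u.2.1| + |u.2.2|
  abs_velocity_le : ∀ a h w, |a| < windowRadius → |h| < 1 / 16 → |w| ≤ 3 → |V (a, h, w)| ≤ 3
  flow : ∀ a h w, |a| < windowRadius → |h| < 1 / 16 → w ^ 2 / 2 - 2 * g a ^ 2 = h →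
    (g a = -(1 / 4) → 0 ≤ w) →
    pendFlow (τ (a, h)) (α + a, V (a, h, w)) = (Real.pi + 2 * Real.arcsin (g a), w) ∧
    pendEnergy (α + a) (V (a, h, w)) = h ∧
    ∀ t ∈ Icc 1 (τ (a, h)), Real.cos (pendFlow t (α + a, V (a, h, w))).1 < 999 / 1000

/-- A pendulum that starts near the upright position is already there. -/
lemma isApproach_upright :
    IsApproach Real.pi (fun a => Real.sin (a / 2)) (fun _ => 0) (fun p => p.2.2) where
  contDiff_profile := by fun_prop
  contDiff_time := by fun_prop
  contDiff_velocity := by fun_prop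
  abs_profile_le := fun a ha => by
    refine Real.abs_sin_le_abs.trans ?_
    rw [abs_div, abs_two]
    unfold windowRadius at ha
    linarith
  abs_deriv_profile_le := fun a => by
    have h : HasDerivAt (fun a : ℝ => Real.sin (a / 2)) (Real.cos (a / 2) * (1 / 2)) a :=
      ((hasDerivAt_id a).div_const 2).sin
    rw [h.deriv, abs_mul, abs_of_pos (by norm_num : (0 : ℝ) < 1 / 2)]
    linarith [Real.abs_cos_le_one (a / 2)]
  time_bounds := fun a h _ _ => by norm_num
  abs_fderiv_time_le := fun a h _ _ u => by
    simp only [fderiv_fun_const, Pi.zero_apply, zero_apply, abs_zero]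
    positivity
  abs_fderiv_velocity_le := fun a h w _ _ u => by
    have : fderiv ℝ (fun p : ℝ × ℝ × ℝ => p.2.2) (a, h, w) =
        (ContinuousLinearMap.snd ℝ ℝ ℝ) ∘L (ContinuousLinearMap.snd ℝ ℝ (ℝ × ℝ)) :=
      ((ContinuousLinearMap.snd ℝ ℝ ℝ) ∘L (ContinuousLinearMap.snd ℝ ℝ (ℝ × ℝ))).fderiv
    rw [this]
    simp only [ContinuousLinearMap.comp_apply, ContinuousLinearMap.coe_snd']
    linarith [abs_nonneg u.1, abs_nonneg u.2.1]
  abs_velocity_le := fun a h w _ _ hw => hw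
  flow := fun a h w ha _ hE _ => by
    unfold windowRadius at ha
    have ha' := abs_lt.1 ha
    refine ⟨?_, ?_, ?_⟩
    · rw [isFlow_pendFlow.zero, Real.arcsin_sin (by linarith [Real.pi_gt_three])
        (by linarith [Real.pi_gt_three])]
      congr 1
      ring
    · rw [← hE, pendEnergy, add_comm, Real.cos_add_pi]
      have h1 := Real.cos_sq_add_sin_sq (a / 2)
      have h2 := Real.cos_sq (a / 2)
      rw [mul_div_cancel₀ _ two_ne_zero] at h2
      linarith
    · intro t ht
      exact absurd (ht.1.trans ht.2) (by norm_num)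

/-- A point on the way from the bottom to the upright position. -/
def midwayPoint : ℝ := Real.pi + 2 * Real.arcsin (-(1 / 4))

lemma cos_midwayPoint : Real.cos midwayPoint = -(7 / 8) := by
  rw [midwayPoint, add_comm, Real.cos_add_pi, Real.cos_two_mul, Real.cos_arcsin,
    Real.sq_sqrt (by norm_num)]
  norm_num

lemma midwayPoint_le : midwayPoint ≤ Real.pi := by
  have : Real.arcsin (-(1 / 4)) ≤ 0 := Real.arcsin_nonpos.2 (by norm_num)
  unfold midwayPoint
  linarith

lemma le_midwayPoint : 3 / 2 ≤ midwayPoint := by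
  by_contra! h
  have h0 : 0 ≤ midwayPoint := by
    unfold midwayPoint
    linarith [Real.neg_pi_div_two_le_arcsin (-(1 / 4))]
  have := Real.cos_nonneg_of_mem_Icc (x := midwayPoint)
    ⟨by linarith [Real.pi_gt_three], by linarith [Real.pi_gt_three]⟩
  rw [cos_midwayPoint] at this
  norm_num at this

lemma neg_le_cos_of_mem {x : ℝ} (h0 : -(1 / 10) ≤ x) (h1 : x ≤ midwayPoint) :
    -(7 / 8) ≤ Real.cos x := by
  have hm := midwayPoint_le
  rcases le_or_gt 0 x with h | h
  · rw [← cos_midwayPoint]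
    exact Real.cos_le_cos_of_nonneg_of_le_pi h hm h1
  · have := Real.cos_nonneg_of_mem_Icc (x := x)
      ⟨by linarith [Real.pi_gt_three], by linarith [Real.pi_gt_three]⟩
    linarith

/-- The integrand of `climbTime`: the inverse of `speed`. -/
def climbIntegrand (q : ℝ × ℝ) : ℝ := invSqrt (2 * (q.1 + 1 + Real.cos q.2))

/-- The time that it takes to get from `a` to `midwayPoint` with energy `h`. -/
def climbTime (q : ℝ × ℝ) : ℝ := ∫ x in q.1..midwayPoint, climbIntegrand (q.2, x)

/-- The velocity at `a` of the motion with energy `h`: a smooth extension of `speed`. -/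
def climbVelocity (q : ℝ × ℝ × ℝ) : ℝ :=
  2 * (q.2.1 + 1 + Real.cos q.1) * invSqrt (2 * (q.2.1 + 1 + Real.cos q.1))

lemma contDiff_climbIntegrand : ContDiff ℝ ∞ climbIntegrand :=
  contDiff_invSqrt.comp (by fun_prop)

lemma contDiff_climbTime : ContDiff ℝ ∞ climbTime :=
  (contDiff_integral_endpoints contDiff_climbIntegrand).comp
    (f := fun q : ℝ × ℝ => (q.2, q.1, midwayPoint)) (by fun_prop)

lemma contDiff_climbVelocity : ContDiff ℝ ∞ climbVelocity := by
  have : ContDiff ℝ ∞ fun q : ℝ × ℝ × ℝ => invSqrt (2 * (q.2.1 + 1 + Real.cos q.1)) :=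
    contDiff_invSqrt.comp (by fun_prop)
  unfold climbVelocity
  fun_prop

lemma climbVelocity_eq {a h w : ℝ} (H : 1 / 10 ≤ 2 * (h + 1 + Real.cos a)) :
    climbVelocity (a, h, w) = speed h a := by
  simp only [climbVelocity]
  rw [invSqrt_eq H, speed, mul_one_div, Real.div_sqrt]

lemma climbIntegrand_eq {h x : ℝ} (H : 1 / 10 ≤ 2 * (h + 1 + Real.cos x)) :
    climbIntegrand (h, x) = 1 / speed h x := by
  simp only [climbIntegrand]
  rw [invSqrt_eq H, speed]

lemma abs_fderiv_climbIntegrand_le {h x : ℝ} (H : 1 / 8 ≤ 2 * (h + 1 + Real.cos x)) (u : ℝ) :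
    |fderiv ℝ climbIntegrand (h, x) (u, 0)| ≤ 24 * |u| := by
  set X := 2 * (h + 1 + Real.cos x) with hX
  have h5 : 1 / 3 ≤ √X := Real.le_sqrt_of_sq_le (by linarith)
  have e1 : HasDerivAt (fun t : ℝ => 2 * (h + t * u + 1 + Real.cos x)) (2 * u) 0 := by
    have := ((((((hasDerivAt_id (0 : ℝ)).mul_const u).const_add h).add_const 1).add_const
      (Real.cos x)).const_mul 2)
    simpa using this
  have e4 : HasDerivAt invSqrt (-(1 / (2 * (X * √X)))) (2 * (h + 0 * u + 1 + Real.cos x)) := by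
    rw [zero_mul, add_zero]
    exact hasDerivAt_invSqrt (by linarith)
  have e2 : HasDerivAt (fun t : ℝ => climbIntegrand ((h, x) + t • (u, (0 : ℝ))))
      (-(1 / (2 * (X * √X))) * (2 * u)) 0 := by
    refine (HasDerivAt.comp (h₂ := invSqrt) (0 : ℝ) e4 e1).congr_of_eventuallyEq
      (Eventually.of_forall fun t => ?_)
    simp [climbIntegrand]
  rw [fderiv_apply_eq_of_hasDerivAt
    (contDiff_climbIntegrand.differentiable (by simp)).differentiableAt e2]
  have h8 : (0 : ℝ) < 2 * (X * √X) := by positivity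
  have h6 : 1 / (2 * (X * √X)) ≤ 12 := by
    rw [div_le_iff₀ h8]; nlinarith
  rw [abs_mul, abs_neg, abs_of_pos (by positivity), abs_mul, abs_two]
  nlinarith [abs_nonneg u]

lemma fderiv_climbTime (a h : ℝ) (u : ℝ × ℝ) :
    fderiv ℝ climbTime (a, h) u =
      (∫ x in a..midwayPoint, fderiv ℝ climbIntegrand (h, x) (u.2, 0)) -
        climbIntegrand (h, a) * u.1 := by
  set J : ℝ × ℝ × ℝ → ℝ := fun q => ∫ x in q.2.1..q.2.2, climbIntegrand (q.1, x) with hJ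
  set M : ℝ × ℝ →L[ℝ] ℝ × ℝ × ℝ := (ContinuousLinearMap.snd ℝ ℝ ℝ).prod
    ((ContinuousLinearMap.fst ℝ ℝ ℝ).prod (0 : ℝ × ℝ →L[ℝ] ℝ)) with hM
  have h0 : HasFDerivAt (fun q : ℝ × ℝ => ((q.2, q.1, midwayPoint) : ℝ × ℝ × ℝ)) M (a, h) :=
    hasFDerivAt_snd.prodMk (hasFDerivAt_fst.prodMk (hasFDerivAt_const _ _))
  have h1 : HasFDerivAt climbTime ((fderiv ℝ J (h, a, midwayPoint)) ∘L M) (a, h) :=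
    HasFDerivAt.comp (g := J) (a, h)
      (((contDiff_integral_endpoints contDiff_climbIntegrand).differentiable
      (by simp)).differentiableAt.hasFDerivAt) h0
  rw [h1.fderiv]
  have := fderiv_integral_endpoints contDiff_climbIntegrand h u.2 a midwayPoint u.1 0
  rw [mul_zero, add_zero] at this
  exact this

/-- A pendulum that starts near the bottom with energy close to that of the upright position climbs
to `midwayPoint`. -/
lemma isApproach_bottom :
    IsApproach 0 (fun _ => -(1 / 4)) climbTime climbVelocity := by
  have hcos : ∀ a, |a| < windowRadius → ∀ x ∈ Icc a midwayPoint, -(7 / 8) ≤ Real.cos x :=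
    fun a ha x hx => by
      have := abs_lt.1 ha
      unfold windowRadius at this
      exact neg_le_cos_of_mem (by linarith [hx.1]) hx.2
  have ham : ∀ a, |a| < windowRadius → a ≤ midwayPoint ∧ midwayPoint - a ≤ 33 / 10 := fun a ha => by
    have h1 := abs_lt.1 ha
    unfold windowRadius at h1
    have h2 := le_midwayPoint
    have h3 := midwayPoint_le
    have := Real.pi_lt_d2
    constructor <;> linarith
  have hX : ∀ a h, |a| < windowRadius → |h| < 1 / 16 → ∀ x ∈ Icc a midwayPoint,
      1 / 8 ≤ 2 * (h + 1 + Real.cos x) := fun a h ha hh x hx => by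
    have := hcos a ha x hx
    have := abs_lt.1 hh
    linarith
  have hτ : ∀ a h, |a| < windowRadius → |h| < 1 / 16 →
      climbTime (a, h) = ∫ x in a..midwayPoint, 1 / speed h x := fun a h ha hh => by
    refine intervalIntegral.integral_congr fun x hx => ?_
    rw [uIcc_of_le (ham a ha).1] at hx
    exact climbIntegrand_eq (by linarith [hX a h ha hh x hx])
  have hsp : ∀ a h, |a| < windowRadius → |h| < 1 / 16 → ∀ x, |x| ≤ 1 / 2 → 1 ≤ speed h x :=
    fun a h ha hh x hx => one_le_speed (by linarith [(abs_lt.1 hh).1]) hx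
  have hmem : ∀ a, |a| < windowRadius → a ∈ Icc a midwayPoint := fun a ha =>
    left_mem_Icc.2 (ham a ha).1
  have hwin : ∀ a, |a| < windowRadius → |a| ≤ 1 / 2 := fun a ha => by
    unfold windowRadius at ha; linarith
  refine ⟨by fun_prop, contDiff_climbTime, contDiff_climbVelocity, ?_, ?_, ?_, ?_, ?_, ?_, ?_⟩
  · intro a _
    norm_num
  · intro a
    simp
  · intro a h ha hh
    have h0 : ∀ x ∈ Icc a midwayPoint, 0 ≤ climbIntegrand (h, x) ∧ climbIntegrand (h, x) ≤ 3 := by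
      intro x hx
      have h1 := hX a h ha hh x hx
      rw [climbIntegrand_eq (by linarith)]
      have h2 : 1 / 3 ≤ speed h x := Real.le_sqrt_of_sq_le (by linarith)
      refine ⟨by positivity, ?_⟩
      rw [div_le_iff₀ (by linarith)]; linarith
    refine ⟨intervalIntegral.integral_nonneg (ham a ha).1 fun x hx => (h0 x hx).1, ?_⟩
    have hi : IntervalIntegrable (fun x => climbIntegrand (h, x)) MeasureTheory.volume
        a midwayPoint := (contDiff_climbIntegrand.continuous.comp
          (f := fun x : ℝ => (h, x)) (by fun_prop)).intervalIntegrable _ _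
    have h1 := intervalIntegral.integral_mono_on (ham a ha).1 hi
      (intervalIntegrable_const (c := 3)) fun x hx => (h0 x hx).2
    rw [intervalIntegral.integral_const, smul_eq_mul] at h1
    refine h1.trans ?_
    linarith [(ham a ha).2]
  · intro a h ha hh u
    rw [fderiv_climbTime]
    have h1 : |∫ x in a..midwayPoint, fderiv ℝ climbIntegrand (h, x) (u.2, 0)| ≤ 100 * |u.2| := by
      rw [← Real.norm_eq_abs]
      have := intervalIntegral.norm_integral_le_of_norm_le_const (a := a) (b := midwayPoint)
        (C := 24 * |u.2|) (f := fun x => fderiv ℝ climbIntegrand (h, x) (u.2, 0)) fun x hx => by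
          rw [uIoc_of_le (ham a ha).1] at hx
          exact abs_fderiv_climbIntegrand_le (hX a h ha hh x (Ioc_subset_Icc_self hx)) _
      refine this.trans ?_
      rw [abs_of_nonneg (a := midwayPoint - a) (by linarith [(ham a ha).1])]
      nlinarith [abs_nonneg u.2, (ham a ha).2]
    have h2 : |climbIntegrand (h, a) * u.1| ≤ |u.1| := by
      have h3 := hsp a h ha hh a (hwin a ha)
      rw [climbIntegrand_eq (by linarith [hX a h ha hh a (hmem a ha)]), abs_mul,
        abs_of_pos (by positivity)]
      refine mul_le_of_le_one_left (abs_nonneg _) ?_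
      rw [div_le_one (by linarith)]; exact h3
    have := abs_sub (∫ x in a..midwayPoint, fderiv ℝ climbIntegrand (h, x) (u.2, 0))
      (climbIntegrand (h, a) * u.1)
    linarith
  · intro a h w ha hh u
    have h1 := hX a h ha hh a (hmem a ha)
    have h3 := hsp a h ha hh a (hwin a ha)
    set A : ℝ × ℝ × ℝ →L[ℝ] ℝ × ℝ := ((ContinuousLinearMap.fst ℝ ℝ ℝ) ∘L
      (ContinuousLinearMap.snd ℝ ℝ (ℝ × ℝ))).prod (ContinuousLinearMap.fst ℝ ℝ (ℝ × ℝ)) with hA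
    have e1 := HasFDerivAt.comp (f := A) (g := fun q : ℝ × ℝ => speed q.1 q.2) (a, h, w)
      (hasFDerivAt_speed (h := h) (x := a) (by linarith)) A.hasFDerivAt
    have e2 : climbVelocity =ᶠ[𝓝 (a, h, w)] (fun q : ℝ × ℝ => speed q.1 q.2) ∘ A := by
      have : ∀ᶠ q : ℝ × ℝ × ℝ in 𝓝 (a, h, w), 1 / 10 < 2 * (q.2.1 + 1 + Real.cos q.1) := by
        refine ContinuousAt.eventually_lt continuousAt_const (Continuous.continuousAt (by fun_prop))
          ?_
        linarith
      filter_upwards [this] with q hq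
      exact climbVelocity_eq hq.le
    rw [(e1.congr_of_eventuallyEq e2).fderiv]
    have e3 : |-Real.sin a / speed h a| ≤ 1 := by
      rw [abs_div, abs_neg, abs_of_pos (by linarith : 0 < speed h a), div_le_one (by linarith)]
      exact (Real.abs_sin_le_one a).trans h3
    have e4 : |1 / speed h a| ≤ 1 := by
      rw [abs_of_pos (by positivity), div_le_one (by linarith)]; exact h3
    simp only [ContinuousLinearMap.comp_apply, add_apply,
      smul_apply, hA, ContinuousLinearMap.prod_apply,
      ContinuousLinearMap.coe_fst', ContinuousLinearMap.coe_snd', smul_eq_mul]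
    refine (abs_add_le _ _).trans ?_
    rw [abs_mul, abs_mul]
    nlinarith [abs_nonneg u.1, abs_nonneg u.2.1, abs_nonneg u.2.2]
  · intro a h w ha hh _
    rw [climbVelocity_eq (by linarith [hX a h ha hh a (hmem a ha)]), speed,
      abs_of_nonneg (Real.sqrt_nonneg _)]
    exact Real.sqrt_le_iff.2 ⟨by norm_num, by linarith [(abs_lt.1 hh).2, Real.cos_le_one a]⟩
  · intro a h w ha hh hE hw
    have hw0 := hw rfl
    have hpos : ∀ x ∈ Icc a midwayPoint, 0 < h + 1 + Real.cos x := fun x hx => by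
      linarith [hX a h ha hh x hx]
    have hV := climbVelocity_eq (w := w) (a := a) (h := h) (by linarith [hX a h ha hh a (hmem a ha)])
    have hwE : speed h midwayPoint = w := by
      rw [speed, cos_midwayPoint, ← hE]
      rw [show 2 * (w ^ 2 / 2 - 2 * (-(1 / 4)) ^ 2 + 1 + -(7 / 8)) = w ^ 2 by ring]
      exact Real.sqrt_sq hw0
    obtain ⟨t1, t2⟩ := pendFlow_transit (ham a ha).1 hpos
    rw [zero_add, hV, hτ a h ha hh]
    refine ⟨?_, pendEnergy_speed (hpos a (hmem a ha)).le, ?_⟩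
    · rw [t1, hwE]; rfl
    · intro t ht
      obtain ⟨x, hx, hx1, hx2⟩ := t2 t ⟨by linarith [ht.1], ht.2⟩
      rw [hx1]
      have h1 := abs_lt.1 ha
      unfold windowRadius at h1
      refine cos_lt_of_mem_Icc ⟨?_, by linarith [hx.2, midwayPoint_le, Real.pi_gt_three]⟩
      by_contra! hlt
      have hi : IntervalIntegrable (fun y => 1 / speed h y) MeasureTheory.volume a x := by
        refine ContinuousOn.intervalIntegrable ?_
        rw [uIcc_of_le hx.1]
        exact continuousOn_inv_speed fun y hy => hpos y ⟨hy.1, hy.2.trans hx.2⟩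
      have h2 := intervalIntegral.integral_mono_on hx.1 hi
        (intervalIntegrable_const (c := 1)) fun y hy => by
          rw [div_le_one (speed_pos (hpos y ⟨hy.1, hy.2.trans hx.2⟩))]
          exact hsp a h ha hh y (abs_le.2 ⟨by linarith [hy.1], by linarith [hy.2]⟩)
      rw [hx2, intervalIntegral.integral_const, smul_eq_mul] at h2
      linarith [ht.1]

/-! ### Families of motions that linger at the upright position -/

/-- The coefficient `A` of the profile `A e^{-σ} + B e^{σ - S}` with values `φ` at `σ = 0` and
`ψ` at `σ = S`, where `S` is the third parameter. -/
def holdCoeff (φ ψ : ℝ × ℝ × ℝ → ℝ) (q : ℝ × ℝ × ℝ) : ℝ :=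
  (φ q - ψ q * Real.exp (-q.2.2)) / (1 - Real.exp (-q.2.2) ^ 2)

lemma exp_neg_le_of_twenty_lt {S : ℝ} (h : 20 < S) : Real.exp (-S) ≤ 1 / 100000 := by
  have h1 : (2 : ℝ) ≤ Real.exp 1 := by linarith [Real.add_one_le_exp (1 : ℝ)]
  have h2 : (2 : ℝ) ^ 20 ≤ Real.exp S := calc
    (2 : ℝ) ^ 20 ≤ Real.exp 1 ^ 20 := by gcongr
    _ = Real.exp (20 : ℕ) := by rw [← Real.exp_nat_mul]; simp
    _ ≤ Real.exp S := Real.exp_le_exp.2 (by push_cast; exact h.le)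
  rw [Real.exp_neg, inv_eq_one_div]
  exact one_div_le_one_div_of_le (by norm_num) (le_trans (by norm_num) h2)

/-- The two coefficients, of which the other is `holdCoeff ψ φ q`, solve the linear system that
prescribes the values `φ q` and `ψ q` of the profile at its two ends. -/
lemma holdCoeff_add {φ ψ : ℝ × ℝ × ℝ → ℝ} {q : ℝ × ℝ × ℝ} (hq : 20 < q.2.2) :
    holdCoeff φ ψ q + holdCoeff ψ φ q * Real.exp (-q.2.2) = φ q := by
  have hz := exp_neg_le_of_twenty_lt hq
  have hz0 := Real.exp_pos (-q.2.2)
  have : 1 - Real.exp (-q.2.2) ^ 2 ≠ 0 := by nlinarith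
  unfold holdCoeff
  field_simp
  ring

lemma abs_holdCoeff_le {φ ψ : ℝ × ℝ × ℝ → ℝ} {q : ℝ × ℝ × ℝ} (hq : 20 < q.2.2)
    (hφ : |φ q| ≤ 1 / 4) (hψ : |ψ q| ≤ 1 / 4) : |holdCoeff φ ψ q| ≤ 27 / 100 := by
  have hz := exp_neg_le_of_twenty_lt hq
  have hz0 := Real.exp_pos (-q.2.2)
  have hD : 0 < 1 - Real.exp (-q.2.2) ^ 2 := by nlinarith
  have h1 := abs_le.1 hφ
  have h2 := abs_le.1 hψ
  rw [holdCoeff, abs_div, abs_of_pos hD, div_le_iff₀ hD, abs_le]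
  constructor <;> nlinarith

lemma contDiffOn_holdCoeff {φ ψ : ℝ × ℝ × ℝ → ℝ} (hφ : ContDiff ℝ ∞ φ) (hψ : ContDiff ℝ ∞ ψ) :
    ContDiffOn ℝ ∞ (holdCoeff φ ψ) (windowDomain (Ioi 20)) := by
  have hz : ContDiff ℝ ∞ fun q : ℝ × ℝ × ℝ => Real.exp (-q.2.2) := by fun_prop
  refine ContDiffOn.div (hφ.sub (hψ.mul hz)).contDiffOn (contDiff_const.sub (hz.pow 2)).contDiffOn
    fun q hq => ?_
  have hz := exp_neg_le_of_twenty_lt hq.2.2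
  have hz0 := Real.exp_pos (-q.2.2)
  nlinarith

lemma hasDerivAt_exp_neg_line (q v : ℝ × ℝ × ℝ) :
    HasDerivAt (fun t : ℝ => Real.exp (-(q + t • v).2.2)) (-(Real.exp (-q.2.2) * v.2.2)) 0 := by
  have := (((hasDerivAt_id (0 : ℝ)).mul_const v.2.2).const_add q.2.2).neg.exp
  refine (this.congr_deriv ?_)
  simp

lemma differentiableAt_of_mem {f : ℝ × ℝ × ℝ → ℝ} (hf : ContDiffOn ℝ ∞ f (windowDomain (Ioi 20)))
    {q : ℝ × ℝ × ℝ} (hq : q ∈ windowDomain (Ioi 20)) : DifferentiableAt ℝ f q :=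
  (hf.contDiffAt ((isOpen_windowDomain isOpen_Ioi).mem_nhds hq)).differentiableAt (by simp)

lemma abs_fderiv_holdCoeff_le {φ ψ : ℝ × ℝ × ℝ → ℝ} (hφ : ContDiff ℝ ∞ φ) (hψ : ContDiff ℝ ∞ ψ)
    {q : ℝ × ℝ × ℝ} (hq : q ∈ windowDomain (Ioi 20)) (h1 : |φ q| ≤ 1 / 4) (h2 : |ψ q| ≤ 1 / 4)
    (v : ℝ × ℝ × ℝ) (h1' : |fderiv ℝ φ q v| ≤ 1 / 2 * (|v.1| + |v.2.1|))
    (h2' : |fderiv ℝ ψ q v| ≤ 1 / 2 * (|v.1| + |v.2.1|)) :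
    |fderiv ℝ (holdCoeff φ ψ) q v| ≤ |v.1| + |v.2.1| + Real.exp (-q.2.2) * |v.2.2| := by
  have hz := exp_neg_le_of_twenty_lt hq.2.2
  have hz0 := Real.exp_pos (-q.2.2)
  have e1 : HasDerivAt (fun t : ℝ => φ (q + t • v)) (fderiv ℝ φ q v) 0 :=
    (hφ.differentiable (by simp)).differentiableAt.hasFDerivAt.hasLineDerivAt v
  have e2 : HasDerivAt (fun t : ℝ => ψ (q + t • v)) (fderiv ℝ ψ q v) 0 :=
    (hψ.differentiable (by simp)).differentiableAt.hasFDerivAt.hasLineDerivAt v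
  have e3 := hasDerivAt_exp_neg_line q v
  have e0 : q + (0 : ℝ) • v = q := by simp
  have e4 := (e1.sub (e2.mul e3)).div ((e3.pow 2).const_sub 1) (by
    simp only [Pi.pow_apply, e0]; nlinarith)
  have e5 : HasDerivAt (fun t : ℝ => holdCoeff φ ψ (q + t • v)) _ 0 := e4
  rw [fderiv_apply_eq_of_hasDerivAt (differentiableAt_of_mem (contDiffOn_holdCoeff hφ hψ) hq) e5]
  clear e5 e4
  simp only [Pi.sub_apply, Pi.mul_apply, Pi.pow_apply, e0]
  generalize Real.exp (-q.2.2) = z at *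
  generalize fderiv ℝ φ q v = φ' at *
  generalize fderiv ℝ ψ q v = ψ' at *
  generalize φ q = x at *
  generalize ψ q = y at *
  set n := |v.1| + |v.2.1| with hn
  have hn0 : 0 ≤ n := by positivity
  have hm0 := abs_nonneg v.2.2
  have hD : 99 / 100 ≤ (1 - z ^ 2) ^ 2 := by nlinarith
  have hD1 : |1 - z ^ 2| ≤ 1 := abs_le.2 ⟨by nlinarith, by nlinarith⟩
  rw [abs_div, abs_of_pos (by linarith : (0 : ℝ) < (1 - z ^ 2) ^ 2), div_le_iff₀ (by linarith)]
  have k1 : |φ' - (ψ' * z + y * -(z * v.2.2))| ≤ 1 / 2 * n + 1 / 2 * n * z + 1 / 4 * (z * |v.2.2|) := by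
    refine (abs_sub _ _).trans ?_
    have := abs_add_le (ψ' * z) (y * -(z * v.2.2))
    rw [abs_mul, abs_mul y, abs_neg, abs_mul, abs_of_pos hz0] at this
    have a1 : |ψ'| * z ≤ 1 / 2 * n * z := by gcongr
    have a2 : |y| * (z * |v.2.2|) ≤ 1 / 4 * (z * |v.2.2|) := by gcongr
    linarith
  have k2 : |x - y * z| ≤ 1 := by
    have b1 := abs_le.1 h1
    have b2 := abs_le.1 h2
    exact abs_le.2 ⟨by nlinarith, by nlinarith⟩
  refine (abs_sub _ _).trans ?_
  rw [abs_mul, abs_mul (x - y * z)]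
  have k3 : |φ' - (ψ' * z + y * -(z * v.2.2))| * |1 - z ^ 2| ≤
      (1 / 2 * n + 1 / 2 * n * z + 1 / 4 * (z * |v.2.2|)) * 1 := by gcongr
  have k4 : |x - y * z| * |-(((2 : ℕ) : ℝ) * z ^ (2 - 1) * -(z * v.2.2))| ≤
      1 * (2 * z * (z * |v.2.2|)) := by
    have e : -(((2 : ℕ) : ℝ) * z ^ (2 - 1) * -(z * v.2.2)) = 2 * z * (z * v.2.2) := by
      push_cast; ring
    rw [e, abs_mul (2 * z), abs_mul z, abs_mul 2, abs_two, abs_of_pos hz0]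
    gcongr
  have hzm : 0 ≤ z * |v.2.2| := by positivity
  have k5 : 2 * z * (z * |v.2.2|) ≤ 1 / 100 * (z * |v.2.2|) := by gcongr; linarith
  have k6 : 1 / 2 * n * z ≤ 1 / 100 * n := by nlinarith
  have k7 : 99 / 100 * (n + z * |v.2.2|) ≤ (n + z * |v.2.2|) * (1 - z ^ 2) ^ 2 := by nlinarith
  linarith

/-- The energy of the motion with profile `A e^{-σ} + B e^{σ - S}`. -/
def holdEnergy (A B : ℝ × ℝ × ℝ → ℝ) (q : ℝ × ℝ × ℝ) : ℝ := -8 * (A q * B q * Real.exp (-q.2.2))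

/-- The initial velocity of the motion with profile `A e^{-σ} + B e^{σ - S}`. -/
def holdVelocity (A B : ℝ × ℝ × ℝ → ℝ) (q : ℝ × ℝ × ℝ) : ℝ :=
  2 * (-A q + B q * Real.exp (-q.2.2))

/-- Bounds for a coefficient of the profile and its derivative at `q`. -/
structure IsCoeffAt (A : ℝ × ℝ × ℝ → ℝ) (q : ℝ × ℝ × ℝ) : Prop where
  differentiableAt : DifferentiableAt ℝ A q
  abs_le : |A q| ≤ 27 / 100
  abs_fderiv_le : ∀ v : ℝ × ℝ × ℝ,
    |fderiv ℝ A q v| ≤ |v.1| + |v.2.1| + Real.exp (-q.2.2) * |v.2.2|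

section Coeff

variable {A B : ℝ × ℝ × ℝ → ℝ} {q : ℝ × ℝ × ℝ}

lemma abs_holdEnergy_le (hA : IsCoeffAt A q) (hB : IsCoeffAt B q) :
    |holdEnergy A B q| ≤ Real.exp (-q.2.2) := by
  have hz0 := Real.exp_pos (-q.2.2)
  have h1 : |A q| * |B q| ≤ 27 / 100 * (27 / 100) :=
    mul_le_mul hA.abs_le hB.abs_le (abs_nonneg _) (by norm_num)
  rw [holdEnergy, abs_mul, abs_mul, abs_mul, abs_of_pos hz0]
  norm_num
  nlinarith

lemma abs_holdVelocity_le (hq : 20 < q.2.2) (hA : IsCoeffAt A q) (hB : IsCoeffAt B q) :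
    |holdVelocity A B q| ≤ 3 := by
  have hz := exp_neg_le_of_twenty_lt hq
  have hz0 := Real.exp_pos (-q.2.2)
  have h1 := _root_.abs_le.1 hA.abs_le
  have h2 := _root_.abs_le.1 hB.abs_le
  rw [holdVelocity, _root_.abs_le]
  constructor <;> nlinarith

lemma abs_fderiv_holdEnergy_le (hq : 20 < q.2.2) (hA : IsCoeffAt A q) (hB : IsCoeffAt B q)
    (v : ℝ × ℝ × ℝ) : |fderiv ℝ (holdEnergy A B) q v| ≤
      5 * Real.exp (-q.2.2) * (|v.1| + |v.2.1| + |v.2.2|) := by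
  have hz := exp_neg_le_of_twenty_lt hq
  have hz0 := Real.exp_pos (-q.2.2)
  have e1 : HasDerivAt (fun t : ℝ => A (q + t • v)) (fderiv ℝ A q v) 0 :=
    hA.differentiableAt.hasFDerivAt.hasLineDerivAt v
  have e2 : HasDerivAt (fun t : ℝ => B (q + t • v)) (fderiv ℝ B q v) 0 :=
    hB.differentiableAt.hasFDerivAt.hasLineDerivAt v
  have e3 := hasDerivAt_exp_neg_line q v
  have e0 : q + (0 : ℝ) • v = q := by simp
  have e4 := ((e1.mul e2).mul e3).const_mul (-8)
  have e5 : HasDerivAt (fun t : ℝ => holdEnergy A B (q + t • v)) _ 0 := e4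
  have hd : DifferentiableAt ℝ (holdEnergy A B) q := by
    have : DifferentiableAt ℝ (fun q : ℝ × ℝ × ℝ => Real.exp (-q.2.2)) q := by fun_prop
    exact ((hA.differentiableAt.mul hB.differentiableAt).mul this).const_mul _
  rw [fderiv_apply_eq_of_hasDerivAt hd e5]
  clear e5 e4
  simp only [Pi.mul_apply, e0]
  have a1 := hA.abs_fderiv_le v
  have a2 := hB.abs_fderiv_le v
  have a3 := hA.abs_le
  have a4 := hB.abs_le
  generalize Real.exp (-q.2.2) = z at *
  generalize fderiv ℝ A q v = A' at *
  generalize fderiv ℝ B q v = B' at *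
  generalize A q = x at *
  generalize B q = y at *
  have hm0 := abs_nonneg v.2.2
  have hn0 : 0 ≤ |v.1| + |v.2.1| := by positivity
  generalize |v.1| + |v.2.1| = n at *
  have k1 : |A' * y| ≤ (n + z * |v.2.2|) * (27 / 100) := by rw [abs_mul]; gcongr
  have k2 : |x * B'| ≤ (27 / 100) * (n + z * |v.2.2|) := by rw [abs_mul]; gcongr
  have k3 : |x * y| ≤ 27 / 100 * (27 / 100) := by rw [abs_mul]; gcongr
  have k4 : |(A' * y + x * B') * z + x * y * -(z * v.2.2)| ≤
      (54 / 100) * (n + z * |v.2.2|) * z + 27 / 100 * (27 / 100) * (z * |v.2.2|) := by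
    refine (abs_add_le _ _).trans ?_
    rw [abs_mul, abs_mul (x * y), abs_neg, abs_mul z, abs_of_pos hz0]
    have := abs_add_le (A' * y) (x * B')
    gcongr
    linarith
  rw [abs_mul, abs_neg, abs_of_pos (by norm_num : (0 : ℝ) < 8)]
  have k5 : 0 ≤ z * |v.2.2| := by positivity
  have k6 : 0 ≤ z * n := by positivity
  have k7 : z * |v.2.2| * z ≤ 1 / 100 * (z * |v.2.2|) := by nlinarith
  linarith

lemma abs_fderiv_holdVelocity_le (hq : 20 < q.2.2) (hA : IsCoeffAt A q) (hB : IsCoeffAt B q)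
    (v : ℝ × ℝ × ℝ) : |fderiv ℝ (holdVelocity A B) q v| ≤
      3 * (|v.1| + |v.2.1| + Real.exp (-q.2.2) * |v.2.2|) := by
  have hz := exp_neg_le_of_twenty_lt hq
  have hz0 := Real.exp_pos (-q.2.2)
  have e1 : HasDerivAt (fun t : ℝ => A (q + t • v)) (fderiv ℝ A q v) 0 :=
    hA.differentiableAt.hasFDerivAt.hasLineDerivAt v
  have e2 : HasDerivAt (fun t : ℝ => B (q + t • v)) (fderiv ℝ B q v) 0 :=
    hB.differentiableAt.hasFDerivAt.hasLineDerivAt v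
  have e3 := hasDerivAt_exp_neg_line q v
  have e0 : q + (0 : ℝ) • v = q := by simp
  have e4 := ((e1.neg).add (e2.mul e3)).const_mul 2
  have e5 : HasDerivAt (fun t : ℝ => holdVelocity A B (q + t • v)) _ 0 := e4
  have hd : DifferentiableAt ℝ (holdVelocity A B) q := by
    have : DifferentiableAt ℝ (fun q : ℝ × ℝ × ℝ => Real.exp (-q.2.2)) q := by fun_prop
    exact ((hA.differentiableAt.neg).add (hB.differentiableAt.mul this)).const_mul _
  rw [fderiv_apply_eq_of_hasDerivAt hd e5]
  clear e5 e4
  simp only [e0]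
  have a1 := hA.abs_fderiv_le v
  have a2 := hB.abs_fderiv_le v
  have a4 := hB.abs_le
  generalize Real.exp (-q.2.2) = z at *
  generalize fderiv ℝ A q v = A' at *
  generalize fderiv ℝ B q v = B' at *
  generalize B q = y at *
  have hm0 := abs_nonneg v.2.2
  have hn0 : 0 ≤ |v.1| + |v.2.1| := by positivity
  generalize |v.1| + |v.2.1| = n at *
  have k4 : |-A' + (B' * z + y * -(z * v.2.2))| ≤
      (n + z * |v.2.2|) + ((n + z * |v.2.2|) * z + 27 / 100 * (z * |v.2.2|)) := by
    refine (abs_add_le _ _).trans ?_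
    rw [abs_neg]
    have h := abs_add_le (B' * z) (y * -(z * v.2.2))
    rw [abs_mul, abs_mul y, abs_neg, abs_mul z, abs_of_pos hz0] at h
    have h1 : |B'| * z ≤ (n + z * |v.2.2|) * z := by gcongr
    have h2 : |y| * (z * |v.2.2|) ≤ 27 / 100 * (z * |v.2.2|) := by gcongr
    linarith
  rw [abs_mul, abs_two]
  have k5 : 0 ≤ z * |v.2.2| := by positivity
  have k7 : (n + z * |v.2.2|) * z ≤ 1 / 100 * (n + z * |v.2.2|) := by nlinarith
  linarith

end Coeff

/-- A family in which the energy and the derivatives of the end velocities with respect to the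
duration are `O(T⁻²)`. -/
lemma IsSwingFamily.of_bounds {T₀ α β : ℝ} {V₀ V₁ : ℝ × ℝ × ℝ → ℝ} (hT₀ : 1 ≤ T₀)
    (h₀ : ContDiffOn ℝ ∞ V₀ (windowDomain (Ioi T₀))) (h₁ : ContDiffOn ℝ ∞ V₁ (windowDomain (Ioi T₀)))
    (flow : ∀ q ∈ windowDomain (Ioi T₀), pendFlow q.2.2 (α + q.1, V₀ q) = (β + q.2.1, V₁ q))
    (abs_le : ∀ q ∈ windowDomain (Ioi T₀), |V₀ q| ≤ 3)
    (energy : ∀ q ∈ windowDomain (Ioi T₀), |pendEnergy (α + q.1) (V₀ q)| ≤ 11 / q.2.2 ^ 2)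
    (bound₀ : ∀ q ∈ windowDomain (Ioi T₀), ∀ v : ℝ × ℝ × ℝ,
      |fderiv ℝ V₀ q v| ≤ 6 * (|v.1| + |v.2.1|) + 220 / q.2.2 ^ 2 * |v.2.2|)
    (bound₁ : ∀ q ∈ windowDomain (Ioi T₀), ∀ v : ℝ × ℝ × ℝ,
      |fderiv ℝ V₁ q v| ≤ 6 * (|v.1| + |v.2.1|) + 220 / q.2.2 ^ 2 * |v.2.2|) :
    IsSwingFamily 1000 T₀ α β V₀ V₁ := by
  have hT : ∀ q ∈ windowDomain (Ioi T₀), 1 < q.2.2 := fun q hq => lt_of_le_of_lt hT₀ hq.2.2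
  have hd : ∀ q ∈ windowDomain (Ioi T₀), |fderiv ℝ V₀ q (0, 0, 1)| ≤ 220 * (1 / q.2.2 ^ 2) ∧
      |fderiv ℝ V₁ q (0, 0, 1)| ≤ 220 * (1 / q.2.2 ^ 2) := fun q hq => by
    have b₀ := bound₀ q hq (0, 0, 1)
    have b₁ := bound₁ q hq (0, 0, 1)
    simp only [abs_zero, add_zero, mul_zero, zero_add, abs_one, mul_one] at b₀ b₁
    constructor
    · linarith [mul_one_div 220 (q.2.2 ^ 2)]
    · linarith [mul_one_div 220 (q.2.2 ^ 2)]
  have hp : ∀ q ∈ windowDomain (Ioi T₀),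
      |V₀ q * fderiv ℝ V₀ q (0, 0, 1)| ≤ 660 * (1 / q.2.2 ^ 2) := fun q hq => by
    have := hT q hq
    rw [abs_mul]
    calc _ ≤ 3 * (220 * (1 / q.2.2 ^ 2)) := by
          gcongr
          · exact abs_le q hq
          · exact (hd q hq).1
      _ = _ := by ring
  have hC : ∀ q : ℝ × ℝ × ℝ, (1000 : ℝ) / q.2.2 ^ 2 = 1000 * (1 / q.2.2 ^ 2) := fun q => by ring
  refine ⟨h₀, h₁, flow, fun q hq _ => ?_, fun q hq => ?_, fun q hq => ?_, fun q hq => ?_,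
    fun q hq => ?_, 11, fun q hq => (le_abs_self _).trans (energy q hq)⟩
  · have a1 := bound₀ q hq (1, 0, 0)
    have a2 := bound₀ q hq (0, 1, 0)
    have a3 := bound₁ q hq (1, 0, 0)
    have a4 := bound₁ q hq (0, 1, 0)
    simp only [abs_zero, add_zero, mul_zero, zero_add, abs_one, mul_one] at a1 a2 a3 a4
    refine ⟨⟨?_, ?_⟩, ?_, ?_⟩ <;> linarith
  · have h1 := _root_.abs_le.1 (hp q hq)
    have h2 := _root_.abs_le.1 (energy q hq)
    have h3 := hT q hq
    have h4 : 2 * pendEnergy (α + q.1) (V₀ q) / q.2.2 ≤ 22 * (1 / q.2.2 ^ 2) := by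
      rw [div_le_iff₀ (by linarith)]
      have : 11 / q.2.2 ^ 2 = 11 * (1 / q.2.2 ^ 2) := by ring
      have h6 : 0 < 1 / q.2.2 ^ 2 := by positivity
      nlinarith
    rw [hC, neg_mul, neg_div]
    have h6 : 0 < 1 / q.2.2 ^ 2 := by have := hT q hq; positivity
    linarith [h1.2]
  · have h1 := _root_.abs_le.1 (hp q hq)
    have h6 : 0 < 1 / q.2.2 ^ 2 := by have := hT q hq; positivity
    rw [hC]
    linarith [(hd q hq).1]
  · have h1 := _root_.abs_le.1 (hp q hq)
    have h6 : 0 < 1 / q.2.2 ^ 2 := by have := hT q hq; positivity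
    rw [hC]
    linarith [(hd q hq).2]
  · have h2 := _root_.abs_le.1 (energy q hq)
    have h6 : 0 < 1 / q.2.2 ^ 2 := by have := hT q hq; positivity
    have : 11 / q.2.2 ^ 2 = 11 * (1 / q.2.2 ^ 2) := by ring
    rw [hC]
    linarith

section Hold

variable {α β : ℝ} {g₀ g₁ : ℝ → ℝ} {τ₀ τ₁ : ℝ × ℝ → ℝ} {U₀ U₁ : ℝ × ℝ × ℝ → ℝ}

/-- The coefficient of `e^{-σ}` in the profile between the points with profile values `g₀ a` and
`g₁ b`. -/
def coeffFst (g₀ g₁ : ℝ → ℝ) : ℝ × ℝ × ℝ → ℝ := holdCoeff (fun q => g₀ q.1) (fun q => g₁ q.2.1)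

/-- The coefficient of `e^{σ - S}` in the profile between the points with profile values `g₀ a` and
`g₁ b`. -/
def coeffSnd (g₀ g₁ : ℝ → ℝ) : ℝ × ℝ × ℝ → ℝ := holdCoeff (fun q => g₁ q.2.1) (fun q => g₀ q.1)

lemma abs_fderiv_comp_fst_le {g : ℝ → ℝ} (hg : ContDiff ℝ ∞ g) (hg' : ∀ a, |deriv g a| ≤ 1 / 2)
    (q v : ℝ × ℝ × ℝ) :
    |fderiv ℝ (fun q : ℝ × ℝ × ℝ => g q.1) q v| ≤ 1 / 2 * (|v.1| + |v.2.1|) := by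
  have h1 := HasFDerivAt.comp (f := fun q : ℝ × ℝ × ℝ => q.1) q
    (hg.differentiable (by simp)).differentiableAt.hasFDerivAt hasFDerivAt_fst
  have h2 : fderiv ℝ (fun q : ℝ × ℝ × ℝ => g q.1) q v = deriv g q.1 * v.1 := by
    refine (congrArg (fun L => L v) h1.fderiv).trans ?_
    simp [mul_comm]
  rw [h2, abs_mul]
  have := hg' q.1
  nlinarith [abs_nonneg v.1, abs_nonneg v.2.1]

lemma abs_fderiv_comp_snd_le {g : ℝ → ℝ} (hg : ContDiff ℝ ∞ g) (hg' : ∀ a, |deriv g a| ≤ 1 / 2)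
    (q v : ℝ × ℝ × ℝ) :
    |fderiv ℝ (fun q : ℝ × ℝ × ℝ => g q.2.1) q v| ≤ 1 / 2 * (|v.1| + |v.2.1|) := by
  have h1 := HasFDerivAt.comp (f := fun q : ℝ × ℝ × ℝ => q.2.1) q
    (hg.differentiable (by simp)).differentiableAt.hasFDerivAt
    (HasFDerivAt.comp (g := Prod.fst) q hasFDerivAt_fst hasFDerivAt_snd)
  have h2 : fderiv ℝ (fun q : ℝ × ℝ × ℝ => g q.2.1) q v = deriv g q.2.1 * v.2.1 := by
    refine (congrArg (fun L => L v) h1.fderiv).trans ?_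
    simp [mul_comm]
  rw [h2, abs_mul]
  have := hg' q.2.1
  nlinarith [abs_nonneg v.1, abs_nonneg v.2.1]

lemma isCoeffAt_coeffFst (h₀ : IsApproach α g₀ τ₀ U₀) (h₁ : IsApproach β g₁ τ₁ U₁)
    {q : ℝ × ℝ × ℝ} (hq : q ∈ windowDomain (Ioi 20)) : IsCoeffAt (coeffFst g₀ g₁) q := by
  have c₀ : ContDiff ℝ ∞ fun q : ℝ × ℝ × ℝ => g₀ q.1 := h₀.contDiff_profile.comp contDiff_fst
  have c₁ : ContDiff ℝ ∞ fun q : ℝ × ℝ × ℝ => g₁ q.2.1 :=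
    h₁.contDiff_profile.comp (contDiff_fst.comp contDiff_snd)
  have b₀ := h₀.abs_profile_le _ hq.1
  have b₁ := h₁.abs_profile_le _ hq.2.1
  exact ⟨differentiableAt_of_mem (contDiffOn_holdCoeff c₀ c₁) hq, abs_holdCoeff_le hq.2.2 b₀ b₁,
    fun v => abs_fderiv_holdCoeff_le c₀ c₁ hq b₀ b₁ v
      (abs_fderiv_comp_fst_le h₀.contDiff_profile h₀.abs_deriv_profile_le q v)
      (abs_fderiv_comp_snd_le h₁.contDiff_profile h₁.abs_deriv_profile_le q v)⟩

lemma isCoeffAt_coeffSnd (h₀ : IsApproach α g₀ τ₀ U₀) (h₁ : IsApproach β g₁ τ₁ U₁)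
    {q : ℝ × ℝ × ℝ} (hq : q ∈ windowDomain (Ioi 20)) : IsCoeffAt (coeffSnd g₀ g₁) q := by
  have c₀ : ContDiff ℝ ∞ fun q : ℝ × ℝ × ℝ => g₀ q.1 := h₀.contDiff_profile.comp contDiff_fst
  have c₁ : ContDiff ℝ ∞ fun q : ℝ × ℝ × ℝ => g₁ q.2.1 :=
    h₁.contDiff_profile.comp (contDiff_fst.comp contDiff_snd)
  have b₀ := h₀.abs_profile_le _ hq.1
  have b₁ := h₁.abs_profile_le _ hq.2.1
  exact ⟨differentiableAt_of_mem (contDiffOn_holdCoeff c₁ c₀) hq, abs_holdCoeff_le hq.2.2 b₁ b₀,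
    fun v => abs_fderiv_holdCoeff_le c₁ c₀ hq b₁ b₀ v
      (abs_fderiv_comp_snd_le h₁.contDiff_profile h₁.abs_deriv_profile_le q v)
      (abs_fderiv_comp_fst_le h₀.contDiff_profile h₀.abs_deriv_profile_le q v)⟩

lemma contDiffOn_coeffFst (h₀ : IsApproach α g₀ τ₀ U₀) (h₁ : IsApproach β g₁ τ₁ U₁) :
    ContDiffOn ℝ ∞ (coeffFst g₀ g₁) (windowDomain (Ioi 20)) :=
  contDiffOn_holdCoeff (h₀.contDiff_profile.comp contDiff_fst)
    (h₁.contDiff_profile.comp (contDiff_fst.comp contDiff_snd))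

lemma contDiffOn_coeffSnd (h₀ : IsApproach α g₀ τ₀ U₀) (h₁ : IsApproach β g₁ τ₁ U₁) :
    ContDiffOn ℝ ∞ (coeffSnd g₀ g₁) (windowDomain (Ioi 20)) :=
  contDiffOn_holdCoeff (h₁.contDiff_profile.comp (contDiff_fst.comp contDiff_snd))
    (h₀.contDiff_profile.comp contDiff_fst)

lemma contDiffOn_holdEnergy {A B : ℝ × ℝ × ℝ → ℝ} {D : Set (ℝ × ℝ × ℝ)} (hA : ContDiffOn ℝ ∞ A D)
    (hB : ContDiffOn ℝ ∞ B D) : ContDiffOn ℝ ∞ (holdEnergy A B) D := by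
  have : ContDiffOn ℝ ∞ (fun q : ℝ × ℝ × ℝ => Real.exp (-q.2.2)) D :=
    ContDiff.contDiffOn (by fun_prop)
  exact contDiffOn_const.mul ((hA.mul hB).mul this)

lemma contDiffOn_holdVelocity {A B : ℝ × ℝ × ℝ → ℝ} {D : Set (ℝ × ℝ × ℝ)}
    (hA : ContDiffOn ℝ ∞ A D) (hB : ContDiffOn ℝ ∞ B D) : ContDiffOn ℝ ∞ (holdVelocity A B) D := by
  have : ContDiffOn ℝ ∞ (fun q : ℝ × ℝ × ℝ => Real.exp (-q.2.2)) D :=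
    ContDiff.contDiffOn (by fun_prop)
  exact contDiffOn_const.mul (hA.neg.add (hB.mul this))

/-- The duration of the motion that is put together from an approach, a motion near the upright
position and a reversed approach. -/
def lingerTime (g₀ g₁ : ℝ → ℝ) (τ₀ τ₁ : ℝ × ℝ → ℝ) (q : ℝ × ℝ × ℝ) : ℝ :=
  τ₀ (q.1, holdEnergy (coeffFst g₀ g₁) (coeffSnd g₀ g₁) q) +
    τ₁ (q.2.1, holdEnergy (coeffFst g₀ g₁) (coeffSnd g₀ g₁) q) +
    holdTime (coeffFst g₀ g₁ q) (coeffSnd g₀ g₁ q) q.2.2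

lemma contDiffOn_holdTime_comp {A B C : ℝ × ℝ × ℝ → ℝ} {D : Set (ℝ × ℝ × ℝ)}
    (hA : ContDiffOn ℝ ∞ A D) (hB : ContDiffOn ℝ ∞ B D) (hC : ContDiffOn ℝ ∞ C D) :
    ContDiffOn ℝ ∞ (fun q => holdTime (A q) (B q) (C q)) D :=
  ContDiff.comp_contDiffOn (g := fun p : ℝ × ℝ × ℝ => holdTime p.1 p.2.1 p.2.2)
    contDiff_holdTime (f := fun q => (A q, B q, C q)) (hA.prodMk (hB.prodMk hC))

lemma contDiffOn_lingerTime (h₀ : IsApproach α g₀ τ₀ U₀) (h₁ : IsApproach β g₁ τ₁ U₁) :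
    ContDiffOn ℝ ∞ (lingerTime g₀ g₁ τ₀ τ₁) (windowDomain (Ioi 20)) := by
  have hA := contDiffOn_coeffFst h₀ h₁
  have hB := contDiffOn_coeffSnd h₀ h₁
  have hH := contDiffOn_holdEnergy hA hB
  have e1 : ContDiffOn ℝ ∞ (fun q : ℝ × ℝ × ℝ => q.1) (windowDomain (Ioi 20)) :=
    contDiff_fst.contDiffOn
  have e2 : ContDiffOn ℝ ∞ (fun q : ℝ × ℝ × ℝ => q.2.1) (windowDomain (Ioi 20)) :=
    (contDiff_fst.comp contDiff_snd).contDiffOn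
  have e3 : ContDiffOn ℝ ∞ (fun q : ℝ × ℝ × ℝ => q.2.2) (windowDomain (Ioi 20)) :=
    (contDiff_snd.comp contDiff_snd).contDiffOn
  have t0 : ContDiffOn ℝ ∞ (fun q : ℝ × ℝ × ℝ =>
      τ₀ (q.1, holdEnergy (coeffFst g₀ g₁) (coeffSnd g₀ g₁) q)) (windowDomain (Ioi 20)) :=
    ContDiff.comp_contDiffOn (g := τ₀) h₀.contDiff_time (e1.prodMk hH)
  have t1 : ContDiffOn ℝ ∞ (fun q : ℝ × ℝ × ℝ =>
      τ₁ (q.2.1, holdEnergy (coeffFst g₀ g₁) (coeffSnd g₀ g₁) q)) (windowDomain (Ioi 20)) :=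
    ContDiff.comp_contDiffOn (g := τ₁) h₁.contDiff_time (e2.prodMk hH)
  have t2 : ContDiffOn ℝ ∞ (fun q : ℝ × ℝ × ℝ =>
      holdTime (coeffFst g₀ g₁ q) (coeffSnd g₀ g₁ q) q.2.2) (windowDomain (Ioi 20)) :=
    contDiffOn_holdTime_comp hA hB e3
  exact (t0.add t1).add t2

lemma abs_holdEnergy_lt {A B : ℝ × ℝ × ℝ → ℝ} {q : ℝ × ℝ × ℝ} (hq : 20 < q.2.2)
    (hA : IsCoeffAt A q) (hB : IsCoeffAt B q) : |holdEnergy A B q| < 1 / 16 := by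
  have := abs_holdEnergy_le hA hB
  have := exp_neg_le_of_twenty_lt hq
  linarith

/-- The duration is a strictly increasing function of the parameter `S`, with derivative between two
positive constants, and its other derivatives are bounded. -/
lemma hasFDerivAt_lingerTime (h₀ : IsApproach α g₀ τ₀ U₀) (h₁ : IsApproach β g₁ τ₁ U₁)
    {q : ℝ × ℝ × ℝ} (hq : q ∈ windowDomain (Ioi 20)) (v : ℝ × ℝ × ℝ) :
    ∃ ι : ℝ, 1 ≤ ι ∧ ι ≤ 11 / 10 ∧ |fderiv ℝ (lingerTime g₀ g₁ τ₀ τ₁) q v - ι * v.2.2| ≤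
      3 * (|v.1| + |v.2.1|) + 11 / 20 * |v.2.2| := by
  set A := coeffFst g₀ g₁ with hAdef
  set B := coeffSnd g₀ g₁ with hBdef
  have hA : IsCoeffAt A q := isCoeffAt_coeffFst h₀ h₁ hq
  have hB : IsCoeffAt B q := isCoeffAt_coeffSnd h₀ h₁ hq
  have hz := exp_neg_le_of_twenty_lt hq.2.2
  have hz0 := Real.exp_pos (-q.2.2)
  have hS0 : 0 ≤ q.2.2 := by have : 20 < q.2.2 := hq.2.2; linarith
  have hH : HasFDerivAt (holdEnergy A B) (fderiv ℝ (holdEnergy A B) q) q :=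
    (differentiableAt_of_mem (contDiffOn_holdEnergy (contDiffOn_coeffFst h₀ h₁)
      (contDiffOn_coeffSnd h₀ h₁)) hq).hasFDerivAt
  have f2 : HasFDerivAt (fun q : ℝ × ℝ × ℝ => q.2.1) ((ContinuousLinearMap.fst ℝ ℝ ℝ) ∘L
    (ContinuousLinearMap.snd ℝ ℝ (ℝ × ℝ))) q :=
    ((ContinuousLinearMap.fst ℝ ℝ ℝ) ∘L (ContinuousLinearMap.snd ℝ ℝ (ℝ × ℝ))).hasFDerivAt
  have f3 : HasFDerivAt (fun q : ℝ × ℝ × ℝ => q.2.2) ((ContinuousLinearMap.snd ℝ ℝ ℝ) ∘L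
    (ContinuousLinearMap.snd ℝ ℝ (ℝ × ℝ))) q :=
    ((ContinuousLinearMap.snd ℝ ℝ ℝ) ∘L (ContinuousLinearMap.snd ℝ ℝ (ℝ × ℝ))).hasFDerivAt
  have d0 := HasFDerivAt.comp (g := τ₀) q
    (h₀.contDiff_time.differentiable (by simp)).differentiableAt.hasFDerivAt
    (HasFDerivAt.prodMk (f₁ := fun q : ℝ × ℝ × ℝ => q.1) hasFDerivAt_fst hH)
  have d1 := HasFDerivAt.comp (g := τ₁) q
    (h₁.contDiff_time.differentiable (by simp)).differentiableAt.hasFDerivAt (f2.prodMk hH)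
  have d2 := HasFDerivAt.comp (g := fun p : ℝ × ℝ × ℝ => holdTime p.1 p.2.1 p.2.2) q
    (contDiff_holdTime.differentiable (by simp)).differentiableAt.hasFDerivAt
    (hA.differentiableAt.hasFDerivAt.prodMk (hB.differentiableAt.hasFDerivAt.prodMk f3))
  have d3 := ((d0.add d1).add d2)
  have d4 : fderiv ℝ (lingerTime g₀ g₁ τ₀ τ₁) q v =
      fderiv ℝ τ₀ (q.1, holdEnergy A B q) (v.1, fderiv ℝ (holdEnergy A B) q v) +
      fderiv ℝ τ₁ (q.2.1, holdEnergy A B q) (v.2.1, fderiv ℝ (holdEnergy A B) q v) +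
      fderiv ℝ (fun p : ℝ × ℝ × ℝ => holdTime p.1 p.2.1 p.2.2) (A q, B q, q.2.2)
        (fderiv ℝ A q v, fderiv ℝ B q v, v.2.2) :=
    congrArg (fun L => L v) d3.fderiv
  have hHb := abs_holdEnergy_lt hq.2.2 hA hB
  have b0 := h₀.abs_fderiv_time_le _ _ hq.1 hHb (v.1, fderiv ℝ (holdEnergy A B) q v)
  have b1 := h₁.abs_fderiv_time_le _ _ hq.2.1 hHb (v.2.1, fderiv ℝ (holdEnergy A B) q v)
  have b2 := abs_fderiv_holdTime_sub_le hS0 hA.abs_le hB.abs_le (hz.trans (by norm_num))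
    (fderiv ℝ A q v, fderiv ℝ B q v, v.2.2)
  have b3 := one_le_holdIntegrand
    (abs_holdProfile_le hA.abs_le hB.abs_le (hz.trans (by norm_num)) ⟨hS0, le_refl q.2.2⟩)
  refine ⟨_, b3.1, b3.2, ?_⟩
  rw [d4]
  have a1 := hA.abs_fderiv_le v
  have a2 := hB.abs_fderiv_le v
  have a3 := abs_fderiv_holdEnergy_le hq.2.2 hA hB v
  have hm0 := abs_nonneg v.2.2
  have hn1 := abs_nonneg v.1
  have hn2 := abs_nonneg v.2.1
  have k1 : Real.exp (-q.2.2) * |v.2.2| ≤ 1 / 100000 * |v.2.2| := by gcongr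
  have k2 : 5 * Real.exp (-q.2.2) * (|v.1| + |v.2.1| + |v.2.2|) ≤
      5 * (1 / 100000) * (|v.1| + |v.2.1| + |v.2.2|) := by gcongr
  simp only at b0 b1 b2
  rw [add_sub_assoc]
  refine (abs_add_le _ _).trans ((add_le_add_left (abs_add_le _ _) _).trans ?_)
  linarith

lemma lingerTime_bounds (h₀ : IsApproach α g₀ τ₀ U₀) (h₁ : IsApproach β g₁ τ₁ U₁)
    {q : ℝ × ℝ × ℝ} (hq : q ∈ windowDomain (Ioi 20)) :
    q.2.2 ≤ lingerTime g₀ g₁ τ₀ τ₁ q ∧ lingerTime g₀ g₁ τ₀ τ₁ q ≤ 24 + 11 / 10 * q.2.2 := by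
  have hA := isCoeffAt_coeffFst h₀ h₁ hq
  have hB := isCoeffAt_coeffSnd h₀ h₁ hq
  have hz := exp_neg_le_of_twenty_lt hq.2.2
  have hS0 : 0 ≤ q.2.2 := by have : 20 < q.2.2 := hq.2.2; linarith
  have hHb := abs_holdEnergy_lt hq.2.2 hA hB
  obtain ⟨a1, a2⟩ := h₀.time_bounds _ _ hq.1 hHb
  obtain ⟨b1, b2⟩ := h₁.time_bounds _ _ hq.2.1 hHb
  obtain ⟨c1, c2⟩ := holdTime_bounds hS0 hA.abs_le hB.abs_le (hz.trans (by norm_num))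
  unfold lingerTime
  constructor <;> linarith

lemma holdEnergy_comm (A B : ℝ × ℝ × ℝ → ℝ) : holdEnergy B A = holdEnergy A B := by
  ext q
  rw [holdEnergy, holdEnergy, mul_comm (B q)]

lemma abs_fderiv_velocity_le {A B : ℝ × ℝ × ℝ → ℝ} {q : ℝ × ℝ × ℝ} (hq : 20 < q.2.2)
    (hA : IsCoeffAt A q) (hB : IsCoeffAt B q) (h₀ : IsApproach α g₀ τ₀ U₀)
    (hH : DifferentiableAt ℝ (holdEnergy A B) q) (hw : DifferentiableAt ℝ (holdVelocity A B) q)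
    (a : ℝ × ℝ × ℝ →L[ℝ] ℝ) (ha : |a q| < windowRadius) (v : ℝ × ℝ × ℝ)
    (hav : |a v| ≤ |v.1| + |v.2.1|) :
    |fderiv ℝ (fun q => U₀ (a q, holdEnergy A B q, holdVelocity A B q)) q v| ≤
      5 * (|v.1| + |v.2.1|) + 8 * Real.exp (-q.2.2) * |v.2.2| := by
  have hz := exp_neg_le_of_twenty_lt hq
  have hz0 := Real.exp_pos (-q.2.2)
  have d0 := HasFDerivAt.comp (g := U₀) q
    (h₀.contDiff_velocity.differentiable (by simp)).differentiableAt.hasFDerivAt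
    (a.hasFDerivAt.prodMk (hH.hasFDerivAt.prodMk hw.hasFDerivAt))
  have d1 : fderiv ℝ (fun q => U₀ (a q, holdEnergy A B q, holdVelocity A B q)) q v =
      fderiv ℝ U₀ (a q, holdEnergy A B q, holdVelocity A B q)
        (a v, fderiv ℝ (holdEnergy A B) q v, fderiv ℝ (holdVelocity A B) q v) :=
    congrArg (fun L => L v) d0.fderiv
  have a3 := abs_fderiv_holdEnergy_le hq hA hB v
  have a4 := abs_fderiv_holdVelocity_le hq hA hB v
  have b := h₀.abs_fderiv_velocity_le (a q) (holdEnergy A B q) (holdVelocity A B q) ha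
    (abs_holdEnergy_lt hq hA hB)
    (a v, fderiv ℝ (holdEnergy A B) q v, fderiv ℝ (holdVelocity A B) q v)
  simp only at b
  rw [d1]
  have hn : 0 ≤ |v.1| + |v.2.1| := by positivity
  have k2 : 5 * Real.exp (-q.2.2) * (|v.1| + |v.2.1|) ≤
      5 * (1 / 100000) * (|v.1| + |v.2.1|) := by gcongr
  linarith

lemma exp_neg_le_div_sq {T S : ℝ} (hS : 20 < S) (hT0 : 0 < T) (hT : T ≤ 24 + 11 / 10 * S) :
    Real.exp (-S) ≤ 11 / T ^ 2 := by
  have h1 := Real.quadratic_le_exp_of_nonneg (by linarith : (0 : ℝ) ≤ S)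
  rw [Real.exp_neg, inv_eq_one_div, div_le_div_iff₀ (Real.exp_pos _) (by positivity)]
  have h2 : T ≤ 23 / 10 * S := by linarith
  nlinarith

/-- An approach, a motion near the upright position and a reversed approach together give a motion
from `α + a` to `β + b`. -/
lemma pendFlow_linger (h₀ : IsApproach α g₀ τ₀ U₀) (h₁ : IsApproach β g₁ τ₁ U₁)
    {q : ℝ × ℝ × ℝ} (hq : q ∈ windowDomain (Ioi 20)) {v₀ v₁ T : ℝ}
    (hv₀ : v₀ = U₀ (q.1, holdEnergy (coeffFst g₀ g₁) (coeffSnd g₀ g₁) q,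
      holdVelocity (coeffFst g₀ g₁) (coeffSnd g₀ g₁) q))
    (hv₁ : v₁ = U₁ (q.2.1, holdEnergy (coeffSnd g₀ g₁) (coeffFst g₀ g₁) q,
      holdVelocity (coeffSnd g₀ g₁) (coeffFst g₀ g₁) q))
    (hT : T = lingerTime g₀ g₁ τ₀ τ₁ q) :
    pendFlow T (α + q.1, v₀) = (β + q.2.1, -v₁) ∧
      pendEnergy (α + q.1) v₀ = holdEnergy (coeffFst g₀ g₁) (coeffSnd g₀ g₁) q ∧
      ∀ t ∈ Icc 1 (T - 1), Real.cos (pendFlow t (α + q.1, v₀)).1 < 999 / 1000 := by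
  have hA := isCoeffAt_coeffFst h₀ h₁ hq
  have hB := isCoeffAt_coeffSnd h₀ h₁ hq
  have hz := exp_neg_le_of_twenty_lt hq.2.2
  have hz0 := Real.exp_pos (-q.2.2)
  have hS0 : 0 ≤ q.2.2 := by have : 20 < q.2.2 := hq.2.2; linarith
  have hHb := abs_holdEnergy_lt hq.2.2 hA hB
  have hHb' := abs_holdEnergy_lt hq.2.2 hB hA
  have hg₀ : coeffFst g₀ g₁ q + coeffSnd g₀ g₁ q * Real.exp (-q.2.2) = g₀ q.1 :=
    holdCoeff_add hq.2.2
  have hg₁ : coeffSnd g₀ g₁ q + coeffFst g₀ g₁ q * Real.exp (-q.2.2) = g₁ q.2.1 :=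
    holdCoeff_add hq.2.2
  have aA := abs_le.1 hA.abs_le
  have aB := abs_le.1 hB.abs_le
  obtain ⟨f0, E0, c0⟩ := h₀.flow q.1 _ (holdVelocity (coeffFst g₀ g₁) (coeffSnd g₀ g₁) q) hq.1 hHb
    (by rw [holdVelocity, holdEnergy, ← hg₀]; ring)
    (fun h => by rw [holdVelocity]; nlinarith)
  obtain ⟨f1, -, c1⟩ := h₁.flow q.2.1 _ (holdVelocity (coeffSnd g₀ g₁) (coeffFst g₀ g₁) q) hq.2.1
    hHb' (by rw [holdVelocity, holdEnergy, ← hg₁]; ring)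
    (fun h => by rw [holdVelocity]; nlinarith)
  obtain ⟨f2, c2⟩ := pendFlow_hold hS0 hA.abs_le hB.abs_le (hz.trans (by norm_num))
  rw [← hv₀] at f0 E0 c0
  rw [← hv₁] at f1 c1
  rw [holdEnergy_comm] at f1 c1
  rw [hg₀, hg₁] at f2
  rw [hg₀] at c2
  change pendFlow _ (_, holdVelocity (coeffFst g₀ g₁) (coeffSnd g₀ g₁) q) =
    (_, -holdVelocity (coeffSnd g₀ g₁) (coeffFst g₀ g₁) q) at f2
  change ∀ t ∈ _, Real.cos (pendFlow _ (_, holdVelocity (coeffFst g₀ g₁) (coeffSnd g₀ g₁) q)).1 < _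
    at c2
  unfold lingerTime at hT
  set s₀ := τ₀ (q.1, holdEnergy (coeffFst g₀ g₁) (coeffSnd g₀ g₁) q)
  set s₁ := τ₁ (q.2.1, holdEnergy (coeffFst g₀ g₁) (coeffSnd g₀ g₁) q)
  set s := holdTime (coeffFst g₀ g₁ q) (coeffSnd g₀ g₁ q) q.2.2
  have f3 : pendFlow (s + s₀) (α + q.1, v₀) = (Real.pi + 2 * Real.arcsin (g₁ q.2.1),
      -holdVelocity (coeffSnd g₀ g₁) (coeffFst g₀ g₁) q) := by
    rw [pendFlow_add, f0, f2]
  have f4 : ∀ t, pendFlow (t + (s + s₀)) (α + q.1, v₀) =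
      ((pendFlow (s₁ - t) (β + q.2.1, v₁)).1, -(pendFlow (s₁ - t) (β + q.2.1, v₁)).2) := by
    intro t
    rw [pendFlow_add, f3]
    have e1 := pendFlow_neg (-t) (Real.pi + 2 * Real.arcsin (g₁ q.2.1))
      (holdVelocity (coeffSnd g₀ g₁) (coeffFst g₀ g₁) q)
    rw [neg_neg, ← f1, ← pendFlow_add, neg_add_eq_sub] at e1
    exact e1
  refine ⟨?_, E0, fun t ht => ?_⟩
  · have := f4 s₁
    rw [sub_self, isFlow_pendFlow.zero] at this
    rw [hT, ← this]
    congr 1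
    ring
  · rcases le_or_gt t s₀ with h | h
    · exact c0 t ⟨ht.1, h⟩
    · rcases le_or_gt t (s + s₀) with h' | h'
      · have := c2 (t - s₀) ⟨by linarith, by linarith⟩
        rwa [← f0, ← pendFlow_add, sub_add_cancel] at this
      · have e := f4 (t - (s + s₀))
        rw [sub_add_cancel] at e
        rw [e]
        exact c1 _ ⟨by linarith [ht.2], by linarith⟩

/-- Two approaches determine a family of motions that linger at the upright position. -/
theorem exists_linger_family (h₀ : IsApproach α g₀ τ₀ U₀) (h₁ : IsApproach β g₁ τ₁ U₁) :
    ∃ V₀ V₁, IsSwingFamily 1000 60 α β V₀ V₁ ∧ StaysAway 60 α V₀ := by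
  set A := coeffFst g₀ g₁ with hAdef
  set B := coeffSnd g₀ g₁ with hBdef
  set G := lingerTime g₀ g₁ τ₀ τ₁ with hG
  have hGs : ContDiffOn ℝ ∞ G (windowDomain (Ioi 20)) := contDiffOn_lingerTime h₀ h₁
  have hA := contDiffOn_coeffFst h₀ h₁
  have hB := contDiffOn_coeffSnd h₀ h₁
  have hG3 : ∀ q ∈ windowDomain (Ioi (20 : ℝ)), 2 / 5 ≤ fderiv ℝ G q (0, 0, 1) := fun q hq => by
    obtain ⟨ι, i1, i2, i3⟩ := hasFDerivAt_lingerTime h₀ h₁ hq (0, 0, 1)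
    simp only [abs_zero, add_zero, mul_zero, zero_add, abs_one, mul_one] at i3
    have := (abs_le.1 i3).1
    linarith
  have hG12 : ∀ q ∈ windowDomain (Ioi (20 : ℝ)), ∀ v : ℝ × ℝ × ℝ,
      |fderiv ℝ G q (v.1, v.2.1, 0)| ≤ 3 * (|v.1| + |v.2.1|) := fun q hq v => by
    obtain ⟨ι, i1, i2, i3⟩ := hasFDerivAt_lingerTime h₀ h₁ hq (v.1, v.2.1, 0)
    simpa using i3
  have hderiv : ∀ a b S, |a| < windowRadius → |b| < windowRadius → 20 < S →
      HasDerivAt (fun l => G (a, b, l)) (fderiv ℝ G (a, b, S) (0, 0, 1)) S := fun a b S ha hb hS => by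
    have h1 := (differentiableAt_of_mem hGs (q := (a, b, S)) ⟨ha, hb, hS⟩).hasFDerivAt
    exact HasFDerivAt.comp_hasDerivAt (l := G) S h1
      ((hasDerivAt_const S a).prodMk ((hasDerivAt_const S b).prodMk (hasDerivAt_id S)))
  obtain ⟨l, -, hl, hW⟩ := exists_reparametrization (T₀ := 60) isOpen_Ioi hGs
    (fun q hq => by linarith [hG3 q hq] |> ne_of_gt)
    (fun a b ha hb => StrictMonoOn.injOn (strictMonoOn_of_deriv_pos (convex_Ioi 20)
      (fun S hS => (hderiv a b S ha hb hS).continuousAt.continuousWithinAt) fun S hS => by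
        rw [interior_Ioi] at hS
        rw [(hderiv a b S ha hb hS).deriv]
        linarith [hG3 (a, b, S) ⟨ha, hb, hS⟩]))
    (fun a b T ha hb hT => by
      have h1 := (lingerTime_bounds h₀ h₁ (q := (a, b, 21)) ⟨ha, hb, by norm_num [mem_Ioi]⟩).2
      have h2 := (lingerTime_bounds h₀ h₁ (q := (a, b, T)) ⟨ha, hb, by simp only [mem_Ioi]; linarith⟩).1
      have hc : ContinuousOn (fun l => G (a, b, l)) (Icc 21 T) := fun S hS =>
        (hderiv a b S ha hb (by linarith [hS.1])).continuousAt.continuousWithinAt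
      simp only at h1 h2
      obtain ⟨S, hS, hS'⟩ := intermediate_value_Icc (by linarith) hc
        (show T ∈ Icc (G (a, b, 21)) (G (a, b, T)) from ⟨by linarith, h2⟩)
      exact ⟨S, by simp only [mem_Ioi]; linarith [hS.1], hS'⟩)
  set W₀ : ℝ × ℝ × ℝ → ℝ := fun q => U₀ (q.1, holdEnergy A B q, holdVelocity A B q) with hW₀
  set W₁ : ℝ × ℝ × ℝ → ℝ := fun q => U₁ (q.2.1, holdEnergy B A q, holdVelocity B A q) with hW₁
  have hW₀s : ContDiffOn ℝ ∞ W₀ (windowDomain (Ioi 20)) :=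
    ContDiff.comp_contDiffOn (g := U₀) h₀.contDiff_velocity (contDiff_fst.contDiffOn.prodMk
      ((contDiffOn_holdEnergy hA hB).prodMk (contDiffOn_holdVelocity hA hB)))
  have hW₁s : ContDiffOn ℝ ∞ W₁ (windowDomain (Ioi 20)) :=
    ContDiff.comp_contDiffOn (g := U₁) h₁.contDiff_velocity
      ((contDiff_fst.comp contDiff_snd).contDiffOn.prodMk
      ((contDiffOn_holdEnergy hB hA).prodMk (contDiffOn_holdVelocity hB hA)))
  have hW₀d : ∀ q ∈ windowDomain (Ioi (20 : ℝ)), ∀ v : ℝ × ℝ × ℝ, |fderiv ℝ W₀ q v| ≤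
      5 * (|v.1| + |v.2.1|) + 8 * Real.exp (-q.2.2) * |v.2.2| := fun q hq v =>
    abs_fderiv_velocity_le hq.2.2 (isCoeffAt_coeffFst h₀ h₁ hq) (isCoeffAt_coeffSnd h₀ h₁ hq) h₀
      (differentiableAt_of_mem (contDiffOn_holdEnergy hA hB) hq)
      (differentiableAt_of_mem (contDiffOn_holdVelocity hA hB) hq)
      (ContinuousLinearMap.fst ℝ ℝ (ℝ × ℝ)) hq.1 v (by
        rw [ContinuousLinearMap.coe_fst']; linarith [abs_nonneg v.2.1])
  have hW₁d : ∀ q ∈ windowDomain (Ioi (20 : ℝ)), ∀ v : ℝ × ℝ × ℝ, |fderiv ℝ W₁ q v| ≤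
      5 * (|v.1| + |v.2.1|) + 8 * Real.exp (-q.2.2) * |v.2.2| := fun q hq v =>
    abs_fderiv_velocity_le hq.2.2 (isCoeffAt_coeffSnd h₀ h₁ hq) (isCoeffAt_coeffFst h₀ h₁ hq) h₁
      (differentiableAt_of_mem (contDiffOn_holdEnergy hB hA) hq)
      (differentiableAt_of_mem (contDiffOn_holdVelocity hB hA) hq)
      ((ContinuousLinearMap.fst ℝ ℝ ℝ) ∘L (ContinuousLinearMap.snd ℝ ℝ (ℝ × ℝ))) hq.2.1 v (by
        simp only [ContinuousLinearMap.comp_apply, ContinuousLinearMap.coe_fst',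
          ContinuousLinearMap.coe_snd']
        linarith [abs_nonneg v.1])
  obtain ⟨hV₀, hd₀⟩ := hW _ hW₀s
  obtain ⟨hV₁, hd₁⟩ := hW _ hW₁s
  have hT0 : ∀ q ∈ windowDomain (Ioi (60 : ℝ)), 60 < q.2.2 := fun q hq => hq.2.2
  have hexp : ∀ q ∈ windowDomain (Ioi (60 : ℝ)), Real.exp (-l q) ≤ 11 / q.2.2 ^ 2 := fun q hq => by
    obtain ⟨hm, hGl⟩ := hl q hq
    have hlb := (lingerTime_bounds h₀ h₁ hm).2
    have hlS : 20 < l q := hm.2.2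
    exact exp_neg_le_div_sq hlS (by linarith [hT0 q hq]) (by rw [← hGl]; exact hlb)
  -- the bound for the derivatives of the velocities after the duration is made a parameter
  have key : ∀ W : ℝ × ℝ × ℝ → ℝ, (∀ q ∈ windowDomain (Ioi (20 : ℝ)), ∀ v : ℝ × ℝ × ℝ,
      |fderiv ℝ W q v| ≤ 5 * (|v.1| + |v.2.1|) + 8 * Real.exp (-q.2.2) * |v.2.2|) →
      ∀ q ∈ windowDomain (Ioi (60 : ℝ)), ∀ v : ℝ × ℝ × ℝ,
      |fderiv ℝ W (q.1, q.2.1, l q) (v.1, v.2.1, 0) + fderiv ℝ W (q.1, q.2.1, l q) (0, 0, 1) *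
        ((v.2.2 - fderiv ℝ G (q.1, q.2.1, l q) (v.1, v.2.1, 0)) /
          fderiv ℝ G (q.1, q.2.1, l q) (0, 0, 1))| ≤
      6 * (|v.1| + |v.2.1|) + 220 / q.2.2 ^ 2 * |v.2.2| := by
    intro W hWd q hq v
    have hm := (hl q hq).1
    have a1 := hWd _ hm (v.1, v.2.1, 0)
    have a2 := hWd _ hm (0, 0, 1)
    simp only [abs_zero, add_zero, mul_zero, zero_add, abs_one, mul_one] at a1 a2
    have a3 := hG3 _ hm
    have a4 := hG12 _ hm v
    have hz := exp_neg_le_of_twenty_lt hm.2.2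
    have hz0 := Real.exp_pos (-(l q))
    simp only at hz
    have hx := hexp q hq
    have hn : 0 ≤ |v.1| + |v.2.1| := by positivity
    refine (abs_add_le _ _).trans ?_
    rw [abs_mul, abs_div, abs_of_pos (by linarith : 0 < fderiv ℝ G (q.1, q.2.1, l q) (0, 0, 1))]
    have a5 : |v.2.2 - fderiv ℝ G (q.1, q.2.1, l q) (v.1, v.2.1, 0)| /
        fderiv ℝ G (q.1, q.2.1, l q) (0, 0, 1) ≤
        (|v.2.2| + 3 * (|v.1| + |v.2.1|)) / (2 / 5) := by
      gcongr
      exact (abs_sub _ _).trans (by linarith)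
    have a6 : |fderiv ℝ W (q.1, q.2.1, l q) (0, 0, 1)| *
        (|v.2.2 - fderiv ℝ G (q.1, q.2.1, l q) (v.1, v.2.1, 0)| /
          fderiv ℝ G (q.1, q.2.1, l q) (0, 0, 1)) ≤
        8 * Real.exp (-(l q)) * ((|v.2.2| + 3 * (|v.1| + |v.2.1|)) / (2 / 5)) := by
      gcongr
    have a7 : Real.exp (-(l q)) * (|v.1| + |v.2.1|) ≤ 1 / 100000 * (|v.1| + |v.2.1|) := by gcongr
    have a8 : Real.exp (-(l q)) * |v.2.2| ≤ 11 / q.2.2 ^ 2 * |v.2.2| := by gcongr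
    have a9 : 220 / q.2.2 ^ 2 * |v.2.2| = 20 * (11 / q.2.2 ^ 2 * |v.2.2|) := by ring
    rw [a9]
    linarith
  have hflow := fun (q : ℝ × ℝ × ℝ) (hq : q ∈ windowDomain (Ioi 60)) =>
    pendFlow_linger h₀ h₁ (hl q hq).1 (v₀ := W₀ (q.1, q.2.1, l q)) (v₁ := W₁ (q.1, q.2.1, l q))
      rfl rfl (hl q hq).2.symm
  refine ⟨fun q => W₀ (q.1, q.2.1, l q), fun q => -W₁ (q.1, q.2.1, l q),
    IsSwingFamily.of_bounds (by norm_num) hV₀ hV₁.neg (fun q hq => (hflow q hq).1) (fun q hq => ?_)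
      (fun q hq => ?_) (fun q hq v => ?_) (fun q hq v => ?_), fun q hq => (hflow q hq).2.2⟩
  · have hm := (hl q hq).1
    have cA := isCoeffAt_coeffFst h₀ h₁ hm
    have cB := isCoeffAt_coeffSnd h₀ h₁ hm
    exact h₀.abs_velocity_le _ _ _ hq.1 (abs_holdEnergy_lt hm.2.2 cA cB)
      (abs_holdVelocity_le hm.2.2 cA cB)
  · have hm := (hl q hq).1
    have := (hflow q hq).2.1
    rw [this]
    exact (abs_holdEnergy_le (isCoeffAt_coeffFst h₀ h₁ hm) (isCoeffAt_coeffSnd h₀ h₁ hm)).trans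
      (hexp q hq)
  · rw [hd₀ q hq v]
    exact key W₀ hW₀d q hq v
  · have : fderiv ℝ (fun q => -W₁ (q.1, q.2.1, l q)) q v =
        -fderiv ℝ (fun q => W₁ (q.1, q.2.1, l q)) q v := by
      rw [fderiv_fun_neg]; rfl
    rw [this, abs_neg, hd₁ q hq v]
    exact key W₁ hW₁d q hq v

end Hold

/-! ### The four uncoupled pendula at total energy one -/

lemma abs_apply_le_norm (w : Config) (i : Fin 4) : |w i| ≤ ‖w‖ := by
  rw [← Real.norm_eq_abs]
  exact PiLp.norm_apply_le w i

lemma norm_le_two_mul {w : Config} {M : ℝ} (h : ∀ i, |w i| ≤ M) : ‖w‖ ≤ 2 * M := by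
  have hM : 0 ≤ M := (abs_nonneg _).trans (h 0)
  rw [EuclideanSpace.norm_eq]
  refine Real.sqrt_le_iff.2 ⟨by linarith, ?_⟩
  calc ∑ i, ‖w i‖ ^ 2 ≤ ∑ _i : Fin 4, M ^ 2 := by
        refine Finset.sum_le_sum fun i _ => ?_
        rw [Real.norm_eq_abs]
        exact pow_le_pow_left₀ (abs_nonneg _) (h i) 2
    _ = (2 * M) ^ 2 := by simp; ring

/-- A function whose derivative is negative wherever it takes the value `c` takes it at most
once. -/
lemma eq_of_deriv_neg_at_level {f f' : ℝ → ℝ} {c a t₁ t₂ : ℝ}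
    (hf : ∀ t, a < t → HasDerivAt f (f' t) t) (hneg : ∀ t, a < t → f t = c → f' t < 0)
    (h₁ : a < t₁) (h₂ : a < t₂) (e₁ : f t₁ = c) (e₂ : f t₂ = c) : t₁ = t₂ := by
  wlog hlt : t₁ < t₂ generalizing t₁ t₂
  · rcases lt_trichotomy t₁ t₂ with h | h | h
    · exact this h₁ h₂ e₁ e₂ h
    · exact h
    · exact (this h₂ h₁ e₂ e₁ h).symm
  exfalso
  have hle : ∀ t ∈ Icc t₁ t₂, f t ≤ c := fun t ht =>
    image_le_of_deriv_right_lt_deriv_boundary (f := f) (f' := f') (B := fun _ => c)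
      (B' := fun _ => 0) (a := t₁) (b := t₂)
      (fun t ht => (hf t (h₁.trans_le ht.1)).continuousAt.continuousWithinAt)
      (fun t ht => (hf t (h₁.trans_le ht.1)).hasDerivWithinAt) e₁.le
      (fun _ => hasDerivAt_const _ _) (fun t ht h => hneg t (h₁.trans_le ht.1) h) ht
  have h0 : 0 ≤ f' t₂ := by
    refine ge_of_tendsto ((hasDerivAt_iff_tendsto_slope_left_right.1 (hf t₂ h₂)).1) ?_
    filter_upwards [Ioo_mem_nhdsLT hlt] with t ht
    rw [slope_def_field, e₂]
    exact div_nonneg_of_nonpos (by linarith [hle t ⟨ht.1.le, ht.2.le⟩]) (by linarith [ht.2])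
  linarith [hneg t₂ h₂ e₂]

/-- The pairs of end points whose coordinates are in the windows around `α i` and `β i`. -/
def endPoints (α β : Fin 4 → ℝ) : Set (Config × Config) :=
  {p | ∀ i, |p.1 i - α i| < windowRadius ∧ |p.2 i - β i| < windowRadius}

lemma isOpen_endPoints (α β : Fin 4 → ℝ) : IsOpen (endPoints α β) := by
  simp only [endPoints, ofPred_forall]
  refine isOpen_iInter_of_finite fun i => ?_
  exact (isOpen_lt (f := fun p : Config × Config => |p.1 i - α i|) (by fun_prop)
    continuous_const).inter
    (isOpen_lt (f := fun p : Config × Config => |p.2 i - β i|) (by fun_prop) continuous_const)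

/-- The parameters of the motion of the `i`-th pendulum between given end points. -/
def motionParam (α β : Fin 4 → ℝ) (i : Fin 4) (p : Config × Config) (T : ℝ) : ℝ × ℝ × ℝ :=
  (p.1 i - α i, p.2 i - β i, T)

lemma motionParam_mem {α β : Fin 4 → ℝ} {p : Config × Config} (hp : p ∈ endPoints α β) {T T₀ : ℝ}
    (hT : T₀ < T) (i : Fin 4) : motionParam α β i p T ∈ windowDomain (Ioi T₀) :=
  ⟨(hp i).1, (hp i).2, hT⟩

/-- The linear part of `motionParam`. -/
def motionParamLinear (i : Fin 4) : (Config × Config) × ℝ →L[ℝ] ℝ × ℝ × ℝ :=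
  ((EuclideanSpace.proj i : Config →L[ℝ] ℝ) ∘L (ContinuousLinearMap.fst ℝ Config Config) ∘L
    (ContinuousLinearMap.fst ℝ (Config × Config) ℝ)).prod
  (((EuclideanSpace.proj i : Config →L[ℝ] ℝ) ∘L (ContinuousLinearMap.snd ℝ Config Config) ∘L
    (ContinuousLinearMap.fst ℝ (Config × Config) ℝ)).prod
    (ContinuousLinearMap.snd ℝ (Config × Config) ℝ))

lemma motionParamLinear_apply (i : Fin 4) (u : (Config × Config) × ℝ) :
    motionParamLinear i u = (u.1.1 i, u.1.2 i, u.2) := rfl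

lemma motionParam_eq (α β : Fin 4 → ℝ) (i : Fin 4) (q : (Config × Config) × ℝ) :
    motionParam α β i q.1 q.2 = motionParamLinear i q - (α i, β i, 0) := by
  rw [motionParamLinear_apply, motionParam]
  simp

lemma contDiff_motionParam (α β : Fin 4 → ℝ) (i : Fin 4) :
    ContDiff ℝ ∞ fun q : (Config × Config) × ℝ => motionParam α β i q.1 q.2 := by
  simp only [motionParam_eq]
  exact (motionParamLinear i).contDiff.sub contDiff_const

lemma hasFDerivAt_motionParam (α β : Fin 4 → ℝ) (i : Fin 4) (q : (Config × Config) × ℝ) :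
    HasFDerivAt (fun q : (Config × Config) × ℝ => motionParam α β i q.1 q.2)
      (motionParamLinear i) q := by
  simp only [motionParam_eq]
  exact (motionParamLinear i).hasFDerivAt.sub_const _

/-- The total energy of the motions with given initial velocities. -/
def totalEnergy (α β : Fin 4 → ℝ) (V : Fin 4 → ℝ × ℝ × ℝ → ℝ) (q : (Config × Config) × ℝ) : ℝ :=
  ∑ i, pendEnergy (q.1.1 i) (V i (motionParam α β i q.1 q.2))

section Free

variable {C T₀ : ℝ} {α β : Fin 4 → ℝ} {V₀ V₁ : Fin 4 → ℝ × ℝ × ℝ → ℝ}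

lemma contDiffOn_velocity_motionParam {V : ℝ × ℝ × ℝ → ℝ} {i : Fin 4}
    (hV : ContDiffOn ℝ ∞ V (windowDomain (Ioi T₀))) :
    ContDiffOn ℝ ∞ (fun q : (Config × Config) × ℝ => V (motionParam α β i q.1 q.2))
      (endPoints α β ×ˢ Ioi T₀) :=
  hV.comp (contDiff_motionParam α β i).contDiffOn fun _ hq => motionParam_mem hq.1 hq.2 i

lemma contDiffOn_totalEnergy {V : Fin 4 → ℝ × ℝ × ℝ → ℝ}
    (hV : ∀ i, ContDiffOn ℝ ∞ (V i) (windowDomain (Ioi T₀))) :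
    ContDiffOn ℝ ∞ (totalEnergy α β V) (endPoints α β ×ˢ Ioi T₀) := by
  unfold totalEnergy pendEnergy
  refine ContDiffOn.sum fun i _ => ?_
  have h1 := contDiffOn_velocity_motionParam (α := α) (β := β) (i := i) (hV i)
  have h2 : ContDiffOn ℝ ∞ (fun q : (Config × Config) × ℝ => Real.cos (q.1.1 i))
    (endPoints α β ×ˢ Ioi T₀) := ContDiff.contDiffOn (by fun_prop)
  exact (((h1.pow 2).div_const 2).sub h2).sub contDiffOn_const

lemma isOpen_motionDomain : IsOpen (endPoints α β ×ˢ Ioi T₀) :=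
  (isOpen_endPoints α β).prod isOpen_Ioi

lemma fderiv_velocity_motionParam {V : ℝ × ℝ × ℝ → ℝ} {i : Fin 4}
    (hV : ContDiffOn ℝ ∞ V (windowDomain (Ioi T₀))) {q : (Config × Config) × ℝ}
    (hq : q ∈ endPoints α β ×ˢ Ioi T₀) :
    HasFDerivAt (fun q : (Config × Config) × ℝ => V (motionParam α β i q.1 q.2))
      ((fderiv ℝ V (motionParam α β i q.1 q.2)) ∘L motionParamLinear i) q := by
  have h1 := ((hV.contDiffAt ((isOpen_windowDomain isOpen_Ioi).mem_nhds
    (motionParam_mem hq.1 hq.2 i))).differentiableAt (by simp)).hasFDerivAt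
  exact HasFDerivAt.comp (f := fun q : (Config × Config) × ℝ => motionParam α β i q.1 q.2) q h1
    (hasFDerivAt_motionParam α β i q)

lemma fderiv_totalEnergy {V : Fin 4 → ℝ × ℝ × ℝ → ℝ}
    (hV : ∀ i, ContDiffOn ℝ ∞ (V i) (windowDomain (Ioi T₀))) {q : (Config × Config) × ℝ}
    (hq : q ∈ endPoints α β ×ˢ Ioi T₀) (u : (Config × Config) × ℝ) :
    fderiv ℝ (totalEnergy α β V) q u = ∑ i, (V i (motionParam α β i q.1 q.2) *
      fderiv ℝ (V i) (motionParam α β i q.1 q.2) (u.1.1 i, u.1.2 i, u.2) +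
      Real.sin (q.1.1 i) * u.1.1 i) := by
  have h : ∀ i, HasFDerivAt (fun q : (Config × Config) × ℝ =>
      pendEnergy (q.1.1 i) (V i (motionParam α β i q.1 q.2)))
      (V i (motionParam α β i q.1 q.2) •
        ((fderiv ℝ (V i) (motionParam α β i q.1 q.2)) ∘L motionParamLinear i) +
        Real.sin (q.1.1 i) • ((EuclideanSpace.proj i : Config →L[ℝ] ℝ) ∘L
          (ContinuousLinearMap.fst ℝ Config Config) ∘L
          (ContinuousLinearMap.fst ℝ (Config × Config) ℝ))) q := fun i => by
    have h1 := fderiv_velocity_motionParam (i := i) (hV i) hq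
    have h2 : HasFDerivAt (fun q : (Config × Config) × ℝ => q.1.1 i)
      ((EuclideanSpace.proj i : Config →L[ℝ] ℝ) ∘L (ContinuousLinearMap.fst ℝ Config Config) ∘L
        (ContinuousLinearMap.fst ℝ (Config × Config) ℝ)) q :=
      ((EuclideanSpace.proj i : Config →L[ℝ] ℝ) ∘L (ContinuousLinearMap.fst ℝ Config Config) ∘L
        (ContinuousLinearMap.fst ℝ (Config × Config) ℝ)).hasFDerivAt
    have h3 := (((h1.pow 2).mul_const (1 / 2 : ℝ)).sub h2.cos).sub_const 1
    have h4 : (fun q : (Config × Config) × ℝ =>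
        pendEnergy (q.1.1 i) (V i (motionParam α β i q.1 q.2))) = fun q =>
        V i (motionParam α β i q.1 q.2) ^ 2 * (1 / 2) - Real.cos (q.1.1 i) - 1 := by
      ext q; rw [pendEnergy]; ring
    rw [h4]
    refine h3.congr_fderiv ?_
    ext <;> simp <;> ring
  have hs := HasFDerivAt.fun_sum (u := Finset.univ) fun i _ => h i
  have : fderiv ℝ (totalEnergy α β V) q = _ := hs.fderiv
  rw [this]
  simp only [sum_apply, add_apply, smul_apply, smul_eq_mul, ContinuousLinearMap.comp_apply,
    motionParamLinear_apply]
  rfl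

lemma fderiv_apply_triple (V : ℝ × ℝ × ℝ → ℝ) (q : ℝ × ℝ × ℝ) (x y s : ℝ) :
    fderiv ℝ V q (x, y, s) = x * fderiv ℝ V q (1, 0, 0) + y * fderiv ℝ V q (0, 1, 0) +
      s * fderiv ℝ V q (0, 0, 1) := by
  have : ((x, y, s) : ℝ × ℝ × ℝ) = x • (1, 0, 0) + y • (0, 1, 0) + s • (0, 0, 1) := by simp
  rw [this, map_add, map_add, map_smul, map_smul, map_smul]
  simp

/-- At total energy one the total energy decreases with the duration, and its derivative controls
the derivatives of the end velocities. -/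
lemma bounds_of_totalEnergy_eq_one (hC : 1 ≤ C) (hT₀ : 16 * C ≤ T₀)
    (hV : ∀ i, IsSwingFamily C T₀ (α i) (β i) (V₀ i) (V₁ i)) {q : (Config × Config) × ℝ}
    (hq : q ∈ endPoints α β ×ˢ Ioi T₀) (h1 : totalEnergy α β V₀ q = 1) :
    fderiv ℝ (totalEnergy α β V₀) q (0, 1) < 0 ∧
    ∀ i, |V₀ i (motionParam α β i q.1 q.2)| ≤ 3 ∧
      pendEnergy (q.1.1 i) (V₀ i (motionParam α β i q.1 q.2)) ≤ 2 ∧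
      |fderiv ℝ (V₀ i) (motionParam α β i q.1 q.2) (0, 0, 1)| ≤
        -(2 * C * fderiv ℝ (totalEnergy α β V₀) q (0, 1)) ∧
      |fderiv ℝ (V₁ i) (motionParam α β i q.1 q.2) (0, 0, 1)| ≤
        -(2 * C * fderiv ℝ (totalEnergy α β V₀) q (0, 1)) := by
  have hm : ∀ i, motionParam α β i q.1 q.2 ∈ windowDomain (Ioi T₀) := motionParam_mem hq.1 hq.2
  have hT : T₀ < q.2 := hq.2
  have hpos : ∀ i, α i + (motionParam α β i q.1 q.2).1 = q.1.1 i := fun i => by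
    simp [motionParam]
  have hdur : ∀ i, (motionParam α β i q.1 q.2).2.2 = q.2 := fun i => rfl
  have hC2 : C / q.2 ^ 2 ≤ 1 / 16 * (1 / q.2) := by
    have : 0 < q.2 := by linarith
    rw [show C / q.2 ^ 2 = C / q.2 * (1 / q.2) by field_simp]
    have h2 : C / q.2 ≤ 1 / 16 := by rw [div_le_iff₀ this]; linarith
    exact mul_le_mul_of_nonneg_right h2 (by positivity)
  have hT1 : 1 / q.2 ≤ 1 / 16 := one_div_le_one_div_of_le (by norm_num) (by linarith)
  have hT1' : 0 < 1 / q.2 := by have : 0 < q.2 := by linarith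
                                positivity
  have hlow : ∀ i, -(1 / 16) ≤ pendEnergy (q.1.1 i) (V₀ i (motionParam α β i q.1 q.2)) := fun i => by
    have := (hV i).energy_ge _ (hm i)
    rw [hpos, hdur] at this
    linarith
  have hE : fderiv ℝ (totalEnergy α β V₀) q (0, 1) = ∑ i, V₀ i (motionParam α β i q.1 q.2) *
      fderiv ℝ (V₀ i) (motionParam α β i q.1 q.2) (0, 0, 1) := by
    rw [fderiv_totalEnergy (fun i => (hV i).contDiffOn₀) hq]
    simp
  set e : Fin 4 → ℝ := fun i => pendEnergy (q.1.1 i) (V₀ i (motionParam α β i q.1 q.2)) with he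
  set d : Fin 4 → ℝ := fun i => V₀ i (motionParam α β i q.1 q.2) *
      fderiv ℝ (V₀ i) (motionParam α β i q.1 q.2) (0, 0, 1) with hd
  have hsum : ∑ i, e i = 1 := h1
  have hdec : ∀ i, d i ≤ -2 * (1 / q.2) * e i + C / q.2 ^ 2 := fun i => by
    have := (hV i).decay _ (hm i)
    rw [hpos, hdur] at this
    refine this.trans (le_of_eq ?_)
    simp only [he]
    ring
  -- the terms `C / T ^ 2` are errors: they are at most `(1 / 16) / T` since `T ≥ 16 C`
  have hET : ∑ i, d i ≤ -(7 / 4) * (1 / q.2) := by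
    calc ∑ i, d i ≤ ∑ i, (-2 * (1 / q.2) * e i + C / q.2 ^ 2) := Finset.sum_le_sum fun i _ => hdec i
      _ = -2 * (1 / q.2) + 4 * (C / q.2 ^ 2) := by
        rw [Finset.sum_add_distrib, ← Finset.mul_sum, hsum]
        simp
      _ ≤ _ := by linarith
  have hnn : ∀ i, 0 ≤ -d i + C / q.2 ^ 2 := fun i => by
    have := (abs_nonneg _).trans ((hV i).boundT₀ _ (hm i))
    rw [hdur] at this
    exact nonneg_of_mul_nonneg_right this (by linarith)
  have hDi : ∀ i, -d i + C / q.2 ^ 2 ≤ -(2 * ∑ i, d i) := fun i => by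
    calc -d i + C / q.2 ^ 2 ≤ ∑ i, (-d i + C / q.2 ^ 2) :=
          Finset.single_le_sum (f := fun i => -d i + C / q.2 ^ 2) (fun j _ => hnn j)
            (Finset.mem_univ i)
      _ = -(∑ i, d i) + 4 * (C / q.2 ^ 2) := by
        rw [Finset.sum_add_distrib, Finset.sum_neg_distrib]
        simp
      _ ≤ _ := by linarith
  have hle : ∀ i, e i ≤ 2 := fun i => by
    have h2 : ∑ j, (e j + 1 / 16) = 5 / 4 := by
      rw [Finset.sum_add_distrib, hsum]; simp; norm_num
    have h3 := Finset.single_le_sum (f := fun j => e j + 1 / 16) (s := Finset.univ)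
      (fun j _ => by linarith [hlow j]) (Finset.mem_univ i)
    simp only [h2] at h3
    linarith
  rw [hE]
  refine ⟨by linarith, fun i => ⟨?_, hle i, ?_, ?_⟩⟩
  · have h2 := hle i
    simp only [he, pendEnergy] at h2
    have h3 : e i ≤ 5 / 4 := by
      have h2 : ∑ j, (e j + 1 / 16) = 5 / 4 := by
        rw [Finset.sum_add_distrib, hsum]; simp; norm_num
      have h3 := Finset.single_le_sum (f := fun j => e j + 1 / 16) (s := Finset.univ)
        (fun j _ => by linarith [hlow j]) (Finset.mem_univ i)
      simp only [h2] at h3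
      linarith
    refine abs_le_of_sq_le_sq ?_ (by norm_num)
    nlinarith [Real.cos_le_one (q.1.1 i)]
  · have := (hV i).boundT₀ _ (hm i)
    rw [hdur] at this
    refine this.trans ?_
    have h2 := mul_le_mul_of_nonneg_left (hDi i) (by linarith : 0 ≤ C)
    refine h2.trans (le_of_eq ?_)
    ring
  · have := (hV i).boundT₁ _ (hm i)
    rw [hdur] at this
    refine this.trans ?_
    have h2 := mul_le_mul_of_nonneg_left (hDi i) (by linarith : 0 ≤ C)
    refine h2.trans (le_of_eq ?_)
    ring

/-- If for all end points the total energy exceeds one for some duration, then the duration can be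
chosen, smoothly, such that the total energy is one. The derivatives of the initial and final
velocities are then bounded by a constant that depends on the families only through `C`. -/
theorem exists_free_motion (hC : 1 ≤ C) (hT₀ : 16 * C ≤ T₀)
    (hV : ∀ i, IsSwingFamily C T₀ (α i) (β i) (V₀ i) (V₁ i))
    (hlow : ∀ p ∈ endPoints α β, ∃ T > T₀, 1 ≤ totalEnergy α β V₀ (p, T)) :
    ∃ T : Config × Config → ℝ, ContDiffOn ℝ ∞ T (endPoints α β) ∧
      (∀ p ∈ endPoints α β, T₀ < T p ∧ totalEnergy α β V₀ (p, T p) = 1) ∧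
      ∀ p ∈ endPoints α β, ∀ i, ∀ u : Config × Config,
        |fderiv ℝ (fun p => V₀ i (motionParam α β i p (T p))) p u| ≤ 100 * C ^ 2 * ‖u‖ ∧
        |fderiv ℝ (fun p => V₁ i (motionParam α β i p (T p))) p u| ≤ 100 * C ^ 2 * ‖u‖ := by
  have hEs := contDiffOn_totalEnergy (α := α) (β := β) fun i => (hV i).contDiffOn₀
  have hEd : ∀ q ∈ endPoints α β ×ˢ Ioi T₀,
      HasFDerivAt (totalEnergy α β V₀) (fderiv ℝ (totalEnergy α β V₀) q) q := fun q hq =>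
    ((hEs.contDiffAt (isOpen_motionDomain.mem_nhds hq)).differentiableAt (by simp)).hasFDerivAt
  have hET : ∀ p ∈ endPoints α β, ∀ t, T₀ < t → HasDerivAt (fun t => totalEnergy α β V₀ (p, t))
      (fderiv ℝ (totalEnergy α β V₀) (p, t) (0, 1)) t := fun p hp t ht =>
    HasFDerivAt.comp_hasDerivAt (l := totalEnergy α β V₀) t (hEd (p, t) ⟨hp, ht⟩)
      ((hasDerivAt_const t p).prodMk (hasDerivAt_id t))
  have hex : ∀ p ∈ endPoints α β, ∃ T > T₀, totalEnergy α β V₀ (p, T) = 1 := by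
    intro p hp
    obtain ⟨T₁, hT₁, h1⟩ := hlow p hp
    choose C' hC' using fun i => (hV i).energy_le
    set M := ∑ i, |C' i| with hM
    have hM0 : 0 ≤ M := Finset.sum_nonneg fun i _ => abs_nonneg _
    set T₂ := max T₁ (M + 1) with hT₂
    have h0 : T₀ < T₂ := lt_of_lt_of_le hT₁ (le_max_left _ _)
    have hM1 : M + 1 ≤ T₂ := le_max_right _ _
    have h2 : totalEnergy α β V₀ (p, T₂) ≤ 1 := by
      calc totalEnergy α β V₀ (p, T₂) ≤ ∑ i, |C' i| / T₂ ^ 2 := by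
            refine Finset.sum_le_sum fun i _ => ?_
            have := hC' i _ (motionParam_mem hp h0 i)
            simp only [motionParam, add_sub_cancel] at this
            refine this.trans ?_
            gcongr
            exact le_abs_self _
        _ = M / T₂ ^ 2 := by rw [← Finset.sum_div]
        _ ≤ 1 := by
          rw [div_le_one (by have : 0 < T₂ := by linarith
                             positivity)]
          nlinarith
    obtain ⟨T, hT, hTe⟩ := intermediate_value_Icc' (le_max_left T₁ (M + 1))
      (f := fun t => totalEnergy α β V₀ (p, t))
      (fun t ht => (hET p hp t (lt_of_lt_of_le hT₁ ht.1)).continuousAt.continuousWithinAt)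
      (show (1 : ℝ) ∈ _ from ⟨h2, h1⟩)
    exact ⟨T, lt_of_lt_of_le hT₁ hT.1, hTe⟩
  choose! T hT hTe using hex
  have hneg : ∀ p ∈ endPoints α β, ∀ t, T₀ < t → totalEnergy α β V₀ (p, t) = 1 →
      fderiv ℝ (totalEnergy α β V₀) (p, t) (0, 1) < 0 := fun p hp t ht h =>
    (bounds_of_totalEnergy_eq_one hC hT₀ hV (q := (p, t)) ⟨hp, ht⟩ h).1
  have hTs : ContDiffOn ℝ ∞ T (endPoints α β) := by
    refine contDiffAt_of_implicit (G := totalEnergy α β V₀) isOpen_motionDomain hEs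
      (isOpen_endPoints α β) (c := fun _ => 1) contDiffOn_const
      (fun p hp => ⟨⟨hp, hT p hp⟩, hTe p hp⟩) (fun p hp t ht h => ?_)
      (fun p hp => (hneg p hp _ (hT p hp) (hTe p hp)).ne)
    exact eq_of_deriv_neg_at_level (hET p hp) (hneg p hp) ht.2 (hT p hp) h (hTe p hp)
  refine ⟨T, hTs, fun p hp => ⟨hT p hp, hTe p hp⟩, fun p hp i u => ?_⟩
  have hq : ((p, T p) : (Config × Config) × ℝ) ∈ endPoints α β ×ˢ Ioi T₀ := ⟨hp, hT p hp⟩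
  have hTd : HasFDerivAt T (fderiv ℝ T p) p :=
    ((hTs.contDiffAt ((isOpen_endPoints α β).mem_nhds hp)).differentiableAt (by simp)).hasFDerivAt
  have hgd : HasFDerivAt (fun p => (p, T p)) ((ContinuousLinearMap.id ℝ (Config × Config)).prod
      (fderiv ℝ T p)) p := (hasFDerivAt_id p).prodMk hTd
  obtain ⟨bneg, hb⟩ := bounds_of_totalEnergy_eq_one hC hT₀ hV hq (hTe p hp)
  set ET := fderiv ℝ (totalEnergy α β V₀) (p, T p) (0, 1) with hETdef
  set τ := fderiv ℝ T p u with hτ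
  have hu0 : ∀ j, |u.1 j| ≤ ‖u‖ := fun j => (abs_apply_le_norm _ j).trans (norm_fst_le u)
  have hu1 : ∀ j, |u.2 j| ≤ ‖u‖ := fun j => (abs_apply_le_norm _ j).trans (norm_snd_le u)
  have hbound : ∀ j, ((|fderiv ℝ (V₀ j) (motionParam α β j p (T p)) (1, 0, 0)| ≤ C ∧
      |fderiv ℝ (V₀ j) (motionParam α β j p (T p)) (0, 1, 0)| ≤ C) ∧
      |fderiv ℝ (V₁ j) (motionParam α β j p (T p)) (1, 0, 0)| ≤ C ∧
      |fderiv ℝ (V₁ j) (motionParam α β j p (T p)) (0, 1, 0)| ≤ C) := fun j =>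
    (hV j).bound _ (motionParam_mem hp (hT p hp) j) (by
      have := (hb j).2.1
      simpa [motionParam] using this)
  have hxy : ∀ (W : ℝ × ℝ × ℝ → ℝ) (z : ℝ × ℝ × ℝ), |fderiv ℝ W z (1, 0, 0)| ≤ C →
      |fderiv ℝ W z (0, 1, 0)| ≤ C → ∀ j,
      |u.1 j * fderiv ℝ W z (1, 0, 0) + u.2 j * fderiv ℝ W z (0, 1, 0)| ≤ 2 * C * ‖u‖ := by
    intro W z h1 h2 j
    refine (abs_add_le _ _).trans ?_
    rw [abs_mul, abs_mul]
    have a1 := mul_le_mul (hu0 j) h1 (abs_nonneg _) (norm_nonneg _)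
    have a2 := mul_le_mul (hu1 j) h2 (abs_nonneg _) (norm_nonneg _)
    linarith
  have hEu : |fderiv ℝ (totalEnergy α β V₀) (p, T p) (u, 0)| ≤ 28 * C * ‖u‖ := by
    rw [fderiv_totalEnergy (fun i => (hV i).contDiffOn₀) hq]
    refine (Finset.abs_sum_le_sum_abs _ _).trans ?_
    calc _ ≤ ∑ _j : Fin 4, 7 * C * ‖u‖ := by
          refine Finset.sum_le_sum fun j _ => ?_
          refine (abs_add_le _ _).trans ?_
          rw [abs_mul, abs_mul, fderiv_apply_triple, zero_mul, add_zero]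
          have a1 := hxy (V₀ j) _ (hbound j).1.1 (hbound j).1.2 j
          have a2 := mul_le_mul (hb j).1 a1 (abs_nonneg _) (by norm_num)
          have a3 := mul_le_mul (Real.abs_sin_le_one (p.1 j)) (hu0 j) (abs_nonneg _) zero_le_one
          have a4 : ‖u‖ ≤ C * ‖u‖ := le_mul_of_one_le_left (norm_nonneg _) hC
          simp only at a2 a3 ⊢
          linarith
      _ = 28 * C * ‖u‖ := by simp; ring
  have himp : fderiv ℝ (totalEnergy α β V₀) (p, T p) (u, 0) + τ * ET = 0 := by
    have h1 := HasFDerivAt.comp (g := totalEnergy α β V₀) p (hEd _ hq) hgd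
    have h2 : (totalEnergy α β V₀ ∘ fun p => (p, T p)) =ᶠ[𝓝 p] fun _ => 1 := by
      filter_upwards [(isOpen_endPoints α β).mem_nhds hp] with p' hp'
      exact hTe p' hp'
    have h3 := h1.fderiv
    rw [h2.fderiv_eq, fderiv_fun_const] at h3
    have h4 := congrArg (fun L => L u) h3
    have h5 : ((u, τ) : (Config × Config) × ℝ) = (u, 0) + τ • (0, 1) := by simp
    have h6 : (0 : ℝ) = fderiv ℝ (totalEnergy α β V₀) (p, T p) (u, τ) := h4
    rw [h5, map_add, map_smul, smul_eq_mul] at h6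
    exact h6.symm
  have hτb : |τ| * (-ET) ≤ 28 * C * ‖u‖ := by
    have : |τ| * (-ET) = |fderiv ℝ (totalEnergy α β V₀) (p, T p) (u, 0)| := by
      rw [← abs_of_neg bneg, ← abs_mul, ← abs_neg]
      congr 1
      linarith
    rw [this]
    exact hEu
  have key : ∀ W : ℝ × ℝ × ℝ → ℝ, ContDiffOn ℝ ∞ W (windowDomain (Ioi T₀)) →
      |fderiv ℝ W (motionParam α β i p (T p)) (1, 0, 0)| ≤ C →
      |fderiv ℝ W (motionParam α β i p (T p)) (0, 1, 0)| ≤ C →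
      |fderiv ℝ W (motionParam α β i p (T p)) (0, 0, 1)| ≤ -(2 * C * ET) →
      |fderiv ℝ (fun p => W (motionParam α β i p (T p))) p u| ≤ 100 * C ^ 2 * ‖u‖ := by
    intro W hW h1 h2 h3
    have h4 := HasFDerivAt.comp (g := fun q : (Config × Config) × ℝ => W (motionParam α β i q.1 q.2))
      p (fderiv_velocity_motionParam hW hq) hgd
    have h5 : fderiv ℝ (fun p => W (motionParam α β i p (T p))) p u =
        fderiv ℝ W (motionParam α β i p (T p)) (u.1 i, u.2 i, τ) :=
      congrArg (fun L => L u) h4.fderiv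
    rw [h5, fderiv_apply_triple]
    refine (abs_add_le _ _).trans ?_
    have a1 := hxy W _ h1 h2 i
    rw [abs_mul τ]
    have a2 := mul_le_mul_of_nonneg_left h3 (abs_nonneg τ)
    have a3 := mul_le_mul_of_nonneg_left hτb (by linarith : 0 ≤ 2 * C)
    have a4 : C * ‖u‖ ≤ C ^ 2 * ‖u‖ := by
      have := norm_nonneg u
      gcongr
      nlinarith
    have a5 : 0 ≤ C ^ 2 * ‖u‖ := by positivity
    linarith
  exact ⟨key _ (hV i).contDiffOn₀ (hbound i).1.1 (hbound i).1.2 (hb i).2.2.1,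
    key _ (hV i).contDiffOn₁ (hbound i).2.1 (hbound i).2.2 (hb i).2.2.2⟩

end Free

/-! ### Comparison of two flows -/

section Compare

variable {E : Type} [NormedAddCommGroup E] [NormedSpace ℝ E] {X Y : E → E} {Φ Ψ : ℝ → E → E}
  {δ : ℝ}

lemma IsFlow.reverse (hΦ : IsFlow X Φ) : IsFlow (fun z => -X z) (fun t => Φ (-t)) where
  zero z := by simpa using hΦ.zero z
  deriv z t := by
    have := (hΦ.deriv z (-t)).scomp t (hasDerivAt_neg t)
    rw [neg_one_smul] at this
    exact this

/-- The field `X` is Lipschitz, and so is its derivative, the latter expressed by second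
differences. -/
structure IsTameField {E : Type} [NormedAddCommGroup E] (X : E → E) : Prop where
  lipschitz : ∀ a b, ‖X a - X b‖ ≤ 2 * ‖a - b‖
  second_difference : ∀ a b c d, ‖X a - X b - (X c - X d)‖ ≤
    2 * ‖a - b - (c - d)‖ + 2 * ‖c - d‖ * (‖a - c‖ + ‖b - d‖)

/-- The difference of the fields `Y` and `X` is small in the Lipschitz norm. -/
structure IsPerturbation {E : Type} [NormedAddCommGroup E] (δ : ℝ) (X Y : E → E) : Prop where
  norm_sub_le : ∀ z, ‖Y z - X z‖ ≤ δ
  lipschitz : ∀ z w, ‖(Y z - X z) - (Y w - X w)‖ ≤ δ * ‖z - w‖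

lemma IsTameField.neg {E : Type} [NormedAddCommGroup E] {X : E → E} (hX : IsTameField X) :
    IsTameField fun z => -X z where
  lipschitz a b := by
    rw [← neg_sub', norm_neg]; exact hX.lipschitz a b
  second_difference a b c d := by
    have := hX.second_difference a b c d
    rwa [← norm_neg, show -(X a - X b - (X c - X d)) = -X a - -X b - (-X c - -X d) by abel] at this

lemma IsPerturbation.neg {E : Type} [NormedAddCommGroup E] {δ : ℝ} {X Y : E → E}
    (h : IsPerturbation δ X Y) :
    IsPerturbation δ (fun z => -X z) fun z => -Y z where
  norm_sub_le z := by
    rw [← neg_sub', norm_neg]; exact h.norm_sub_le z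
  lipschitz z w := by
    have := h.lipschitz z w
    rwa [← norm_neg, show -(Y z - X z - (Y w - X w)) = -Y z - -X z - (-Y w - -X w) by abel] at this

lemma exp_two_le : Real.exp 2 ≤ 8 := by
  have h := Real.exp_one_lt_d9
  have : Real.exp 2 = Real.exp 1 ^ 2 := by rw [← Real.exp_nat_mul]; norm_num
  rw [this]
  nlinarith [Real.exp_pos 1]

lemma exp_three_le : Real.exp 3 ≤ 21 := by
  have h := Real.exp_one_lt_d9
  have : Real.exp 3 = Real.exp 1 ^ 3 := by rw [← Real.exp_nat_mul]; norm_num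
  rw [this]
  calc Real.exp 1 ^ 3 ≤ (2.7182818286 : ℝ) ^ 3 := pow_le_pow_left₀ (Real.exp_pos 1).le h.le 3
    _ ≤ 21 := by norm_num

lemma norm_flow_sub_le (hX : IsTameField X) (hΦ : IsFlow X Φ) {s : ℝ} (hs : s ∈ Icc (0 : ℝ) 1)
    (z w : E) : ‖Φ s z - Φ s w‖ ≤ 8 * ‖z - w‖ := by
  have hd : ∀ t, HasDerivAt (fun t => Φ t z - Φ t w) (X (Φ t z) - X (Φ t w)) t := fun t =>
    (hΦ.deriv z t).sub (hΦ.deriv w t)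
  have := norm_le_gronwallBound_of_norm_deriv_right_le (a := 0) (b := 1) (δ := ‖z - w‖) (K := 2)
    (ε := 0) (fun t _ => (hd t).continuousAt.continuousWithinAt)
    (fun t _ => (hd t).hasDerivWithinAt) (by rw [hΦ.zero, hΦ.zero])
    (fun t _ => by rw [add_zero]; exact hX.lipschitz _ _) s hs
  refine this.trans ?_
  rw [gronwallBound_ε0, sub_zero, mul_comm]
  gcongr
  exact (Real.exp_le_exp.2 (by linarith [hs.2])).trans exp_two_le

/-- Flows of nearby vector fields are close for one unit of time, by Grönwall's inequality. -/
lemma norm_flow_sub_flow_le (hX : IsTameField X) (hXY : IsPerturbation δ X Y) (hΦ : IsFlow X Φ)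
    (hΨ : IsFlow Y Ψ) {s : ℝ} (hs : s ∈ Icc (0 : ℝ) 1) (z : E) : ‖Ψ s z - Φ s z‖ ≤ 4 * δ := by
  have hδ : 0 ≤ δ := (norm_nonneg _).trans (hXY.norm_sub_le z)
  have hd : ∀ t, HasDerivAt (fun t => Ψ t z - Φ t z) (Y (Ψ t z) - X (Φ t z)) t := fun t =>
    (hΨ.deriv z t).sub (hΦ.deriv z t)
  have := norm_le_gronwallBound_of_norm_deriv_right_le (a := 0) (b := 1) (δ := 0) (K := 2)
    (ε := δ) (fun t _ => (hd t).continuousAt.continuousWithinAt)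
    (fun t _ => (hd t).hasDerivWithinAt) (by rw [hΦ.zero, hΨ.zero, sub_self, norm_zero])
    (fun t _ => by
      have h1 := hX.lipschitz (Ψ t z) (Φ t z)
      have h2 := hXY.norm_sub_le (Ψ t z)
      have h3 := norm_add_le (Y (Ψ t z) - X (Ψ t z)) (X (Ψ t z) - X (Φ t z))
      rw [sub_add_sub_cancel] at h3
      linarith) s hs
  refine this.trans ?_
  rw [gronwallBound_of_K_ne_0 two_ne_zero]
  simp only [zero_mul, sub_zero, zero_add]
  have : Real.exp (2 * s) ≤ 8 := (Real.exp_le_exp.2 (by linarith [hs.2])).trans exp_two_le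
  nlinarith

/-- The difference of the flows of nearby vector fields has a small Lipschitz constant. This is again
Grönwall's inequality, for which the fields have to be close in the Lipschitz sense. -/
lemma norm_flow_second_difference_le (hX : IsTameField X) (hXY : IsPerturbation δ X Y)
    (hδ1 : δ ≤ 1) (hΦ : IsFlow X Φ) (hΨ : IsFlow Y Ψ) {s : ℝ} (hs : s ∈ Icc (0 : ℝ) 1) (z w : E) :
    ‖(Ψ s z - Φ s z) - (Ψ s w - Φ s w)‖ ≤ 1000 * δ * ‖z - w‖ := by
  have hδ : 0 ≤ δ := (norm_nonneg _).trans (hXY.norm_sub_le z)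
  have hd : ∀ t, HasDerivAt (fun t => (Ψ t z - Φ t z) - (Ψ t w - Φ t w))
      ((Y (Ψ t z) - X (Φ t z)) - (Y (Ψ t w) - X (Φ t w))) t := fun t =>
    ((hΨ.deriv z t).sub (hΦ.deriv z t)).sub ((hΨ.deriv w t).sub (hΦ.deriv w t))
  have := norm_le_gronwallBound_of_norm_deriv_right_le (a := 0) (b := 1) (δ := 0) (K := 3)
    (ε := 136 * δ * ‖z - w‖) (fun t _ => (hd t).continuousAt.continuousWithinAt)
    (fun t _ => (hd t).hasDerivWithinAt)
    (by simp [hΦ.zero, hΨ.zero])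
    (fun t ht => by
      have ht' := Ico_subset_Icc_self ht
      have h1 := hX.second_difference (Ψ t z) (Ψ t w) (Φ t z) (Φ t w)
      have h2 := hXY.lipschitz (Ψ t z) (Ψ t w)
      have h3 := norm_flow_sub_le hX hΦ ht' z w
      have h4 := norm_flow_sub_flow_le hX hXY hΦ hΨ ht' z
      have h5 := norm_flow_sub_flow_le hX hXY hΦ hΨ ht' w
      have e1 : Ψ t z - Ψ t w - (Φ t z - Φ t w) = Ψ t z - Φ t z - (Ψ t w - Φ t w) := by abel
      have e2 : Y (Ψ t z) - X (Φ t z) - (Y (Ψ t w) - X (Φ t w)) =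
          (X (Ψ t z) - X (Ψ t w) - (X (Φ t z) - X (Φ t w))) +
          (Y (Ψ t z) - X (Ψ t z) - (Y (Ψ t w) - X (Ψ t w))) := by abel
      have h6 : ‖Ψ t z - Ψ t w‖ ≤ ‖Ψ t z - Φ t z - (Ψ t w - Φ t w)‖ + ‖Φ t z - Φ t w‖ := by
        rw [← e1]
        have := norm_add_le (Ψ t z - Ψ t w - (Φ t z - Φ t w)) (Φ t z - Φ t w)
        rwa [sub_add_cancel] at this
      rw [e2]
      refine (norm_add_le _ _).trans ?_
      rw [e1] at h1
      have hu := norm_nonneg (Ψ t z - Φ t z - (Ψ t w - Φ t w))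
      generalize ‖Ψ t z - Φ t z - (Ψ t w - Φ t w)‖ = u at *
      have hzw := norm_nonneg (z - w)
      have k1 : 2 * ‖Φ t z - Φ t w‖ * (‖Ψ t z - Φ t z‖ + ‖Ψ t w - Φ t w‖) ≤
          2 * (8 * ‖z - w‖) * (4 * δ + 4 * δ) := by gcongr
      have k2 : δ * ‖Ψ t z - Ψ t w‖ ≤ δ * (u + 8 * ‖z - w‖) := by
        gcongr; linarith
      have k3 : δ * u ≤ u := mul_le_of_le_one_left hu hδ1
      nlinarith) s hs
  refine this.trans ?_
  rw [gronwallBound_of_K_ne_0 three_ne_zero]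
  simp only [zero_mul, sub_zero, zero_add]
  have h1 : Real.exp (3 * s) ≤ 21 := (Real.exp_le_exp.2 (by linarith [hs.2])).trans exp_three_le
  have h2 : 0 ≤ δ * ‖z - w‖ := by positivity
  nlinarith

/-- Going forward with one flow and back with the other is close to the identity, in the Lipschitz
norm. -/
lemma scattering_bounds (hX : IsTameField X) (hXL : LipschitzWith 2 X) (hXY : IsPerturbation δ X Y)
    (hδ1 : δ ≤ 1) (hΦ : IsFlow X Φ) (hΨ : IsFlow Y Ψ) :
    (∀ z w, ‖Ψ (-1) (Φ 1 z) - z‖ ≤ 4 * δ ∧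
      ‖(Ψ (-1) (Φ 1 z) - z) - (Ψ (-1) (Φ 1 w) - w)‖ ≤ 8000 * δ * ‖z - w‖) ∧
    ∀ z w, ‖Ψ 1 (Φ (-1) z) - z‖ ≤ 4 * δ ∧
      ‖(Ψ 1 (Φ (-1) z) - z) - (Ψ 1 (Φ (-1) w) - w)‖ ≤ 8000 * δ * ‖z - w‖ := by
  have h1 : (1 : ℝ) ∈ Icc (0 : ℝ) 1 := ⟨zero_le_one, le_rfl⟩
  have e1 : ∀ z, Φ (-1) (Φ 1 z) = z := fun z => hΦ.neg_apply hXL 1 z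
  have e2 : ∀ z, Φ 1 (Φ (-1) z) = z := fun z => by
    have := hΦ.neg_apply hXL (-1) z
    rwa [neg_neg] at this
  have hδ : ∀ z : E, 0 ≤ δ := fun z => (norm_nonneg _).trans (hXY.norm_sub_le z)
  refine ⟨fun z w => ?_, fun z w => ?_⟩
  · have a := norm_flow_sub_flow_le hX.neg hXY.neg hΦ.reverse hΨ.reverse h1 (Φ 1 z)
    have b := norm_flow_second_difference_le hX.neg hXY.neg hδ1 hΦ.reverse hΨ.reverse h1 (Φ 1 z)
      (Φ 1 w)
    simp only [e1] at a b
    refine ⟨a, b.trans ?_⟩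
    have c := norm_flow_sub_le hX hΦ h1 z w
    have := mul_le_mul_of_nonneg_left c (hδ z)
    linarith
  · have a := norm_flow_sub_flow_le hX hXY hΦ hΨ h1 (Φ (-1) z)
    have b := norm_flow_second_difference_le hX hXY hδ1 hΦ hΨ h1 (Φ (-1) z) (Φ (-1) w)
    simp only [e2] at a b
    refine ⟨a, b.trans ?_⟩
    have c := norm_flow_sub_le hX.neg hΦ.reverse h1 z w
    have := mul_le_mul_of_nonneg_left c (hδ z)
    linarith

end Compare

/-- A smooth map that is close to the identity on a ball, in the Lipschitz norm, has a smooth right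
inverse on the ball of a quarter of the radius. -/
lemma exists_inverse_near_id {E : Type} [NormedAddCommGroup E] [NormedSpace ℝ E] [CompleteSpace E]
    {g : E → E} {c : E} {ρ : ℝ} (hρ : 0 < ρ) (hg : ContDiffOn ℝ ∞ g (Metric.ball c ρ))
    (hL : ∀ x ∈ Metric.ball c ρ, ∀ y ∈ Metric.ball c ρ,
      ‖(g x - x) - (g y - y)‖ ≤ 1 / 2 * ‖x - y‖) (hc : ‖g c - c‖ ≤ ρ / 8) :
    ∃ k : E → E, ContDiffOn ℝ ∞ k (Metric.ball c (ρ / 4)) ∧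
      ∀ y ∈ Metric.ball c (ρ / 4), k y ∈ Metric.ball c ρ ∧ g (k y) = y := by
  have hA : ApproximatesLinearOn g ((ContinuousLinearEquiv.refl ℝ E : E ≃L[ℝ] E) : E →L[ℝ] E)
      (Metric.ball c ρ) (1 / 2) := by
    rw [ApproximatesLinearOn.approximatesLinearOn_iff_lipschitzOnWith, lipschitzOnWith_iff_norm_sub_le]
    intro x hx y hy
    exact (hL x hx y hy)
  rcases subsingleton_or_nontrivial E with hE | hE
  · refine ⟨fun _ => c, contDiffOn_const, fun y _ => ⟨Metric.mem_ball_self hρ,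
      Subsingleton.elim _ _⟩⟩
  have hnorm : ‖((ContinuousLinearEquiv.refl ℝ E).symm : E →L[ℝ] E)‖₊ = 1 := by
    have : ((ContinuousLinearEquiv.refl ℝ E).symm : E →L[ℝ] E) = ContinuousLinearMap.id ℝ E := rfl
    rw [this]
    exact NNReal.coe_injective ContinuousLinearMap.norm_id
  have hN : (1 / 2 : NNReal) < ‖((ContinuousLinearEquiv.refl ℝ E).symm : E →L[ℝ] E)‖₊⁻¹ := by
    rw [hnorm, inv_one]
    exact NNReal.half_lt_self one_ne_zero
  set φ := hA.toOpenPartialHomeomorph g (Metric.ball c ρ) (Or.inr hN) Metric.isOpen_ball with hφ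
  have hsurj : ∀ y ∈ Metric.ball c (ρ / 4), y ∈ φ.target := by
    intro y hy
    have h1 := hA.surjOn_closedBall_of_nonlinearRightInverse
      (ContinuousLinearEquiv.refl ℝ E).toNonlinearRightInverse (b := c) (ε := 3 / 4 * ρ)
      (by positivity) (Metric.closedBall_subset_ball (by linarith))
    have h2 : ((ContinuousLinearEquiv.refl ℝ E).toNonlinearRightInverse.nnnorm : ℝ) = 1 :=
      congrArg NNReal.toReal hnorm
    rw [h2] at h1
    obtain ⟨x, hx, hxy⟩ := h1 (a := y) (by
      rw [Metric.mem_closedBall]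
      refine (dist_triangle y c (g c)).trans ?_
      have h3 := Metric.mem_ball.1 hy
      rw [dist_eq_norm c, norm_sub_rev]
      push_cast
      linarith)
    exact ⟨x, Metric.closedBall_subset_ball (by linarith) hx, hxy⟩
  refine ⟨φ.symm, fun y hy => ?_, fun y hy => ⟨φ.map_target (hsurj y hy), φ.right_inv (hsurj y hy)⟩⟩
  have hx : φ.symm y ∈ Metric.ball c ρ := φ.map_target (hsurj y hy)
  have hgx : ContDiffAt ℝ ∞ g (φ.symm y) := hg.contDiffAt (Metric.isOpen_ball.mem_nhds hx)
  have hgd := (hgx.differentiableAt (by simp)).hasFDerivAt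
  have hfd : ‖fderiv ℝ g (φ.symm y) - ContinuousLinearMap.id ℝ E‖ ≤ 1 / 2 := by
    have h1 : HasFDerivAt (fun x => g x - x) (fderiv ℝ g (φ.symm y) - ContinuousLinearMap.id ℝ E)
      (φ.symm y) := hgd.sub (hasFDerivAt_id _)
    have h2 : LipschitzOnWith (1 / 2) (fun x => g x - x) (Metric.ball c ρ) := by
      rw [lipschitzOnWith_iff_norm_sub_le]
      intro x hx y hy
      exact (hL x hx y hy)
    have := h1.le_of_lipschitzOn (Metric.isOpen_ball.mem_nhds hx) h2
    simpa using this
  set u := Units.oneSub (ContinuousLinearMap.id ℝ E - fderiv ℝ g (φ.symm y)) (by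
    rw [norm_sub_rev]; linarith) with hu
  have huc : (ContinuousLinearEquiv.ofUnit u : E →L[ℝ] E) = fderiv ℝ g (φ.symm y) := by
    have : (u : E →L[ℝ] E) = 1 - (ContinuousLinearMap.id ℝ E - fderiv ℝ g (φ.symm y)) := rfl
    ext x
    change (u : E →L[ℝ] E) x = _
    rw [this]
    simp
  refine (φ.contDiffAt_symm (f₀' := ContinuousLinearEquiv.ofUnit u) (hsurj y hy) ?_ hgx).contDiffWithinAt
  rw [huc]
  exact hgd

/-! ### The flows of the uncoupled and of the coupled pendula -/

/-- The phase space: positions and velocities. -/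
abbrev Phase : Type := Config × Config

/-- The field of the four uncoupled pendula. -/
def freeField (z : Phase) : Phase := (z.2, WithLp.toLp 2 fun i => -Real.sin (z.1 i))

/-- The field of the four pendula with the coupling potential `P`. -/
def coupledField (P : Config → ℝ) (z : Phase) : Phase :=
  (z.2, WithLp.toLp 2 fun i => -Real.sin (z.1 i) - partialDeriv i P z.1)

/-- The flow of the four uncoupled pendula. -/
def freeFlow (t : ℝ) (z : Phase) : Phase :=
  (WithLp.toLp 2 fun i => (pendFlow t (z.1 i, z.2 i)).1,
    WithLp.toLp 2 fun i => (pendFlow t (z.1 i, z.2 i)).2)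

/-- A coupling potential that is small in the `C²` sense and vanishes wherever two of the pendula are
away from the bottom. -/
structure IsSmallCoupling (δ : ℝ) (P : Config → ℝ) : Prop where
  contDiff : ContDiff ℝ ∞ P
  le_half : ∀ x, P x ≤ 1 / 2
  norm_gradient_le : ∀ x, ‖(WithLp.toLp 2 fun i => partialDeriv i P x : Config)‖ ≤ δ
  norm_gradient_sub_le : ∀ x y, ‖(WithLp.toLp 2 fun i => partialDeriv i P x : Config) -
    WithLp.toLp 2 fun i => partialDeriv i P y‖ ≤ δ * ‖x - y‖
  eq_zero : ∀ x : Config, ∀ i j, i ≠ j → Real.cos (x i) < 999 / 1000 →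
    Real.cos (x j) < 999 / 1000 → P x = 0

lemma hasDerivAt_toLp {f : Fin 4 → ℝ → ℝ} {f' : Fin 4 → ℝ} {t : ℝ}
    (h : ∀ i, HasDerivAt (f i) (f' i) t) :
    HasDerivAt (fun t => (WithLp.toLp 2 fun i => f i t : Config)) (WithLp.toLp 2 f') t := by
  have h1 : HasDerivAt (fun t i => f i t) f' t := hasDerivAt_pi.2 h
  exact (PiLp.continuousLinearEquiv 2 ℝ (fun _ : Fin 4 => ℝ)).symm.hasFDerivAt.comp_hasDerivAt t h1

lemma isFlow_freeFlow : IsFlow freeField freeFlow where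
  zero z := by
    simp only [freeFlow, isFlow_pendFlow.zero]
  deriv z t := by
    have h1 := hasDerivAt_toLp fun i => pendFlow_hasDerivAt_fst (z.1 i, z.2 i) t
    have h2 := hasDerivAt_toLp fun i => pendFlow_hasDerivAt_snd (z.1 i, z.2 i) t
    exact h1.prodMk h2

lemma contDiff_freeField : ContDiff ℝ ∞ freeField := by
  unfold freeField
  refine contDiff_snd.prodMk ?_
  rw [contDiff_piLp]
  intro i
  fun_prop

lemma contDiff_partialDeriv {P : Config → ℝ} (hP : ContDiff ℝ ∞ P) (i : Fin 4) :
    ContDiff ℝ ∞ (partialDeriv i P) :=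
  (hP.fderiv_right (m := ∞) (by norm_num)).clm_apply contDiff_const

lemma contDiff_coupledField {P : Config → ℝ} (hP : ContDiff ℝ ∞ P) :
    ContDiff ℝ ∞ (coupledField P) := by
  unfold coupledField
  refine contDiff_snd.prodMk ?_
  rw [contDiff_piLp]
  intro i
  have h1 : ContDiff ℝ ∞ fun z : Phase => partialDeriv i P z.1 :=
    (contDiff_partialDeriv hP i).comp contDiff_fst
  have h2 : ContDiff ℝ ∞ fun z : Phase => -Real.sin (z.1 i) := by fun_prop
  exact h2.sub h1

lemma abs_sin_second_difference_le (a b c d : ℝ) :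
    |Real.sin a - Real.sin b - (Real.sin c - Real.sin d)| ≤
      |a - b - (c - d)| + |c - d| * (|a - c| + |b - d|) := by
  have h1 : ∀ x y : ℝ, Real.sin x - Real.sin y =
      2 * Real.sin ((x - y) / 2) * Real.cos ((x + y) / 2) := Real.sin_sub_sin
  have h2 := abs_sin_sub_sin_le ((a - b) / 2) ((c - d) / 2)
  have h3 : |Real.cos ((a + b) / 2) - Real.cos ((c + d) / 2)| ≤ |(a + b) / 2 - (c + d) / 2| := by
    have := abs_sin_sub_sin_le (Real.pi / 2 - (a + b) / 2) (Real.pi / 2 - (c + d) / 2)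
    rw [Real.sin_pi_div_two_sub, Real.sin_pi_div_two_sub] at this
    refine this.trans (le_of_eq ?_)
    rw [← abs_neg]; congr 1; ring
  have h4 : |Real.sin ((c - d) / 2)| ≤ |(c - d) / 2| := Real.abs_sin_le_abs
  have h5 := Real.abs_cos_le_one ((a + b) / 2)
  have e1 : |(a - b) / 2 - (c - d) / 2| = |a - b - (c - d)| / 2 := by
    rw [← sub_div, abs_div, abs_two]
  have e2 : |(a + b) / 2 - (c + d) / 2| ≤ (|a - c| + |b - d|) / 2 := by
    rw [← sub_div, abs_div, abs_two]
    gcongr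
    refine le_trans (le_of_eq ?_) (abs_add_le _ _)
    congr 1; ring
  have e3 : |(c - d) / 2| = |c - d| / 2 := by rw [abs_div, abs_two]
  rw [e1] at h2
  rw [e3] at h4
  have e4 : Real.sin a - Real.sin b - (Real.sin c - Real.sin d) =
      2 * ((Real.sin ((a - b) / 2) - Real.sin ((c - d) / 2)) * Real.cos ((a + b) / 2)) +
      2 * (Real.sin ((c - d) / 2) * (Real.cos ((a + b) / 2) - Real.cos ((c + d) / 2))) := by
    rw [h1, h1]; ring
  rw [e4]
  refine (abs_add_le _ _).trans ?_
  rw [abs_mul, abs_mul, abs_mul, abs_mul, abs_two]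
  have k1 := mul_le_mul h2 h5 (abs_nonneg _) (by positivity)
  have k2 := mul_le_mul h4 (h3.trans e2) (abs_nonneg _) (by positivity)
  have k3 : 0 ≤ |c - d| * (|a - c| + |b - d|) := by positivity
  linarith

lemma isTameField_freeField : IsTameField freeField where
  lipschitz a b := by
    rw [Prod.norm_def]
    refine max_le ?_ (norm_le_two_mul fun i => ?_)
    · have : ‖(freeField a - freeField b).1‖ ≤ ‖a - b‖ := norm_snd_le (a - b)
      linarith [norm_nonneg (a - b)]
    · have h1 := abs_sin_sub_sin_le (b.1 i) (a.1 i)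
      have h2 := (abs_apply_le_norm (a - b).1 i).trans (norm_fst_le _)
      have h3 : (freeField a - freeField b).2 i = Real.sin (b.1 i) - Real.sin (a.1 i) := by
        simp [freeField]; ring
      rw [h3]
      rw [abs_sub_comm (b.1 i)] at h1
      exact h1.trans h2
  second_difference a b c d := by
    have h0 : 0 ≤ ‖c - d‖ * (‖a - c‖ + ‖b - d‖) := by positivity
    rw [Prod.norm_def]
    refine max_le ?_ ?_
    · have : ‖(freeField a - freeField b - (freeField c - freeField d)).1‖ ≤
        ‖a - b - (c - d)‖ := norm_snd_le (a - b - (c - d))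
      linarith [norm_nonneg (a - b - (c - d))]
    · rw [mul_assoc, ← mul_add]
      refine norm_le_two_mul fun i => ?_
      have h1 := abs_sin_second_difference_le (a.1 i) (b.1 i) (c.1 i) (d.1 i)
      have h2 := (abs_apply_le_norm (a - b - (c - d)).1 i).trans (norm_fst_le _)
      have h3 := (abs_apply_le_norm (c - d).1 i).trans (norm_fst_le _)
      have h4 := (abs_apply_le_norm (a - c).1 i).trans (norm_fst_le _)
      have h5 := (abs_apply_le_norm (b - d).1 i).trans (norm_fst_le _)
      have h6 : (freeField a - freeField b - (freeField c - freeField d)).2 i =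
          -(Real.sin (a.1 i) - Real.sin (b.1 i) - (Real.sin (c.1 i) - Real.sin (d.1 i))) := by
        simp [freeField]; ring
      rw [h6, abs_neg]
      refine h1.trans ?_
      exact add_le_add h2 (mul_le_mul h3 (add_le_add h4 h5) (by positivity) (norm_nonneg _))

lemma lipschitzWith_freeField : LipschitzWith 2 freeField :=
  LipschitzWith.of_dist_le_mul fun a b => by
    rw [dist_eq_norm, dist_eq_norm]; exact isTameField_freeField.lipschitz a b

section Coupled

variable {δ : ℝ} {P : Config → ℝ}

lemma coupledField_sub_freeField (z : Phase) : coupledField P z - freeField z =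
    (0, -(WithLp.toLp 2 fun i => partialDeriv i P z.1 : Config)) := by
  refine Prod.ext (sub_self _) ?_
  ext i
  simp [coupledField, freeField]
  ring

lemma IsSmallCoupling.isPerturbation (hP : IsSmallCoupling δ P) :
    IsPerturbation δ freeField (coupledField P) where
  norm_sub_le z := by
    rw [coupledField_sub_freeField, Prod.norm_def, norm_zero, norm_neg]
    exact max_le ((norm_nonneg _).trans (hP.norm_gradient_le z.1)) (hP.norm_gradient_le z.1)
  lipschitz z w := by
    have hδ : 0 ≤ δ := (norm_nonneg _).trans (hP.norm_gradient_le z.1)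
    rw [coupledField_sub_freeField, coupledField_sub_freeField, Prod.norm_def]
    refine max_le ?_ ?_
    · simp only [Prod.fst_sub, sub_self, norm_zero]
      positivity
    · have h1 := hP.norm_gradient_sub_le z.1 w.1
      have h2 : ‖z.1 - w.1‖ ≤ ‖z - w‖ := norm_fst_le (z - w)
      simp only [Prod.snd_sub]
      rw [neg_sub_neg, norm_sub_rev]
      exact h1.trans (mul_le_mul_of_nonneg_left h2 hδ)

lemma IsSmallCoupling.lipschitzWith (hP : IsSmallCoupling δ P) (hδ : δ ≤ 1) :
    LipschitzWith 3 (coupledField P) :=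
  LipschitzWith.of_dist_le_mul fun a b => by
    rw [dist_eq_norm, dist_eq_norm]
    have h1 := isTameField_freeField.lipschitz a b
    have h2 := hP.isPerturbation.lipschitz a b
    have h3 := norm_add_le (freeField a - freeField b)
      ((coupledField P a - freeField a) - (coupledField P b - freeField b))
    have h4 : freeField a - freeField b +
      ((coupledField P a - freeField a) - (coupledField P b - freeField b)) =
      coupledField P a - coupledField P b := by abel
    rw [h4] at h3
    have h5 : δ * ‖a - b‖ ≤ ‖a - b‖ := mul_le_of_le_one_left (norm_nonneg _) hδ
    push_cast
    linarith

lemma IsSmallCoupling.partialDeriv_eq_zero (hP : IsSmallCoupling δ P) {x : Config} {i j : Fin 4}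
    (hij : i ≠ j) (hi : Real.cos (x i) < 999 / 1000) (hj : Real.cos (x j) < 999 / 1000)
    (k : Fin 4) : partialDeriv k P x = 0 := by
  have h : P =ᶠ[𝓝 x] fun _ => 0 := by
    have h1 : ∀ᶠ y : Config in 𝓝 x, Real.cos (y i) < 999 / 1000 :=
      ContinuousAt.eventually_lt (Continuous.continuousAt (by fun_prop)) continuousAt_const hi
    have h2 : ∀ᶠ y : Config in 𝓝 x, Real.cos (y j) < 999 / 1000 :=
      ContinuousAt.eventually_lt (Continuous.continuousAt (by fun_prop)) continuousAt_const hj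
    filter_upwards [h1, h2] with y hy1 hy2
    exact hP.eq_zero y i j hij hy1 hy2
  rw [partialDeriv, h.fderiv_eq]
  simp

/-- The function `F` such that `√F ds` is the Jacobi metric of energy one. -/
def conformalFactor (P : Config → ℝ) (x : Config) : ℝ := 5 + ∑ i, Real.cos (x i) - P x

lemma fderiv_apply_eq_sum (f : Config → ℝ) (x v : Config) :
    fderiv ℝ f x v = ∑ i, partialDeriv i f x * v i := by
  have h : v = ∑ i, v i • (EuclideanSpace.single i (1 : ℝ) : Config) := by
    ext j
    simp [Finset.sum_apply, Pi.single_apply]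
  conv_lhs => rw [h]
  simp only [map_sum, map_smul, smul_eq_mul, partialDeriv, mul_comm]

lemma contDiff_conformalFactor (hP : ContDiff ℝ ∞ P) : ContDiff ℝ ∞ (conformalFactor P) := by
  unfold conformalFactor
  fun_prop

lemma partialDeriv_conformalFactor (hP : ContDiff ℝ ∞ P) (x : Config) (k : Fin 4) :
    partialDeriv k (conformalFactor P) x = -Real.sin (x k) - partialDeriv k P x := by
  have h1 : ∀ i, HasFDerivAt (fun y : Config => Real.cos (y i))
      (-Real.sin (x i) • (EuclideanSpace.proj i : Config →L[ℝ] ℝ)) x := fun i =>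
    (EuclideanSpace.proj i : Config →L[ℝ] ℝ).hasFDerivAt.cos
  have h2 := ((HasFDerivAt.fun_sum (u := Finset.univ) fun i _ => h1 i).const_add 5).sub
    (hP.differentiable (by simp)).differentiableAt.hasFDerivAt
  have h3 : fderiv ℝ (conformalFactor P) x = _ := h2.fderiv
  rw [partialDeriv, h3]
  simp [partialDeriv]

lemma coupledField_snd_apply (hP : ContDiff ℝ ∞ P) (z : Phase) (i : Fin 4) :
    (coupledField P z).2 i = partialDeriv i (conformalFactor P) z.1 := by
  rw [partialDeriv_conformalFactor hP]
  rfl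

/-- The energy minus one. -/
def energyDefect (P : Config → ℝ) (z : Phase) : ℝ :=
  (∑ i, z.2 i ^ 2) / 2 - conformalFactor P z.1

lemma energyDefect_flow {Ψ : ℝ → Phase → Phase} (hP : ContDiff ℝ ∞ P)
    (hΨ : IsFlow (coupledField P) Ψ) (t : ℝ) (z : Phase) :
    energyDefect P (Ψ t z) = energyDefect P z := by
  have hd : ∀ t, HasDerivAt (fun t => energyDefect P (Ψ t z)) 0 t := fun t => by
    have h1 := hΨ.deriv z t
    have h2 : HasDerivAt (fun t => conformalFactor P (Ψ t z).1)
        (fderiv ℝ (conformalFactor P) (Ψ t z).1 (coupledField P (Ψ t z)).1) t :=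
      HasFDerivAt.comp_hasDerivAt (l := conformalFactor P) t
        ((contDiff_conformalFactor hP).differentiable (by simp)).differentiableAt.hasFDerivAt h1.fst
    have h3 : ∀ i, HasDerivAt (fun t => (Ψ t z).2 i) ((coupledField P (Ψ t z)).2 i) t := fun i =>
      HasFDerivAt.comp_hasDerivAt (l := fun y : Config => y i) t
        (EuclideanSpace.proj i : Config →L[ℝ] ℝ).hasFDerivAt h1.snd
    have h4 := ((HasDerivAt.fun_sum (u := Finset.univ) fun i _ => (h3 i).pow 2).div_const 2).sub h2
    refine h4.congr_deriv ?_
    rw [fderiv_apply_eq_sum, Finset.sum_div, ← Finset.sum_sub_distrib]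
    refine Finset.sum_eq_zero fun i _ => ?_
    rw [coupledField_snd_apply hP]
    change _ - _ * (Ψ t z).2 i = 0
    push_cast
    ring
  have := is_const_of_deriv_eq_zero (fun t => (hd t).differentiableAt) (fun t => (hd t).deriv) t 0
  simpa [hΨ.zero] using this

/-- If two of the uncoupled pendula are away from the bottom except for the first and the last unit
of time, then the coupling only acts during these two units of time. -/
lemma coupledFlow_eq {Ψ : ℝ → Phase → Phase} (hP : IsSmallCoupling δ P) (hδ : δ ≤ 1)
    (hΨ : IsFlow (coupledField P) Ψ) {z : Phase} {T : ℝ} (hT : 2 ≤ T) {i j : Fin 4} (hij : i ≠ j)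
    (hi : ∀ t ∈ Icc 1 (T - 1), Real.cos ((freeFlow t z).1 i) < 999 / 1000)
    (hj : ∀ t ∈ Icc 1 (T - 1), Real.cos ((freeFlow t z).1 j) < 999 / 1000) :
    Ψ T (Ψ (-1) (freeFlow 1 z)) = Ψ 1 (freeFlow (-1) (freeFlow T z)) ∧
      ∀ t, energyDefect P (Ψ t (Ψ (-1) (freeFlow 1 z))) =
        ∑ k, pendEnergy (z.1 k) (z.2 k) - 1 := by
  have hL := hP.lipschitzWith hδ
  constructor
  · have h1 := hΨ.eq_of_hasDerivWithinAt hL (c := fun t => freeFlow t z) (t₀ := 1) (t₁ := T - 1)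
      (fun t ht => by
        have e : coupledField P (freeFlow t z) = freeField (freeFlow t z) := by
          refine Prod.ext rfl ?_
          ext k
          simp [coupledField, freeField,
            hP.partialDeriv_eq_zero hij (hi t ht) (hj t ht) k]
        rw [e]
        exact (isFlow_freeFlow.deriv z t).hasDerivWithinAt) (right_mem_Icc.2 (by linarith))
    have h2 : freeFlow (-1) (freeFlow T z) = freeFlow (T - 1) z := by
      rw [← isFlow_freeFlow.add lipschitzWith_freeField]
      congr 1; ring
    rw [h2, h1, ← hΨ.add hL, ← hΨ.add hL]
    congr 1; ring
  · intro t
    rw [energyDefect_flow hP.contDiff hΨ, energyDefect_flow hP.contDiff hΨ, energyDefect,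
      conformalFactor, hP.eq_zero _ i j hij (hi 1 ⟨le_rfl, by linarith⟩)
        (hj 1 ⟨le_rfl, by linarith⟩)]
    have h1 : ∀ k, pendEnergy (z.1 k) (z.2 k) =
        ((freeFlow 1 z).2 k) ^ 2 / 2 - Real.cos ((freeFlow 1 z).1 k) - 1 := fun k =>
      (pendEnergy_pendFlow 1 (z.1 k, z.2 k)).symm
    have h2 : ∑ k, pendEnergy (z.1 k) (z.2 k) = (∑ k, ((freeFlow 1 z).2 k) ^ 2) / 2 -
        ∑ k, Real.cos ((freeFlow 1 z).1 k) - 4 := by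
      rw [Finset.sum_congr rfl fun k _ => h1 k, Finset.sum_sub_distrib, Finset.sum_sub_distrib,
        Finset.sum_div]
      simp
    rw [h2]
    ring

end Coupled

/-! ### Geodesics of the Jacobi metric -/

section Geodesic

variable {F : Config → ℝ}

lemma partialDeriv_smul_one (hF : Differentiable ℝ F) (x : Config) (i j l : Fin 4) :
    partialDeriv i (fun y => (F y • (1 : Matrix (Fin 4) (Fin 4) ℝ)) j l) x =
      partialDeriv i F x * (1 : Matrix (Fin 4) (Fin 4) ℝ) j l := by
  simp only [Matrix.smul_apply, smul_eq_mul, partialDeriv]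
  rw [fderiv_mul_const (hF x)]
  simp [mul_comm]

/-- The geodesic acceleration of a conformally flat metric. -/
lemma christoffel_smul_one (hF : Differentiable ℝ F) {x : Config} (hx : F x ≠ 0) (v : Config)
    (k : Fin 4) :
    -∑ i : Fin 4, ∑ j : Fin 4, christoffel (fun y => F y • (1 : Matrix (Fin 4) (Fin 4) ℝ)) k i j x *
      v i * v j = (F x)⁻¹ * (partialDeriv k F x * (∑ i, v i ^ 2) / 2 -
        (∑ i, partialDeriv i F x * v i) * v k) := by
  have hinv : (F x • (1 : Matrix (Fin 4) (Fin 4) ℝ))⁻¹ =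
      (F x)⁻¹ • (1 : Matrix (Fin 4) (Fin 4) ℝ) := by
    refine Matrix.inv_eq_right_inv ?_
    rw [smul_mul_smul_comm, mul_one, mul_inv_cancel₀ hx, one_smul]
  have hc : ∀ i j, christoffel (fun y => F y • (1 : Matrix (Fin 4) (Fin 4) ℝ)) k i j x =
      (F x)⁻¹ / 2 * (partialDeriv i F x * (1 : Matrix (Fin 4) (Fin 4) ℝ) j k +
        partialDeriv j F x * (1 : Matrix (Fin 4) (Fin 4) ℝ) i k -
        partialDeriv k F x * (1 : Matrix (Fin 4) (Fin 4) ℝ) i j) := by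
    intro i j
    simp only [christoffel, hinv, partialDeriv_smul_one hF]
    rw [Finset.sum_eq_single k]
    · simp
      ring
    · intro l _ hl
      simp [Matrix.one_apply_ne hl.symm]
    · simp
  simp only [hc]
  clear hc
  obtain rfl | rfl | rfl | rfl : k = 0 ∨ k = 1 ∨ k = 2 ∨ k = 3 := by omega
  all_goals
    simp [Fin.sum_univ_four]
    ring

/-- A motion with potential energy `-F` and total energy zero becomes a geodesic of the metric
`F ds²` if the time is changed such that the action grows linearly. -/
lemma isGeodesicOn_of_motion (hF : Differentiable ℝ F) {x y : ℝ → Config} {θ : ℝ → ℝ} {L : ℝ}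
    (hpos : ∀ x, 0 < F x) (hx : ∀ t, HasDerivAt x (y t) t)
    (hy : ∀ t, HasDerivAt y (WithLp.toLp 2 fun i => partialDeriv i F (x t)) t)
    (hE : ∀ t, (∑ i, y t i ^ 2) / 2 = F (x t))
    (hθ : ∀ s, HasDerivAt θ (L / F (x (θ s))) s) (I : Set ℝ) :
    IsGeodesicOn (fun y => F y • (1 : Matrix (Fin 4) (Fin 4) ℝ)) (fun s => x (θ s)) I := by
  refine ⟨fun s => (L / F (x (θ s))) • y (θ s), fun s _ => ⟨?_, ?_⟩⟩
  · exact ((hx (θ s)).scomp s (hθ s)).hasDerivWithinAt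
  · have h1 : HasDerivAt (fun s => y (θ s)) _ s := (hy (θ s)).scomp s (hθ s)
    have h2 : HasDerivAt (fun t => F (x t)) (∑ i, partialDeriv i F (x (θ s)) * y (θ s) i) (θ s) := by
      have := HasFDerivAt.comp_hasDerivAt (l := F) (θ s) (hF (x (θ s))).hasFDerivAt (hx (θ s))
      rwa [fderiv_apply_eq_sum] at this
    have h3 : HasDerivAt (fun s => F (x (θ s))) _ s := h2.comp s (hθ s)
    have h4 := (((hasDerivAt_const s L).div h3 (hpos _).ne').smul h1)
    refine HasDerivAt.hasDerivWithinAt (h4.congr_deriv ?_)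
    ext k
    simp only
    rw [christoffel_smul_one hF (hpos _).ne']
    have hp := (hpos (x (θ s))).ne'
    have hEs := hE (θ s)
    have e1 : ∑ i, ((L / F (x (θ s))) • y (θ s)) i ^ 2 =
        (L / F (x (θ s))) ^ 2 * (2 * F (x (θ s))) := by
      rw [← hEs, mul_div_cancel₀ _ two_ne_zero, Finset.mul_sum]
      refine Finset.sum_congr rfl fun i _ => ?_
      simp only [PiLp.smul_apply, smul_eq_mul]
      ring
    have e2 : ∑ i, partialDeriv i F (x (θ s)) * ((L / F (x (θ s))) • y (θ s)) i =
        (L / F (x (θ s))) * ∑ i, partialDeriv i F (x (θ s)) * y (θ s) i := by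
      rw [Finset.mul_sum]
      refine Finset.sum_congr rfl fun i _ => ?_
      simp only [PiLp.smul_apply, smul_eq_mul]
      ring
    rw [e1, e2]
    simp only [PiLp.add_apply, PiLp.smul_apply, smul_eq_mul, Pi.div_apply]
    field_simp
    ring

end Geodesic

/-- The inverse of the antiderivative of a positive function, with smooth dependence on a
parameter. -/
lemma exists_inverse_antiderivative {E : Type} [NormedAddCommGroup E] [NormedSpace ℝ E]
    [CompleteSpace E] {f : E × ℝ → ℝ} (hf : ContDiff ℝ ∞ f) {m : ℝ} (hm : 0 < m)
    (hfm : ∀ q, m ≤ f q) :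
    ∃ θ : E × ℝ → ℝ, ContDiff ℝ ∞ θ ∧ (∀ p t, θ (p, ∫ u in (0 : ℝ)..t, f (p, u)) = t) ∧
      ∀ p s, HasDerivAt (fun s => θ (p, s)) (1 / f (p, θ (p, s))) s := by
  set a : E × ℝ → ℝ := fun q => ∫ u in (0 : ℝ)..q.2, f (q.1, u) with ha
  have has : ContDiff ℝ ∞ a := (contDiff_integral_endpoints hf).comp
    (f := fun q : E × ℝ => (q.1, (0 : ℝ), q.2)) (by fun_prop)
  have hcont : ∀ p, Continuous fun u => f (p, u) := fun p =>
    hf.continuous.comp (Continuous.prodMk_right p)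
  have had : ∀ p t, HasDerivAt (fun t => a (p, t)) (f (p, t)) t := fun p t =>
    intervalIntegral.integral_hasDerivAt_right ((hcont p).intervalIntegrable _ _)
      (hcont p).aestronglyMeasurable.stronglyMeasurableAtFilter (hcont p).continuousAt
  have hmono : ∀ p, StrictMono fun t => a (p, t) := fun p =>
    strictMono_of_deriv_pos fun t => by rw [(had p t).deriv]; exact hm.trans_le (hfm _)
  have hsurj : ∀ p, Function.Surjective fun t => a (p, t) := fun p => by
    have hg : ∀ s t, s ≤ t → m * (t - s) ≤ a (p, t) - a (p, s) := fun s t hst =>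
      Convex.mul_sub_le_image_sub_of_le_deriv convex_univ
        (fun t _ => (had p t).continuousAt.continuousWithinAt)
        (fun t _ => (had p t).differentiableAt.differentiableWithinAt)
        (fun t _ => by rw [(had p t).deriv]; exact hfm _) s (mem_univ _) t (mem_univ _) hst
    have ha0 : a (p, 0) = 0 := by simp [ha]
    refine Continuous.surjective (continuous_iff_continuousAt.2 fun t => (had p t).continuousAt)
      ?_ ?_
    · refine tendsto_atTop_mono' _ ?_ (tendsto_id.const_mul_atTop hm)
      filter_upwards [eventually_ge_atTop 0] with t ht
      have := hg 0 t ht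
      rw [ha0, sub_zero, sub_zero] at this
      exact this
    · refine tendsto_atBot_mono' _ ?_ (tendsto_id.const_mul_atBot hm)
      filter_upwards [eventually_le_atBot 0] with t ht
      have := hg t 0 ht
      rw [ha0] at this
      simp only [id]
      linarith
  choose T hT using hsurj
  simp only at hT
  have hfd : ∀ p t, fderiv ℝ (fun q : (E × ℝ) × ℝ => a (q.1.1, q.2)) (p, t) (0, 1) = f (p.1, t) := by
    intro p t
    have h1 : DifferentiableAt ℝ (fun q : (E × ℝ) × ℝ => a (q.1.1, q.2)) (p, t) :=
      ((has.comp (f := fun q : (E × ℝ) × ℝ => (q.1.1, q.2)) (by fun_prop)).differentiable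
        (by simp)).differentiableAt
    refine fderiv_apply_eq_of_hasDerivAt h1 ?_
    have h2 := (had p.1 (t + 0)).comp_const_add t 0
    rw [add_zero] at h2
    simpa using h2
  have hTs : ContDiff ℝ ∞ fun q : E × ℝ => T q.1 q.2 := by
    rw [← contDiffOn_univ]
    refine contDiffAt_of_implicit (G := fun q : (E × ℝ) × ℝ => a (q.1.1, q.2)) isOpen_univ
      (has.comp (f := fun q : (E × ℝ) × ℝ => (q.1.1, q.2)) (by fun_prop)).contDiffOn isOpen_univ
      (c := Prod.snd) contDiffOn_snd (fun p _ => ⟨mem_univ _, hT p.1 p.2⟩)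
      (fun p _ t _ h => (hmono p.1).injective (h.trans (hT p.1 p.2).symm))
      (fun p _ => by rw [hfd]; exact (hm.trans_le (hfm _)).ne')
  refine ⟨fun q => T q.1 q.2, hTs, fun p t => (hmono p).injective (hT p _), fun p s => ?_⟩
  have h1 : DifferentiableAt ℝ (fun s => T p s) s :=
    ((hTs.comp (f := fun s : ℝ => (p, s)) (by fun_prop)).differentiable (by simp)).differentiableAt
  have h2 := (had p (T p s)).comp s h1.hasDerivAt
  have h3 : (fun t => a (p, t)) ∘ (fun s => T p s) = id := funext fun s => hT p s
  rw [h3] at h2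
  have h4 := h2.unique (hasDerivAt_id s)
  refine h1.hasDerivAt.congr_deriv ?_
  rw [eq_div_iff (hm.trans_le (hfm _)).ne', mul_comm]
  exact h4

/-! ### Geodesics between given end points -/

section Main

variable {C T₀ δ : ℝ} {α β : Fin 4 → ℝ} {V₀ V₁ : Fin 4 → ℝ × ℝ × ℝ → ℝ} {P : Config → ℝ}

lemma half_le_conformalFactor (hP : IsSmallCoupling δ P) (x : Config) :
    1 / 2 ≤ conformalFactor P x := by
  have h1 : ∑ _i : Fin 4, (-1 : ℝ) ≤ ∑ i, Real.cos (x i) :=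
    Finset.sum_le_sum fun i _ => Real.neg_one_le_cos _
  simp at h1
  have := hP.le_half x
  unfold conformalFactor
  linarith

/-- The pair of points with coordinates `α` and `β`. -/
def endCenter (α β : Fin 4 → ℝ) : Config × Config := (WithLp.toLp 2 α, WithLp.toLp 2 β)

lemma ball_subset_endPoints (α β : Fin 4 → ℝ) :
    Metric.ball (endCenter α β) (1 / 10) ⊆ endPoints α β := by
  intro p hp i
  rw [Metric.mem_ball, dist_eq_norm] at hp
  have h1 := (abs_apply_le_norm (p - endCenter α β).1 i).trans (norm_fst_le _)
  have h2 := (abs_apply_le_norm (p - endCenter α β).2 i).trans (norm_snd_le _)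
  exact ⟨lt_of_le_of_lt h1 hp, lt_of_le_of_lt h2 hp⟩

lemma contDiffOn_velocityVector {V : Fin 4 → ℝ × ℝ × ℝ → ℝ}
    (hV : ∀ i, ContDiffOn ℝ ∞ (V i) (windowDomain (Ioi T₀))) {T : Config × Config → ℝ}
    (hT : ContDiffOn ℝ ∞ T (endPoints α β)) (hT₀ : ∀ p ∈ endPoints α β, T₀ < T p) (i : Fin 4) :
    ContDiffOn ℝ ∞ (fun p => V i (motionParam α β i p (T p))) (endPoints α β) :=
  (contDiffOn_velocity_motionParam (hV i)).comp (contDiffOn_id.prodMk hT)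
    fun p hp => ⟨hp, hT₀ p hp⟩

lemma norm_velocityVector_sub_le {v : Config × Config → Config} {K : ℝ}
    (hv : ∀ i, ContDiffOn ℝ ∞ (fun p => v p i) (endPoints α β)) (hK : 0 ≤ K)
    (hd : ∀ p ∈ endPoints α β, ∀ i, ∀ u, |fderiv ℝ (fun p => v p i) p u| ≤ K * ‖u‖)
    {x y : Config × Config} (hx : x ∈ Metric.ball (endCenter α β) (1 / 10))
    (hy : y ∈ Metric.ball (endCenter α β) (1 / 10)) : ‖v x - v y‖ ≤ 2 * K * ‖x - y‖ := by
  rw [mul_assoc]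
  refine norm_le_two_mul fun i => ?_
  have := (convex_ball (endCenter α β) (1 / 10)).norm_image_sub_le_of_norm_fderiv_le (𝕜 := ℝ)
    (f := fun p => v p i) (C := K) (fun p hp => ((hv i).contDiffAt
      ((isOpen_endPoints α β).mem_nhds (ball_subset_endPoints α β hp))).differentiableAt (by simp))
    (fun p hp => ContinuousLinearMap.opNorm_le_bound _ hK
      (hd p (ball_subset_endPoints α β hp) i)) hy hx
  exact this

/-- Between end points near given centres there are geodesics that depend smoothly on the end
points, if the uncoupled pendula have suitable families of motions. -/
theorem exists_geodesics (hC : 1 ≤ C) (hT₀ : 16 * C ≤ T₀)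
    (hV : ∀ i, IsSwingFamily C T₀ (α i) (β i) (V₀ i) (V₁ i))
    (hlow : ∀ p ∈ endPoints α β, ∃ T > T₀, 1 ≤ totalEnergy α β V₀ (p, T))
    {i₁ i₂ : Fin 4} (hi : i₁ ≠ i₂) (h₁ : StaysAway T₀ (α i₁) (V₀ i₁))
    (h₂ : StaysAway T₀ (α i₂) (V₀ i₂)) (hP : IsSmallCoupling δ P)
    (hδ : 10000000 * (C ^ 2 * δ) ≤ 1) :
    ∃ γ : Config × Config × ℝ → Config,
      ContDiffOn ℝ ∞ γ {q | (q.1, q.2.1) ∈ Metric.ball (endCenter α β) (1 / 40)} ∧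
      ∀ p ∈ Metric.ball (endCenter α β) (1 / 40),
        IsGeodesicOn (fun y => conformalFactor P y • (1 : Matrix (Fin 4) (Fin 4) ℝ))
          (fun t => γ (p.1, p.2, t)) (Icc 0 1) ∧ γ (p.1, p.2, 0) = p.1 ∧ γ (p.1, p.2, 1) = p.2 := by
  have hδ0 : 0 ≤ δ := (norm_nonneg _).trans (hP.norm_gradient_le 0)
  have hδ1 : 10000000 * δ ≤ 1 := by
    nlinarith [mul_le_mul_of_nonneg_right (one_le_pow₀ hC (n := 2)) hδ0]
  obtain ⟨T, hTs, hT, hbound⟩ := exists_free_motion hC hT₀ hV hlow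
  set v₀ : Config × Config → Config := fun p => WithLp.toLp 2 fun i =>
    V₀ i (motionParam α β i p (T p)) with hv₀
  set v₁ : Config × Config → Config := fun p => WithLp.toLp 2 fun i =>
    V₁ i (motionParam α β i p (T p)) with hv₁
  have hv₀s : ∀ i, ContDiffOn ℝ ∞ (fun p => v₀ p i) (endPoints α β) :=
    contDiffOn_velocityVector (fun i => (hV i).contDiffOn₀) hTs fun p hp => (hT p hp).1
  have hv₁s : ∀ i, ContDiffOn ℝ ∞ (fun p => v₁ p i) (endPoints α β) :=
    contDiffOn_velocityVector (fun i => (hV i).contDiffOn₁) hTs fun p hp => (hT p hp).1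
  have hv₀l := fun (x y : Config × Config) hx hy => norm_velocityVector_sub_le (x := x) (y := y)
    hv₀s (by positivity) (fun p hp i u => (hbound p hp i u).1) hx hy
  have hv₁l := fun (x y : Config × Config) hx hy => norm_velocityVector_sub_le (x := x) (y := y)
    hv₁s (by positivity) (fun p hp i u => (hbound p hp i u).2) hx hy
  set z₀ : Config × Config → Phase := fun p => (p.1, v₀ p) with hz₀
  set z₁ : Config × Config → Phase := fun p => (p.2, v₁ p) with hz₁
  have hz₀s : ContDiffOn ℝ ∞ z₀ (endPoints α β) :=
    contDiffOn_fst.prodMk ((contDiffOn_piLp 2).2 hv₀s)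
  have hz₁s : ContDiffOn ℝ ∞ z₁ (endPoints α β) :=
    contDiffOn_snd.prodMk ((contDiffOn_piLp 2).2 hv₁s)
  have hK : (1 : ℝ) ≤ 200 * C ^ 2 := by nlinarith
  have hz₀l : ∀ x ∈ Metric.ball (endCenter α β) (1 / 10), ∀ y ∈ Metric.ball (endCenter α β) (1 / 10),
      ‖z₀ x - z₀ y‖ ≤ 200 * C ^ 2 * ‖x - y‖ := fun x hx y hy => by
    rw [Prod.norm_def]
    refine max_le ?_ ((hv₀l x y hx hy).trans (le_of_eq (by ring)))
    exact (norm_fst_le (x - y)).trans (le_mul_of_one_le_left (norm_nonneg _) hK)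
  have hz₁l : ∀ x ∈ Metric.ball (endCenter α β) (1 / 10), ∀ y ∈ Metric.ball (endCenter α β) (1 / 10),
      ‖z₁ x - z₁ y‖ ≤ 200 * C ^ 2 * ‖x - y‖ := fun x hx y hy => by
    rw [Prod.norm_def]
    refine max_le ?_ ((hv₁l x y hx hy).trans (le_of_eq (by ring)))
    exact (norm_snd_le (x - y)).trans (le_mul_of_one_le_left (norm_nonneg _) hK)
  have hL := hP.lipschitzWith (by linarith)
  have hXs := contDiff_coupledField hP.contDiff
  obtain ⟨Ψ, hΨ⟩ := exists_isFlow hL (hXs.of_le (by norm_num))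
  have hΨs := hΨ.contDiff hL hXs
  have hΦs := isFlow_freeFlow.contDiff lipschitzWith_freeField contDiff_freeField
  have hΨ1 : ∀ t, ContDiff ℝ ∞ (Ψ t) := fun t =>
    hΨs.comp (f := fun z : Phase => (t, z)) (by fun_prop)
  have hΦ1 : ∀ t, ContDiff ℝ ∞ (freeFlow t) := fun t =>
    hΦs.comp (f := fun z : Phase => (t, z)) (by fun_prop)
  obtain ⟨hB, hB'⟩ := scattering_bounds isTameField_freeField lipschitzWith_freeField
    hP.isPerturbation (by linarith) isFlow_freeFlow hΨ
  -- the initial state of the coupled motion: one unit of time along the uncoupled motion, and back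
  -- along the coupled flow
  set w : Config × Config → Phase := fun p => Ψ (-1) (freeFlow 1 (z₀ p)) with hw
  have hws : ContDiffOn ℝ ∞ w (endPoints α β) :=
    ((hΨ1 (-1)).comp (hΦ1 1)).comp_contDiffOn hz₀s
  -- the end points of the coupled motion that has the same middle part as the uncoupled one
  set g : Config × Config → Config × Config := fun p =>
    ((w p).1, (Ψ 1 (freeFlow (-1) (z₁ p))).1) with hg
  have hgs : ContDiffOn ℝ ∞ g (endPoints α β) :=
    (contDiff_fst.comp_contDiffOn hws).prodMk
      (contDiff_fst.comp_contDiffOn (((hΨ1 1).comp (hΦ1 (-1))).comp_contDiffOn hz₁s))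
  have hsmall : 8000 * δ * (200 * C ^ 2) ≤ 1 / 2 := by linarith
  have hcontr : ∀ a b u : ℝ, 0 ≤ u → a ≤ 8000 * δ * b → b ≤ 200 * C ^ 2 * u → a ≤ 1 / 2 * u :=
    fun a b u hu hab hbu => by
      have h1 := mul_le_mul_of_nonneg_left hbu (by positivity : 0 ≤ 8000 * δ)
      have h2 := mul_le_mul_of_nonneg_right hsmall hu
      linarith
  obtain ⟨k, hks, hk⟩ := exists_inverse_near_id (g := g) (c := endCenter α β) (ρ := 1 / 10)
    (by norm_num) (hgs.mono (ball_subset_endPoints α β))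
    (fun x hx y hy => by
      rw [Prod.norm_def]
      refine max_le ?_ ?_
      · refine (norm_fst_le ((w x - z₀ x) - (w y - z₀ y))).trans ?_
        exact hcontr _ _ _ (norm_nonneg _) (hB (z₀ x) (z₀ y)).2 (hz₀l x hx y hy)
      · refine (norm_fst_le ((Ψ 1 (freeFlow (-1) (z₁ x)) - z₁ x) -
          (Ψ 1 (freeFlow (-1) (z₁ y)) - z₁ y))).trans ?_
        exact hcontr _ _ _ (norm_nonneg _) (hB' (z₁ x) (z₁ y)).2 (hz₁l x hx y hy))
    (by
      rw [Prod.norm_def]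
      refine max_le ?_ ?_
      · refine (norm_fst_le (w (endCenter α β) - z₀ (endCenter α β))).trans
          ((hB (z₀ (endCenter α β)) 0).1.trans ?_)
        linarith
      · refine (norm_fst_le (Ψ 1 (freeFlow (-1) (z₁ (endCenter α β))) -
          z₁ (endCenter α β))).trans ((hB' (z₁ (endCenter α β)) 0).1.trans ?_)
        linarith)
  rw [show (1 : ℝ) / 10 / 4 = 1 / 40 by norm_num] at hks hk
  set f : Phase × ℝ → ℝ := fun q => conformalFactor P (Ψ q.2 q.1).1 with hf
  have hFs := contDiff_conformalFactor hP.contDiff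
  have hfs : ContDiff ℝ ∞ f := hFs.comp (contDiff_fst.comp
    (hΨs.comp (f := fun q : Phase × ℝ => (q.2, q.1)) (by fun_prop)))
  obtain ⟨θ, hθs, hθ, hθd⟩ := exists_inverse_antiderivative hfs (m := 1 / 2) (by norm_num)
    fun q => half_le_conformalFactor hP _
  -- the conformal factor integrated along the motion is the parameter of the geodesic, and `θ`
  -- expresses time in terms of it
  set len : Config × Config → ℝ := fun p => ∫ u in (0 : ℝ)..T p, f (w p, u) with hlen
  have hlens : ContDiffOn ℝ ∞ len (endPoints α β) :=
    (contDiff_integral_endpoints hfs).comp_contDiffOn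
      (hws.prodMk (contDiffOn_const.prodMk hTs) : ContDiffOn ℝ ∞ (fun p => (w p, (0 : ℝ), T p)) _)
  set γ : Config × Config × ℝ → Config := fun q =>
    (Ψ (θ (w (k (q.1, q.2.1)), q.2.2 * len (k (q.1, q.2.1)))) (w (k (q.1, q.2.1)))).1 with hγ
  have hkmem : ∀ p ∈ Metric.ball (endCenter α β) (1 / 40), k p ∈ endPoints α β := fun p hp =>
    ball_subset_endPoints α β (hk p hp).1
  refine ⟨γ, ?_, fun p hp => ?_⟩
  · have e1 : ContDiffOn ℝ ∞ (fun q : Config × Config × ℝ => k (q.1, q.2.1))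
        {q | (q.1, q.2.1) ∈ Metric.ball (endCenter α β) (1 / 40)} :=
      hks.comp (f := fun q : Config × Config × ℝ => (q.1, q.2.1))
        (ContDiff.contDiffOn (by fun_prop)) fun q hq => hq
    have e2 := hws.comp e1 fun q hq => hkmem _ hq
    have e3 := hlens.comp e1 fun q hq => hkmem _ hq
    have e4 : ContDiffOn ℝ ∞ (fun q : Config × Config × ℝ => q.2.2)
        {q | (q.1, q.2.1) ∈ Metric.ball (endCenter α β) (1 / 40)} :=
      ContDiff.contDiffOn (by fun_prop)
    have e5 := hθs.comp_contDiffOn (e2.prodMk (e4.mul e3))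
    have e6 := hΨs.comp_contDiffOn (e5.prodMk e2)
    exact contDiff_fst.comp_contDiffOn e6
  · have hm := hkmem p hp
    have hgk := (hk p hp).2
    obtain ⟨hT1, hE1⟩ := hT _ hm
    have hz : freeFlow (T (k p)) (z₀ (k p)) = z₁ (k p) := by
      have h1 : ∀ i, pendFlow (T (k p)) ((k p).1 i, v₀ (k p) i) = ((k p).2 i, v₁ (k p) i) :=
          fun i => by
        have := (hV i).flow _ (motionParam_mem hm hT1 i)
        simp only [motionParam, add_sub_cancel] at this
        exact this
      refine Prod.ext ?_ ?_
      · ext i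
        exact congrArg Prod.fst (h1 i)
      · ext i
        exact congrArg Prod.snd (h1 i)
    have haway : ∀ i, StaysAway T₀ (α i) (V₀ i) → ∀ t ∈ Icc 1 (T (k p) - 1),
        Real.cos ((freeFlow t (z₀ (k p))).1 i) < 999 / 1000 := fun i hi t ht => by
      have := hi _ (motionParam_mem hm hT1 i) t ht
      simp only [motionParam, add_sub_cancel] at this
      exact this
    obtain ⟨m1, m2⟩ := coupledFlow_eq hP (by linarith) hΨ (z := z₀ (k p)) (by linarith) hi
      (haway i₁ h₁) (haway i₂ h₂)
    rw [hz] at m1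
    have hdef : ∀ t, energyDefect P (Ψ t (w (k p))) = 0 := fun t => by
      rw [m2 t]
      have : ∑ i, pendEnergy ((z₀ (k p)).1 i) ((z₀ (k p)).2 i) = 1 := hE1
      rw [this, sub_self]
    refine ⟨?_, ?_, ?_⟩
    · refine isGeodesicOn_of_motion (hFs.differentiable (by simp)) (x := fun t => (Ψ t (w (k p))).1)
        (y := fun t => (Ψ t (w (k p))).2) (θ := fun s => θ (w (k p), s * len (k p)))
        (L := len (k p)) (fun x => lt_of_lt_of_le (by norm_num) (half_le_conformalFactor hP x))
        (fun t => (hΨ.deriv (w (k p)) t).fst) (fun t => ?_) (fun t => ?_) (fun s => ?_) _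
      · have h1 : HasDerivAt (fun t => (Ψ t (w (k p))).2) (coupledField P (Ψ t (w (k p)))).2 t :=
          (hΨ.deriv (w (k p)) t).snd
        have h2 : (coupledField P (Ψ t (w (k p)))).2 =
            WithLp.toLp 2 fun i => partialDeriv i (conformalFactor P) (Ψ t (w (k p))).1 := by
          ext i
          exact coupledField_snd_apply hP.contDiff _ i
        exact h1.congr_deriv h2
      · have := hdef t
        rw [energyDefect, sub_eq_zero] at this
        exact this
      · have h1 := (hθd (w (k p)) (s * len (k p))).comp s ((hasDerivAt_id s).mul_const (len (k p)))
        refine h1.congr_deriv ?_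
        rw [one_mul, one_div_mul_eq_div]
    · have h0 := hθ (w (k p)) 0
      rw [intervalIntegral.integral_same] at h0
      simp only [hγ, zero_mul, h0, hΨ.zero]
      have h1 : (g (k p)).1 = p.1 := congrArg Prod.fst hgk
      exact h1
    · have h1 : θ (w (k p), len (k p)) = T (k p) := hθ (w (k p)) (T (k p))
      simp only [hγ, one_mul, h1]
      have h2 : (g (k p)).2 = p.2 := congrArg Prod.snd hgk
      exact (congrArg Prod.fst m1).trans h2

end Main

/-! ### The localized coupling is small -/

/-- The vector `2 π n`. -/
def latticePoint (n : Fin 3 → ℤ) : EuclideanSpace ℝ (Fin 3) :=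
  WithLp.toLp 2 fun i => 2 * Real.pi * (n i : ℝ)

lemma eq_of_norm_sub_latticePoint_lt {x : EuclideanSpace ℝ (Fin 3)} {n m : Fin 3 → ℤ}
    (hn : ‖x - latticePoint n‖ < 2) (hm : ‖x - latticePoint m‖ < 2) : n = m := by
  by_contra hne
  obtain ⟨i, hi⟩ := Function.ne_iff.1 hne
  have h1 : ‖latticePoint n - latticePoint m‖ < 4 := by
    have := norm_sub_le (x - latticePoint m) (x - latticePoint n)
    rw [sub_sub_sub_cancel_left] at this
    linarith
  have h2 : ‖(latticePoint n - latticePoint m) i‖ ≤ ‖latticePoint n - latticePoint m‖ :=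
    PiLp.norm_apply_le _ i
  have h3 : (latticePoint n - latticePoint m) i = 2 * Real.pi * ((n i - m i : ℤ) : ℝ) := by
    simp [latticePoint]; ring
  have h4 : (1 : ℝ) ≤ |((n i - m i : ℤ) : ℝ)| := by
    rw [← Int.cast_abs]
    exact_mod_cast Int.one_le_abs (sub_ne_zero.2 hi)
  rw [h3, Real.norm_eq_abs, abs_mul, abs_of_pos Real.two_pi_pos] at h2
  nlinarith [Real.pi_gt_three]

section Coupling

variable {η : ℝ → ℝ} {r ε : ℝ}

lemma IsBumpProfile.eq_zero_of_le (hη : IsBumpProfile η) (hε : 0 < ε) {s : ℝ} (hs : ε ≤ s) :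
    η (s / ε) = 0 := hη.zero _ ((one_le_div hε).2 hs)

/-- At most one term of the sum over the lattice is different from zero on a given unit ball. -/
lemma exists_coupling_eq (hη : IsBumpProfile η) (hε : 0 < ε) (hε1 : ε < 1)
    (x₀ : EuclideanSpace ℝ (Fin 3)) : ∃ n, ∀ x ∈ Metric.ball x₀ 1,
      coupling η r ε x = ε ^ r * η ‖ε⁻¹ • (x - latticePoint n)‖ := by
  obtain ⟨n, hn⟩ : ∃ n, ∀ m, m ≠ n → 2 ≤ ‖x₀ - latticePoint m‖ := by
    by_cases h : ∃ n, ‖x₀ - latticePoint n‖ < 2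
    · obtain ⟨n, hn⟩ := h
      refine ⟨n, fun m hm => ?_⟩
      by_contra! hlt
      exact hm (eq_of_norm_sub_latticePoint_lt hlt hn)
    · push Not at h
      exact ⟨0, fun m _ => h m⟩
  refine ⟨n, fun x hx => ?_⟩
  rw [coupling, tsum_eq_single n]
  · rw [norm_smul, norm_inv, Real.norm_of_nonneg hε.le, inv_mul_eq_div]
    rfl
  · intro m hm
    refine hη.eq_zero_of_le hε ?_
    have h1 := hn m hm
    have h2 := norm_sub_le_norm_sub_add_norm_sub x₀ x (latticePoint m)
    rw [Metric.mem_ball, dist_comm, dist_eq_norm] at hx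
    change ε ≤ ‖x - latticePoint m‖
    linarith

lemma exists_norm_fderiv_le {E F : Type*} [NormedAddCommGroup E] [NormedSpace ℝ E]
    [NormedAddCommGroup F] [NormedSpace ℝ F] {b : E → F} (hs : ContDiff ℝ ∞ b)
    (hc : HasCompactSupport b) : ∃ M, ∀ y, ‖fderiv ℝ b y‖ ≤ M :=
  (hc.fderiv ℝ).exists_bound_of_continuous (hs.continuous_fderiv (by simp))

lemma exists_norm_bounds {E : Type*} [NormedAddCommGroup E] [NormedSpace ℝ E] {b : E → ℝ}
    (hs : ContDiff ℝ ∞ b) (hc : HasCompactSupport b) :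
    ∃ M : ℝ, 0 < M ∧ ∀ y, |b y| ≤ M ∧ ‖fderiv ℝ b y‖ ≤ M ∧ ‖fderiv ℝ (fderiv ℝ b) y‖ ≤ M := by
  have hs1 : ContDiff ℝ ∞ (fderiv ℝ b) := hs.fderiv_right (m := ∞) (by norm_num)
  have hc1 : HasCompactSupport (fderiv ℝ b) := hc.fderiv ℝ
  obtain ⟨M₀, h₀⟩ := hc.exists_bound_of_continuous hs.continuous
  obtain ⟨M₁, h₁⟩ := exists_norm_fderiv_le hs hc
  obtain ⟨M₂, h₂⟩ := exists_norm_fderiv_le hs1 hc1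
  refine ⟨max (max M₀ M₁) (max M₂ 1), by simp, fun y => ⟨?_, ?_, ?_⟩⟩
  · exact (h₀ y).trans ((le_max_left _ _).trans (le_max_left _ _))
  · exact (h₁ y).trans ((le_max_right _ _).trans (le_max_left _ _))
  · exact (h₂ y).trans ((le_max_left _ _).trans (le_max_right _ _))

lemma abs_fderiv_fderiv_le {E : Type*} [NormedAddCommGroup E] [NormedSpace ℝ E] {b : E → ℝ}
    (hs : ContDiff ℝ ∞ b) {M : ℝ} {y : E} (h : ‖fderiv ℝ (fderiv ℝ b) y‖ ≤ M) (u v : E) :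
    |fderiv ℝ (fun y => fderiv ℝ b y u) y v| ≤ M * ‖u‖ * ‖v‖ := by
  have hs1 : Differentiable ℝ (fderiv ℝ b) :=
    (hs.fderiv_right (m := ∞) (by norm_num)).differentiable (by simp)
  have h3 : fderiv ℝ (fun y => fderiv ℝ b y u) y v = fderiv ℝ (fderiv ℝ b) y v u := by
    rw [fderiv_clm_apply (hs1 y) (differentiableAt_const u)]
    simp
  rw [h3, ← Real.norm_eq_abs]
  calc _ ≤ M * ‖v‖ * ‖u‖ := (fderiv ℝ (fderiv ℝ b) y v).le_of_opNorm_le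
        ((fderiv ℝ (fderiv ℝ b) y).le_of_opNorm_le h v) u
    _ = _ := by ring

lemma exists_derivative_bound {E : Type*} [NormedAddCommGroup E] [NormedSpace ℝ E] {b : E → ℝ}
    (hs : ContDiff ℝ ∞ b) (hc : HasCompactSupport b) :
    ∃ M : ℝ, 0 < M ∧ ∀ y, b y ≤ M ∧ -M ≤ b y ∧ ∀ u, |fderiv ℝ b y u| ≤ M * ‖u‖ ∧
      ∀ v, |fderiv ℝ (fun y => fderiv ℝ b y u) y v| ≤ M * ‖u‖ * ‖v‖ := by
  obtain ⟨M, hM, h⟩ := exists_norm_bounds hs hc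
  refine ⟨M, hM, fun y => ⟨(abs_le.1 (h y).1).2, (abs_le.1 (h y).1).1, fun u => ⟨?_, fun v => ?_⟩⟩⟩
  · exact (fderiv ℝ b y).le_of_opNorm_le (h y).2.1 u
  · exact abs_fderiv_fderiv_le hs (h y).2.2 u v

/-- The derivatives of a bump function are bounded. -/
lemma IsBumpProfile.exists_bound (hη : IsBumpProfile η) :
    ∃ M : ℝ, 0 < M ∧ ∀ y : EuclideanSpace ℝ (Fin 3), η ‖y‖ ≤ M ∧ -M ≤ η ‖y‖ ∧
      ∀ u, |fderiv ℝ (fun y : EuclideanSpace ℝ (Fin 3) => η ‖y‖) y u| ≤ M * ‖u‖ ∧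
        ∀ v, |fderiv ℝ (fun y => fderiv ℝ (fun y : EuclideanSpace ℝ (Fin 3) => η ‖y‖) y u) y v| ≤
          M * ‖u‖ * ‖v‖ :=
  exists_derivative_bound hη.smooth
    (HasCompactSupport.intro (isCompact_closedBall 0 1) fun x hx => by
      rw [mem_closedBall_zero_iff, not_le] at hx
      exact hη.zero _ hx.le)

/-- The coordinates with the indices `i - 1`, `i`, `i + 1`. -/
def neighbours (i : Fin 4) : Config →L[ℝ] EuclideanSpace ℝ (Fin 3) :=
  LinearMap.toContinuousLinearMap
    { toFun := fun x => !₂[x (i - 1), x i, x (i + 1)]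
      map_add' := fun x y => by ext j; fin_cases j <;> simp
      map_smul' := fun c x => by ext j; fin_cases j <;> simp }

lemma neighbours_apply (i : Fin 4) (x : Config) :
    neighbours i x = !₂[x (i - 1), x i, x (i + 1)] := rfl

lemma norm_neighbours_le (i : Fin 4) (x : Config) : ‖neighbours i x‖ ≤ 2 * ‖x‖ := by
  rw [neighbours_apply, EuclideanSpace.norm_eq]
  refine Real.sqrt_le_iff.2 ⟨by positivity, ?_⟩
  have h : ∀ j, x j ^ 2 ≤ ‖x‖ ^ 2 := fun j => sq_le_sq.2 (by
    rw [abs_norm]; exact abs_apply_le_norm x j)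
  simp [Fin.sum_univ_three]
  nlinarith [h (i - 1), h i, h (i + 1), sq_nonneg ‖x‖]

/-- One term of the coupling potential. -/
def couplingTerm (η : ℝ → ℝ) (r ε : ℝ) (i : Fin 4) (x : Config) : ℝ :=
  coupling η r ε (neighbours i x)

lemma exists_couplingTerm_eq (hη : IsBumpProfile η) (hε : 0 < ε) (hε1 : ε < 1) (i : Fin 4)
    (x₀ : Config) : ∃ n, couplingTerm η r ε i =ᶠ[𝓝 x₀] fun x =>
      ε ^ r * η ‖ε⁻¹ • (neighbours i x - latticePoint n)‖ := by
  obtain ⟨n, hn⟩ := exists_coupling_eq (r := r) hη hε hε1 (neighbours i x₀)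
  refine ⟨n, ?_⟩
  filter_upwards [(neighbours i).continuous.continuousAt.preimage_mem_nhds
    (Metric.ball_mem_nhds (neighbours i x₀) one_pos)] with x hx
  exact hn _ hx

lemma contDiff_scaled_bump (hη : IsBumpProfile η) (i : Fin 4) (n : Fin 3 → ℤ) :
    ContDiff ℝ ∞ fun x : Config => ε ^ r * η ‖ε⁻¹ • (neighbours i x - latticePoint n)‖ :=
  have h : ContDiff ℝ ∞ fun x : Config => ε⁻¹ • (neighbours i x - latticePoint n) := by fun_prop
  contDiff_const.mul (hη.smooth.comp h)

lemma contDiff_couplingTerm (hη : IsBumpProfile η) (hε : 0 < ε) (hε1 : ε < 1) (i : Fin 4) :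
    ContDiff ℝ ∞ (couplingTerm η r ε i) := by
  rw [contDiff_iff_contDiffAt]
  intro x₀
  obtain ⟨n, hn⟩ := exists_couplingTerm_eq (r := r) hη hε hε1 i x₀
  exact (contDiff_scaled_bump hη i n).contDiffAt.congr_of_eventuallyEq hn

lemma hasFDerivAt_scaled_neighbours (i : Fin 4) (n : Fin 3 → ℤ) (x : Config) :
    HasFDerivAt (fun x : Config => ε⁻¹ • (neighbours i x - latticePoint n))
      (ε⁻¹ • neighbours i) x :=
  ((neighbours i).hasFDerivAt.sub_const _).fun_const_smul _

/-- Each derivative of the rescaled bump costs a factor `ε⁻¹`, which the amplitude `ε ^ r` with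
`r ≥ 3` more than compensates. -/
lemma couplingTerm_bounds (hη : IsBumpProfile η) (hr : 3 ≤ r) {M : ℝ} (hM0 : 0 < M)
    (hM : ∀ y : EuclideanSpace ℝ (Fin 3), η ‖y‖ ≤ M ∧ -M ≤ η ‖y‖ ∧
      ∀ u, |fderiv ℝ (fun y : EuclideanSpace ℝ (Fin 3) => η ‖y‖) y u| ≤ M * ‖u‖ ∧
        ∀ v, |fderiv ℝ (fun y => fderiv ℝ (fun y : EuclideanSpace ℝ (Fin 3) => η ‖y‖) y u) y v| ≤
          M * ‖u‖ * ‖v‖) (hε : 0 < ε) (hε1 : ε < 1) (i : Fin 4) (x : Config) :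
    |couplingTerm η r ε i x| ≤ M ∧ ∀ k, |partialDeriv k (couplingTerm η r ε i) x| ≤ 4 * M ∧
      ∀ v, |fderiv ℝ (partialDeriv k (couplingTerm η r ε i)) x v| ≤ 4 * M * ‖v‖ := by
  obtain ⟨n, hn⟩ := exists_couplingTerm_eq (r := r) hη hε hε1 i x
  set b : EuclideanSpace ℝ (Fin 3) → ℝ := fun y => η ‖y‖ with hb
  set ℓ : Config → EuclideanSpace ℝ (Fin 3) := fun x => ε⁻¹ • (neighbours i x - latticePoint n)
    with hℓ
  have hc0 : 0 < ε ^ r := Real.rpow_pos_of_pos hε r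
  have hc3 : ε ^ r ≤ ε ^ 3 := by
    have := Real.rpow_le_rpow_of_exponent_ge hε hε1.le hr
    rwa [show (3 : ℝ) = ((3 : ℕ) : ℝ) by norm_num, Real.rpow_natCast] at this
  have hc1 : ε ^ r * ε⁻¹ ≤ 1 := by
    rw [← div_eq_mul_inv, div_le_one hε]
    nlinarith [mul_pos hε hε]
  have hc2 : ε ^ r * ε⁻¹ * ε⁻¹ ≤ 1 := by
    rw [← div_eq_mul_inv, ← div_eq_mul_inv, div_div, div_le_one (by positivity)]
    nlinarith [mul_pos hε hε]
  have hcM : ε ^ r ≤ 1 := hc3.trans (pow_le_one₀ hε.le hε1.le)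
  have hbd : Differentiable ℝ b := hη.smooth.differentiable (by simp)
  have hfd : ∀ x' u, fderiv ℝ (fun x => ε ^ r * b (ℓ x)) x' u =
      ε ^ r * ε⁻¹ * fderiv ℝ b (ℓ x') (neighbours i u) := fun x' u => by
    have h1 := ((hbd (ℓ x')).hasFDerivAt.comp (f := ℓ) x'
      (hasFDerivAt_scaled_neighbours i n x')).const_mul (ε ^ r)
    have h2 := congrArg (fun L => L u) h1.fderiv
    refine h2.trans ?_
    simp only [smul_apply, ContinuousLinearMap.comp_apply, map_smul, smul_eq_mul]
    ring
  have he : ∀ k : Fin 4, ‖neighbours i (EuclideanSpace.single k (1 : ℝ))‖ ≤ 2 := fun k => by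
    have := norm_neighbours_le i (EuclideanSpace.single k (1 : ℝ))
    simpa using this
  have hpd : ∀ k, partialDeriv k (couplingTerm η r ε i) =ᶠ[𝓝 x] fun x' =>
      ε ^ r * ε⁻¹ * fderiv ℝ b (ℓ x') (neighbours i (EuclideanSpace.single k (1 : ℝ))) := fun k => by
    filter_upwards [hn.eventuallyEq_nhds] with x' hx'
    rw [partialDeriv, hx'.fderiv_eq]
    exact hfd x' _
  have hpos : 0 < ε ^ r * ε⁻¹ := by positivity
  refine ⟨?_, fun k => ⟨?_, fun v => ?_⟩⟩
  · rw [hn.self_of_nhds, abs_mul, abs_of_pos hc0]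
    have h1 : |η ‖ε⁻¹ • (neighbours i x - latticePoint n)‖| ≤ M :=
      abs_le.2 ⟨(hM _).2.1, (hM _).1⟩
    calc _ ≤ 1 * M := by gcongr
      _ = M := one_mul M
  · rw [(hpd k).self_of_nhds, abs_mul, abs_of_pos hpos]
    have h1 := ((hM (ℓ x)).2.2 (neighbours i (EuclideanSpace.single k (1 : ℝ)))).1
    have h2 : M * ‖neighbours i (EuclideanSpace.single k (1 : ℝ))‖ ≤ M * 2 := by
      gcongr; exact he k
    calc _ ≤ 1 * (M * 2) := by
          gcongr
          exact h1.trans h2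
      _ ≤ 4 * M := by linarith
  · rw [(hpd k).fderiv_eq]
    set e := neighbours i (EuclideanSpace.single k (1 : ℝ))
    have hs1 : ContDiff ℝ ∞ fun y => fderiv ℝ b y e :=
      (hη.smooth.fderiv_right (m := ∞) (by norm_num)).clm_apply contDiff_const
    have h1 := ((hs1.differentiable (by simp) (ℓ x)).hasFDerivAt.comp (f := ℓ) x
      (hasFDerivAt_scaled_neighbours i n x)).const_mul (ε ^ r * ε⁻¹)
    have h2 : fderiv ℝ (fun x' => ε ^ r * ε⁻¹ * fderiv ℝ b (ℓ x') e) x v =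
        ε ^ r * ε⁻¹ * ε⁻¹ * fderiv ℝ (fun y => fderiv ℝ b y e) (ℓ x) (neighbours i v) := by
      refine (congrArg (fun L => L v) h1.fderiv).trans ?_
      simp only [smul_apply, ContinuousLinearMap.comp_apply, map_smul, smul_eq_mul]
      ring
    rw [h2, abs_mul, abs_of_pos (by positivity)]
    have h3 := ((hM (ℓ x)).2.2 e).2 (neighbours i v)
    have h4 := norm_neighbours_le i v
    calc _ ≤ 1 * (M * 2 * (2 * ‖v‖)) := by
          gcongr
          refine h3.trans ?_
          gcongr
          exact he k
      _ = _ := by ring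

lemma couplingTerm_eq_zero (hη : IsBumpProfile η) (hε : 0 < ε) (hε1 : ε ≤ 1 / 30) {i j : Fin 4}
    (hj : j = i - 1 ∨ j = i ∨ j = i + 1) {x : Config} (hx : Real.cos (x j) < 999 / 1000) :
    couplingTerm η r ε i x = 0 := by
  rw [couplingTerm, coupling]
  refine mul_eq_zero_of_right _ ?_
  refine (tsum_congr fun n => ?_).trans tsum_zero
  refine hη.eq_zero_of_le hε ?_
  by_contra! hlt
  obtain ⟨m, hm⟩ : ∃ m : ℤ, |x j - 2 * Real.pi * m| < ε := by
    have key : ∀ l : Fin 3, |neighbours i x l - 2 * Real.pi * (n l : ℝ)| < ε := fun l =>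
      lt_of_le_of_lt (PiLp.norm_apply_le (neighbours i x - latticePoint n) l) hlt
    rcases hj with rfl | rfl | rfl
    · exact ⟨n 0, key 0⟩
    · exact ⟨n 1, key 1⟩
    · exact ⟨n 2, key 2⟩
  have h1 : Real.cos (x j) = Real.cos (x j - 2 * Real.pi * m) := by
    rw [mul_comm, Real.cos_sub_int_mul_two_pi]
  have h2 := Real.one_sub_sq_div_two_le_cos (x := x j - 2 * Real.pi * m)
  have h3 : (x j - 2 * Real.pi * m) ^ 2 ≤ (1 / 30) ^ 2 := sq_le_sq.2 (by
    rw [abs_of_pos (by norm_num : (0 : ℝ) < 1 / 30)]; linarith)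
  linarith

/-- The coupling potential `κ ε ∑ β`. -/
def couplingPotential (η : ℝ → ℝ) (r κ ε : ℝ) (x : Config) : ℝ :=
  κ * ε * ∑ i, couplingTerm η r ε i x

lemma jacobiFactor_eq (κ : ℝ) :
    jacobiFactor η r κ ε = conformalFactor (couplingPotential η r κ ε) := by
  ext x
  simp only [jacobiFactor, conformalFactor, couplingPotential, pendulumPotential, couplingTerm,
    neighbours_apply, Finset.sum_add_distrib, Finset.mul_sum, Finset.sum_sub_distrib,
    Finset.sum_neg_distrib]
  simp
  ring

/-- The coupling potential is small in the `C²` sense, uniformly in `κ`. -/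
theorem exists_isSmallCoupling (hη : IsBumpProfile η) (hr : 3 ≤ r) :
    ∃ K : ℝ, 0 < K ∧ ∀ ε, 0 < ε → ε ≤ 1 / 30 → K * ε ≤ 1 → ∀ κ : ℝ, κ = 1 ∨ κ = -1 →
      IsSmallCoupling (K * ε) (couplingPotential η r κ ε) := by
  obtain ⟨M, hM0, hM⟩ := hη.exists_bound
  refine ⟨32 * M, by positivity, fun ε hε hε1 hKε κ hκ => ?_⟩
  have hε2 : ε < 1 := by linarith
  have hb := couplingTerm_bounds hη hr hM0 hM hε hε2
  have hκ1 : |κ| = 1 := by rcases hκ with rfl | rfl <;> simp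
  have hκε : |κ * ε| = ε := by rw [abs_mul, hκ1, one_mul, abs_of_pos hε]
  have hs := contDiff_couplingTerm (r := r) hη hε hε2
  have hd : ∀ i, Differentiable ℝ (couplingTerm η r ε i) := fun i =>
    (hs i).differentiable (by simp)
  have hpd : ∀ k, partialDeriv k (couplingPotential η r κ ε) = fun x =>
      κ * ε * ∑ i, partialDeriv k (couplingTerm η r ε i) x := fun k => by
    ext x
    have h1 := ((HasFDerivAt.fun_sum (u := Finset.univ) fun i _ => (hd i x).hasFDerivAt).const_mul
      (κ * ε))
    have h2 : fderiv ℝ (couplingPotential η r κ ε) x = _ := h1.fderiv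
    rw [partialDeriv, h2]
    simp [partialDeriv]
  have hsum : ∀ (a : Fin 4 → ℝ) (m : ℝ), (∀ i, |a i| ≤ m) → |κ * ε * ∑ i, a i| ≤ ε * (4 * m) := by
    intro a m ha
    rw [abs_mul, hκε]
    have : |∑ i, a i| ≤ 4 * m := by
      refine (Finset.abs_sum_le_sum_abs _ _).trans ((Finset.sum_le_sum fun i _ => ha i).trans ?_)
      simp
    gcongr
  refine ⟨contDiff_const.mul (ContDiff.sum fun i _ => hs i), fun x => ?_, fun x => ?_, fun x y => ?_,
    fun x i j hij hi hj => ?_⟩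
  · have := (abs_le.1 (hsum _ _ fun i => (hb i x).1)).2
    change κ * ε * ∑ i, couplingTerm η r ε i x ≤ _
    linarith
  · have h1 : ∀ k, |partialDeriv k (couplingPotential η r κ ε) x| ≤ ε * (4 * (4 * M)) := fun k => by
      rw [hpd]
      exact hsum _ _ fun i => ((hb i x).2 k).1
    refine (norm_le_two_mul (w := WithLp.toLp 2 fun i => partialDeriv i _ x) h1).trans
      (le_of_eq (by ring))
  · have h1 : ∀ k, |partialDeriv k (couplingPotential η r κ ε) x -
        partialDeriv k (couplingPotential η r κ ε) y| ≤ ε * (4 * (4 * M)) * ‖x - y‖ := fun k => by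
      have hdk : ∀ i, Differentiable ℝ (partialDeriv k (couplingTerm η r ε i)) := fun i =>
        (contDiff_partialDeriv (hs i) k).differentiable (by simp)
      have hD : Differentiable ℝ (partialDeriv k (couplingPotential η r κ ε)) := by
        rw [hpd]
        fun_prop
      refine convex_univ.norm_image_sub_le_of_norm_fderiv_le (𝕜 := ℝ) (fun z _ => hD z)
        (fun z _ => ContinuousLinearMap.opNorm_le_bound _ (by positivity) fun v => ?_)
        (mem_univ y) (mem_univ x)
      have h2 := ((HasFDerivAt.fun_sum (u := Finset.univ) fun i _ => (hdk i z).hasFDerivAt).const_mul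
        (κ * ε))
      rw [hpd, h2.fderiv, Real.norm_eq_abs]
      simp only [smul_apply, sum_apply, smul_eq_mul]
      refine (hsum _ _ fun i => ((hb i z).2 k).2 v).trans (le_of_eq (by ring))
    refine (norm_le_two_mul (w := WithLp.toLp 2 (fun i => partialDeriv i _ x) -
      WithLp.toLp 2 fun i => partialDeriv i _ y) h1).trans (le_of_eq (by ring))
  · refine mul_eq_zero_of_right _ (Finset.sum_eq_zero fun k _ => ?_)
    have hcase : (i = k - 1 ∨ i = k ∨ i = k + 1) ∨ (j = k - 1 ∨ j = k ∨ j = k + 1) := by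
      have h : ∀ i j k : Fin 4, i ≠ j →
          (i = k - 1 ∨ i = k ∨ i = k + 1) ∨ (j = k - 1 ∨ j = k ∨ j = k + 1) := by decide
      exact h i j k hij
    rcases hcase with h | h
    · exact couplingTerm_eq_zero hη hε hε1 h hi
    · exact couplingTerm_eq_zero hη hε hε1 h hj

end Coupling

/-! ### Steps of an itinerary -/

/-- A family of swings over the angle `2 π ν`, with constants that do not depend on `ν`. The lower
bound for the energy makes long swings fast. -/
structure IsLink (α ν : ℝ) (V₀ V₁ : ℝ × ℝ × ℝ → ℝ) : Prop where
  swing : IsSwingFamily 1000 16000 α (α + 2 * Real.pi * ν) V₀ V₁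
  energy_ge : ∀ q ∈ windowDomain (Ioi 16000),
    (2 * Real.pi * |ν| - 1) ^ 2 / (2 * q.2.2 ^ 2) - 2 ≤ pendEnergy (α + q.1) (V₀ q)

/-- The energy bound in `IsLink` is automatic for swings over an angle of at most `π`. -/
lemma IsSwingFamily.isLink {α ν α' β' : ℝ} {V₀ V₁ : ℝ × ℝ × ℝ → ℝ}
    (h : IsSwingFamily 1000 60 α' β' V₀ V₁) (hα : α' = α) (hβ : β' = α + 2 * Real.pi * ν)
    (hν : |ν| ≤ 1 / 2) : IsLink α ν V₀ V₁ := by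
  subst hα hβ
  have h' := h.mono (C' := 1000) (T₀' := 16000) (by norm_num) le_rfl (by norm_num)
  refine ⟨h', fun q hq => le_trans ?_ (h'.energy_ge q hq)⟩
  have hT : (16000 : ℝ) < q.2.2 := hq.2.2
  have hT2 : (16000 : ℝ) ^ 2 ≤ q.2.2 ^ 2 := by gcongr
  have h1 : (2 * Real.pi * |ν| - 1) ^ 2 ≤ 16 := by
    have := abs_nonneg ν
    have := Real.pi_le_four
    have h0 : 2 * Real.pi * |ν| ≤ 4 := by nlinarith [Real.pi_pos]
    have h3 : 0 ≤ 2 * Real.pi * |ν| := by positivity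
    nlinarith
  have h2 : (2 * Real.pi * |ν| - 1) ^ 2 / (2 * q.2.2 ^ 2) ≤ 1 :=
    (div_le_one (by positivity)).2 (by linarith)
  have h3 : 1000 / q.2.2 ^ 2 ≤ 1 := (div_le_one (by positivity)).2 (by linarith)
  linarith

lemma exists_isLink_bottom_upright (a : ℤ) : ∃ V₀ V₁, IsLink (2 * Real.pi * a) (1 / 2) V₀ V₁ := by
  obtain ⟨V₀, V₁, h, -⟩ := exists_linger_family isApproach_bottom isApproach_upright
  exact ⟨V₀, V₁, (h.translate a).isLink (add_zero _) (by ring) (by norm_num)⟩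

lemma exists_isLink_upright_upright (a : ℤ) : ∃ V₀ V₁,
    IsLink (2 * Real.pi * a + Real.pi) 0 V₀ V₁ ∧
      StaysAway 16000 (2 * Real.pi * a + Real.pi) V₀ := by
  obtain ⟨V₀, V₁, h, h'⟩ := exists_linger_family isApproach_upright isApproach_upright
  exact ⟨V₀, V₁, (h.translate a).isLink rfl (by ring) (by norm_num),
    (h'.translate a).mono (by norm_num)⟩

/-- The motion from the upright position down to the next bottom is a mirror image of the one to
the previous bottom. -/
lemma exists_isLink_upright_bottom (a : ℤ) : ∃ V₀ V₁,
    IsLink (2 * Real.pi * a + Real.pi) (1 / 2) V₀ V₁ ∧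
      StaysAway 16000 (2 * Real.pi * a + Real.pi) V₀ := by
  obtain ⟨V₀, V₁, h, h'⟩ := exists_linger_family isApproach_upright isApproach_bottom
  have he : 2 * Real.pi * ((a + 1 : ℤ) : ℝ) + -Real.pi = 2 * Real.pi * a + Real.pi := by
    push_cast; ring
  refine ⟨_, _, (h.reflect.translate (a + 1)).isLink he (by push_cast; ring) (by norm_num), ?_⟩
  rw [← he]
  exact (h'.reflect.translate (a + 1)).mono (by norm_num)

lemma exists_isLink_zero_int (m : ℤ) : ∃ V₀ V₁,
    IsLink 0 m V₀ V₁ ∧ (m = 1 → StaysAway 16000 0 V₀) := by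
  rcases eq_or_ne m 0 with rfl | hm
  · obtain ⟨V₀, V₁, h, -⟩ := exists_linger_family isApproach_bottom isApproach_bottom
    exact ⟨V₀, V₁, h.isLink rfl (by simp) (by simp), by simp⟩
  obtain ⟨V₀, V₁, h, hE, hS⟩ := exists_rotation_family m.natAbs (Int.natAbs_pos.2 hm)
  have hk : ((m.natAbs : ℕ) : ℝ) = |(m : ℝ)| := by rw [Nat.cast_natAbs, Int.cast_abs]
  have hD : windowDomain (Ioi 16000) ⊆ windowDomain (Ioi 1) :=
    windowDomain_mono (Ioi_subset_Ioi (by norm_num))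
  have h' := h.mono (C' := 1000) (T₀' := 16000) (by norm_num) (by norm_num) (by norm_num)
  rw [hk] at h' hE
  rcases hm.lt_or_gt with hneg | hpos
  · have hm' : |(m : ℝ)| = -m := abs_of_neg (by exact_mod_cast hneg)
    refine ⟨fun q => -V₀ (flipWindow q), fun q => -V₁ (flipWindow q), ⟨?_, fun q hq => ?_⟩,
      fun h1 => by omega⟩
    · have := h'.reflect
      rwa [hm', neg_zero, mul_neg, neg_neg, ← zero_add (2 * Real.pi * (m : ℝ))] at this
    · refine (hE _ (hD (flipWindow_mem hq))).trans (le_of_eq ?_)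
      rw [pendEnergy, pendEnergy, neg_sq, ← Real.cos_neg (0 + q.1), flipWindow_apply, neg_add,
        neg_zero]
  · have hm' : |(m : ℝ)| = m := abs_of_pos (by exact_mod_cast hpos)
    refine ⟨V₀, V₁, ⟨?_, fun q hq => hE q (hD hq)⟩, fun h1 => ?_⟩
    · rwa [hm', ← zero_add (2 * Real.pi * (m : ℝ))] at h'
    · exact (hS (by omega)).mono (by norm_num)

lemma exists_isLink_int (a m : ℤ) : ∃ V₀ V₁,
    IsLink (2 * Real.pi * a) m V₀ V₁ ∧ (m = 1 → StaysAway 16000 (2 * Real.pi * a) V₀) := by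
  obtain ⟨V₀, V₁, h, hS⟩ := exists_isLink_zero_int m
  refine ⟨V₀, V₁, ⟨?_, fun q hq => ?_⟩, fun h1 => ?_⟩
  · simpa using h.swing.translate a
  · refine (h.energy_ge q hq).trans (le_of_eq ?_)
    rw [zero_add, pendEnergy_translate]
  · simpa using (hS h1).translate a

/-- The pendula `j₀ + 2` and `j₀ + 3` are both away from the bottom throughout the step, so that the
coupling, which couples only pendula near the bottom, is not felt. -/
lemma IsItineraryStep.exists_isLink {j₀ j₁ : Fin 4} {a₀ a₁ : Fin 4 → ℤ} {ν : Config}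
    (h : IsItineraryStep j₀ a₀ j₁ a₁ ν) (i : Fin 4) : ∃ V₀ V₁,
      IsLink (center j₀ a₀ i) (ν i) V₀ V₁ ∧
        (i = j₀ + 2 ∨ i = j₀ + 3 → StaysAway 16000 (center j₀ a₀ i) V₀) := by
  have hj : ∀ j i : Fin 4, i = j ∨ i = j + 1 ∨ i = j + 2 ∨ i = j + 3 := by decide
  have h01 : ∀ j : Fin 4, j + 1 ≠ j := by decide
  have h02 : ∀ j : Fin 4, j + 2 ≠ j := by decide
  have h03 : ∀ j : Fin 4, j + 3 ≠ j := by decide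
  have h12 : ∀ j : Fin 4, j + 2 ≠ j + 1 := by decide
  have h13 : ∀ j : Fin 4, j + 3 ≠ j + 1 := by decide
  have h23 : ∀ j : Fin 4, j + 3 ≠ j + 2 := by decide
  have hc : ∀ i, i ≠ j₀ + 3 → center j₀ a₀ i = 2 * Real.pi * a₀ i := fun i hi => by
    simp [center, hi]
  have hc3 : center j₀ a₀ (j₀ + 3) = 2 * Real.pi * a₀ (j₀ + 3) + Real.pi := by simp [center]
  rcases h.2 with ⟨-, m, n, rfl⟩ | ⟨-, s, rfl⟩
  · rcases hj j₀ i with rfl | rfl | rfl | rfl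
    · obtain ⟨V₀, V₁, hV, -⟩ := exists_isLink_int (a₀ i) m
      rw [hc _ (h03 _).symm]
      exact ⟨V₀, V₁, by simpa [transferVector] using hV,
        fun h => h.elim (fun h => absurd h.symm (h02 _)) fun h => absurd h.symm (h03 _)⟩
    · obtain ⟨V₀, V₁, hV, -⟩ := exists_isLink_int (a₀ (j₀ + 1)) n
      rw [hc _ (h13 _).symm]
      exact ⟨V₀, V₁, by simpa [transferVector, h01] using hV,
        fun h => h.elim (fun h => absurd h.symm (h12 _)) fun h => absurd h.symm (h13 _)⟩
    · obtain ⟨V₀, V₁, hV, hS⟩ := exists_isLink_int (a₀ (j₀ + 2)) 1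
      rw [hc _ (h23 _).symm]
      exact ⟨V₀, V₁, by simpa [transferVector, h02, h12] using hV, fun _ => hS rfl⟩
    · obtain ⟨V₀, V₁, hV, hS⟩ := exists_isLink_upright_upright (a₀ (j₀ + 3))
      rw [hc3]
      exact ⟨V₀, V₁, by simpa [transferVector, h03, h13, h23] using hV, fun _ => hS⟩
  · rcases hj j₀ i with rfl | rfl | rfl | rfl
    · obtain ⟨V₀, V₁, hV⟩ := exists_isLink_bottom_upright (a₀ i)
      rw [hc _ (h03 _).symm]
      exact ⟨V₀, V₁, by simpa [advanceVector] using hV,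
        fun h => h.elim (fun h => absurd h.symm (h02 _)) fun h => absurd h.symm (h03 _)⟩
    · obtain ⟨V₀, V₁, hV, -⟩ := exists_isLink_int (a₀ (j₀ + 1)) s
      rw [hc _ (h13 _).symm]
      exact ⟨V₀, V₁, by simpa [advanceVector, h01] using hV,
        fun h => h.elim (fun h => absurd h.symm (h12 _)) fun h => absurd h.symm (h13 _)⟩
    · obtain ⟨V₀, V₁, hV, hS⟩ := exists_isLink_int (a₀ (j₀ + 2)) 1
      rw [hc _ (h23 _).symm]
      exact ⟨V₀, V₁, by simpa [advanceVector, h02, h12] using hV, fun _ => hS rfl⟩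
    · obtain ⟨V₀, V₁, hV, hS⟩ := exists_isLink_upright_bottom (a₀ (j₀ + 3))
      rw [hc3]
      exact ⟨V₀, V₁, by simpa [advanceVector, h03, h13, h23] using hV, fun _ => hS⟩

/-- If one of the swings is long, then the total energy is at least `1` for some duration, namely
for the one in which the long swing is traversed with mean speed about `3`. -/
lemma exists_one_le_totalEnergy {α β : Fin 4 → ℝ} {ν : Config} {V₀ V₁ : Fin 4 → ℝ × ℝ × ℝ → ℝ}
    (hV : ∀ i, IsLink (α i) (ν i) (V₀ i) (V₁ i)) (hν : 32000 < ‖ν‖) {p : Config × Config}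
    (hp : p ∈ endPoints α β) : ∃ T > 16000, 1 ≤ totalEnergy α β V₀ (p, T) := by
  obtain ⟨i, hi⟩ : ∃ i, 16000 < |ν i| := by
    by_contra! hle
    linarith [norm_le_two_mul hle]
  have hT : 16000 < (2 * Real.pi * |ν i| - 1) / 3 := by
    nlinarith [Real.pi_gt_three]
  refine ⟨_, hT, ?_⟩
  set T := (2 * Real.pi * |ν i| - 1) / 3 with hTdef
  have hα : ∀ k, p.1 k = α k + (motionParam α β k p T).1 := fun k => by simp [motionParam]
  have h1 : 5 / 2 ≤ pendEnergy (p.1 i) (V₀ i (motionParam α β i p T)) := by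
    have h2 := (hV i).energy_ge _ (motionParam_mem hp hT i)
    rw [← hα] at h2
    refine le_trans (le_of_eq ?_) h2
    change _ = _ / (2 * T ^ 2) - 2
    rw [show 2 * Real.pi * |ν i| - 1 = 3 * T by rw [hTdef]; ring]
    have : T ≠ 0 := by linarith
    field_simp
    norm_num
  have h2 : ∀ k, -(1 / 4) ≤ pendEnergy (p.1 k) (V₀ k (motionParam α β k p T)) := fun k => by
    have h3 := (hV k).swing.energy_ge _ (motionParam_mem hp hT k)
    rw [← hα] at h3
    refine le_trans (neg_le_neg ?_) h3
    change 1000 / T ^ 2 ≤ _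
    rw [div_le_iff₀ (by positivity)]
    nlinarith
  have h3 : totalEnergy α β V₀ (p, T) =
      ∑ k, (pendEnergy (p.1 k) (V₀ k (motionParam α β k p T)) + 1 / 4) - 1 := by
    rw [totalEnergy, Finset.sum_add_distrib]
    simp
  have h4 := Finset.single_le_sum (f := fun k =>
    pendEnergy (p.1 k) (V₀ k (motionParam α β k p T)) + 1 / 4) (s := Finset.univ)
    (fun k _ => by linarith [h2 k]) (Finset.mem_univ i)
  simp only at h4
  linarith

lemma dist_center_lt {ε : ℝ} (hε1 : ε < 1 / 6400) {j : Fin 4} {a : Fin 4 → ℤ}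
    {x : Config} (hx : x ∈ crossSection ε j a) : dist x (center j a) < 1 / 40 := by
  obtain ⟨h2, h01, h3⟩ := hx
  have hs : √ε < 1 / 80 := (Real.sqrt_lt' (by norm_num)).2 (by linarith)
  have hj : ∀ j i : Fin 4, i = j ∨ i = j + 1 ∨ i = j + 2 ∨ i = j + 3 := by decide
  have h : ∀ i, |(x - center j a) i| ≤ √ε := fun i => by
    change |x i - center j a i| ≤ √ε
    rcases hj j i with rfl | rfl | rfl | rfl
    · exact Real.abs_le_sqrt (by nlinarith [sq_nonneg (x (i + 1) - center i a (i + 1))])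
    · exact Real.abs_le_sqrt (by nlinarith [sq_nonneg (x j - center j a j)])
    · rw [h2, sub_self, abs_zero]; exact Real.sqrt_nonneg ε
    · exact h3
  rw [dist_eq_norm]
  linarith [norm_le_two_mul h]

end PendulumLattice

end

open PendulumLattice

theorem lemma3 (η : ℝ → ℝ) (hη : PendulumLattice.IsBumpProfile η) (r : ℝ) (hr : 3 ≤ r) :
    ∃ ε₀ : ℝ, 0 < ε₀ ∧ ∀ ε : ℝ, 0 < ε → ε < ε₀ →
      ∀ κ : ℝ, κ = 1 ∨ κ = -1 →
      ∀ (j₀ : Fin 4) (a₀ : Fin 4 → ℤ) (j₁ : Fin 4) (a₁ : Fin 4 → ℤ)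
        (ν : PendulumLattice.Config),
        PendulumLattice.IsItineraryStep j₀ a₀ j₁ a₁ ν → 1 / ε < ‖ν‖ →
        ∃ γ : PendulumLattice.Config × PendulumLattice.Config × ℝ → PendulumLattice.Config,
          PendulumLattice.SmoothOnSubset γ
            (PendulumLattice.crossSection ε j₀ a₀ ×ˢ
              (PendulumLattice.crossSection ε j₁ a₁ ×ˢ Set.Icc (0 : ℝ) 1)) ∧
          ∀ p₀ ∈ PendulumLattice.crossSection ε j₀ a₀,
            ∀ p₁ ∈ PendulumLattice.crossSection ε j₁ a₁,
              PendulumLattice.IsGeodesicOn (PendulumLattice.jacobiMetric η r κ ε)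
                (fun t => γ (p₀, p₁, t)) (Set.Icc 0 1) ∧
              γ (p₀, p₁, 0) = p₀ ∧ γ (p₀, p₁, 1) = p₁ := by
  obtain ⟨K, hK, hP⟩ := PendulumLattice.exists_isSmallCoupling hη hr
  -- the first bound makes one of the swings longer than `16000` turns and keeps the sections in
  -- balls of radius `1 / 40`, the second one makes the coupling small enough for `exists_geodesics`
  refine ⟨min (1 / 32000) (1 / (10000000 * 1000 ^ 2 * K)), by positivity, ?_⟩
  intro ε hε hε₀ κ hκ j₀ a₀ j₁ a₁ ν hstep hν
  have hε1 : ε < 1 / 32000 := hε₀.trans_le (min_le_left _ _)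
  have hε2 : 10000000 * 1000 ^ 2 * K * ε < 1 := by
    have h := hε₀.trans_le (min_le_right _ _)
    rw [lt_div_iff₀ (by positivity)] at h
    linarith
  have hν1 : 32000 < ‖ν‖ := lt_trans (by rw [lt_div_iff₀ hε]; linarith) hν
  choose V₀ V₁ hV hS using hstep.exists_isLink
  have hβ : ∀ i, center j₁ a₁ i = center j₀ a₀ i + 2 * Real.pi * ν i := fun i => by
    rw [hstep.1]; simp
  have h23 : ∀ j : Fin 4, j + 2 ≠ j + 3 := by decide
  have hcoupling := hP ε hε (by linarith) (by linarith) κ hκ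
  obtain ⟨γ, hγs, hγ⟩ := exists_geodesics (C := 1000) (T₀ := 16000) (α := center j₀ a₀)
    (β := center j₁ a₁) (by norm_num) (by norm_num)
    (fun i => by rw [hβ]; exact (hV i).swing) (fun p hp => exists_one_le_totalEnergy hV hν1 hp)
    (i₁ := j₀ + 2) (i₂ := j₀ + 3) (h23 j₀) (hS _ (Or.inl rfl)) (hS _ (Or.inr rfl))
    hcoupling (by linarith)
  have hball : ∀ p₀ ∈ crossSection ε j₀ a₀, ∀ p₁ ∈ crossSection ε j₁ a₁,
      (p₀, p₁) ∈ Metric.ball (endCenter (center j₀ a₀) (center j₁ a₁)) (1 / 40) :=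
    fun p₀ h₀ p₁ h₁ => by
      rw [Metric.mem_ball, Prod.dist_eq]
      exact max_lt (dist_center_lt (by linarith) h₀) (dist_center_lt (by linarith) h₁)
  refine ⟨γ, ⟨_, ?_, fun q hq => hball _ hq.1 _ hq.2.1, hγs⟩, fun p₀ h₀ p₁ h₁ => ?_⟩
  · exact Metric.isOpen_ball.preimage (by fun_prop : Continuous
      fun q : Config × Config × ℝ => (q.1, q.2.1))
  · have h := hγ _ (hball p₀ h₀ p₁ h₁)
    rw [← jacobiFactor_eq] at h
    exact h
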